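/- **Setting.** Let $\Omega\subset\mathbb R^2$ be a bounded domain, $T>0$, $m,p\in\mathbb N$ with $p\ge 1$. Let $\xi_i,\ \omega=(\omega_1,\omega_2),\ \mathsf A(i,j),\ \mathsf Q(i,\ell,j),\ \mathsf R(i,j)$ ($1\le i,j,\ell\le m$) be functions of $(t,x)\in[0,T]\times\Omega$ that are measurable in $x$ and bounded uniformly in $t$ and $x$, with $\xi_i\ge\xi_0$ for a constant $\xi_0>0$, and let $f_i(t,\cdot)\in L^2(\Omega)$ for every $t\in[0,T]$. *Meshes.* $\mathcal T_h$ is a finite partition of $\Omega$ into polygons $E$ (bounded by simple closed polygonal curves, angles $\pi$ allowed). With fixed constants $\delta,c>0$, every $E$, of diameter $h_E$, is star-shaped with respect to a disc of radius $\delta h_E$, and its edges have length at least $c\,h_E$. *Projections.* $\mathbb P_k$ is the space of polynomials of degree at most $k$ ($\mathbb P_{-1}=\{0\}$). Elementwise, $\mathcal P$ is the $L^2(E)$-projection onto $\mathbb P_p(E)$, $\boldsymbol{\mathcal P}$ is the $L^2(E)$-projection onto $(\mathbb P_{p-1}(E))^2$, and $\Pi=\mathcal P_p^\nabla:H^1(E)\to\mathbb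 P_p(E)$ is given by $(\nabla(u-\Pi u),\nabla q)_E=0$ for all $q\in\mathbb P_p(E)$ and $\int_{\partial E}(\Pi u-u)\,ds=0$. *Spaces.* $W_E^p$ is the set of $v\in H^1(E)$ whose trace on $\partial E$ is continuous and is a polynomial of degree at most $p$ on every edge, with $\Delta v\in\mathbb P_p(E)$. For each $E$ let $\mathbb P_p(E)/\mathbb P_{p-2}(E)$ be represented by any fixed complement of $\mathbb P_{p-2}(E)$ in $\mathbb P_p(E)$, and let $V_E^p=\{v\in W_E^p:\ (v-\Pi v,q)_E=0\ \ \forall q\in \mathbb P_p(E)/\mathbb P_{p-2}(E)\}$ and $V_h^p=\{v\in H^1_0(\Omega):\ v|_E\in V_E^p\ \ \forall E\in\mathcal T_h\}$. *Forms.* Let $\widetilde S_1^E,\widetilde S_2^E$ be symmetric bilinear forms on $V_E^p$ such that, with constants $0<\alpha_*\le\alpha^*$ and $0<\beta_*\le\beta^*$, $\alpha_*\|v\|_{0,E}^2\le\widetilde S^E_1(v,v)\le\alpha^*\|v\|_{0,E}^2$ for $v\in V_E^p$ with $\mathcal Pv=0$, and $\beta_*\|\nabla v\|_{0,E}^2\le\widetilde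 S^E_2(v,v)\le\beta^*\|\nabla v\|_{0,E}^2$ for $v\in V_E^p$ with $\Pi v=0$. Let $(\cdot,\cdot)_0=\sum_E(\cdot,\cdot)_{0,E}$. For a time step $\delta t=T/N$ ($N\in\mathbb N$, $N\ge1$) and $t_n=n\,\delta t$, evaluate all coefficients at $t_n$, write $f_i^n=f_i(t_n)$, and put $$m_h(u,v)=(\mathcal Pu,\mathcal Pv)_0+\sum_E\widetilde S_1^E((I-\mathcal P)u,(I-\mathcal P)v),$$ $$a_h(u,v)=(\xi_i\boldsymbol{\mathcal P}\nabla u,\boldsymbol{\mathcal P}\nabla v)_0+\sum_E\|\xi_i(t_n)\|_{L^\infty(E)}\,\widetilde S_2^E((I-\Pi)u,(I-\Pi)v)$$ (the form $a_h$ depends on $i$ and $n$). *The linearized scheme.* Given $U^{n-1}\in[V_h^p]^m$, find $U^n\in[V_h^p]^m$ such that for all $V\in[V_h^p]^m$ $$\sum_{i=1}^m\Big\{m_h(U_i^n-U_i^{n-1},V_i)+\delta t\,a_h(U_i^n,V_i)+\delta t\,(\omega\cdot\boldsymbol{\mathcal P}\nabla U_i^n,\mathcal PV_i)_0+\delta t\,\big(\mathcal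 PU_i^n\sum_{j=1}^m\mathsf A(i,j)\mathcal PU_j^{n-1},\mathcal PV_i\big)_0+\delta t\,(\mathsf R(i,i)\mathcal PU_i^n,\mathcal PV_i)_0\Big\}$$ $$=\delta t\sum_{i=1}^m\Big\{-\big(\sum_{\ell\ne i}\sum_{j\neq i}\mathsf Q(i,\ell,j)\mathcal PU_\ell^{n-1}\mathcal PU_j^{n-1},\mathcal PV_i\big)_0-\big(\sum_{j\ne i}\mathsf R(i,j)\mathcal PU_j^{n-1},\mathcal PV_i\big)_0+(f_i^n,\mathcal PV_i)_0\Big\}.$$ **Theorem.** Let $\mu>0$. There is $\delta t_0>0$, depending only on $\Omega$, $T$, $m$, $p$, the coefficients, $\delta$, $c$, $\alpha_*,\alpha^*,\beta_*,\beta^*$ and $\mu$ (in particular not on the mesh within this class, on $n$, or on the iterates), such that for every such mesh, choice of complements and stabilizations, and every $N\ge 1$ with $\delta t=T/N<\delta t_0$: 1. For every $1\le n\le N$ and every $U^{n-1}\in[V_h^p]^m$ with $\|U_i^{n-1}\|_{L^\infty(\Omega)}\le\mu+1$ for all $i$, the linearized scheme has a solution $U^n\in[V_h^p]^m$, and it is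 unique. 2. Let $u^0\in[V_h^p]^m$, and suppose that for each $0\le n<N$ every $(U^0,\dots,U^n)$ with $U^0=u^0$ that solves the linearized scheme at the levels $1,\dots,n$ satisfies $\|U_i^n\|_{L^\infty(\Omega)}\le\mu+1$ for all $i$. Then there is exactly one $(U^0,\dots,U^N)$ in $[V_h^p]^m$ with $U^0=u^0$ that solves the linearized scheme at all levels $1,\dots,N$. -/

import Mathlib

open MeasureTheory Filter Topology Set
open scoped ContDiff

noncomputable section

namespace VEM

/-- The plane with its Euclidean norm. -/
abbrev Pt : Type := EuclideanSpace ℝ (Fin 2)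

/-! ### Sobolev spaces of order one -/

/-- Test functions `φ ∈ C_c^∞(U)`. -/
def IsTest (U : Set Pt) (φ : Pt → ℝ) : Prop :=
  ContDiff ℝ ∞ φ ∧ HasCompactSupport φ ∧ tsupport φ ⊆ U

/-- `u ∈ L²(U)` has the weak gradient `g ∈ L²(U)²` in `U`. -/
def HasWeakGrad (U : Set Pt) (u : Pt → ℝ) (g : Pt → Pt) : Prop :=
  MemLp u 2 (volume.restrict U) ∧ MemLp g 2 (volume.restrict U) ∧
    ∀ φ : Pt → ℝ, IsTest U φ →
      ∫ x in U, u x • gradient φ x = - ∫ x in U, φ x • g x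

/-- `u ∈ H¹(U)`. -/
def MemH1 (U : Set Pt) (u : Pt → ℝ) : Prop := ∃ g : Pt → Pt, HasWeakGrad U u g

open Classical in
/-- The weak gradient of `u` in `U` (unique almost everywhere in an open set `U`);
zero if `u ∉ H¹(U)`. -/
def weakGrad (U : Set Pt) (u : Pt → ℝ) : Pt → Pt :=
  if h : MemH1 U u then h.choose else 0

/-- `u ∈ H¹₀(U)`, the closure of `C_c^∞(U)` in `H¹(U)`. -/
def MemH10 (U : Set Pt) (u : Pt → ℝ) : Prop :=
  MemH1 U u ∧ ∃ φ : ℕ → Pt → ℝ, (∀ k, IsTest U (φ k)) ∧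
    Tendsto (fun k => eLpNorm (fun x => u x - φ k x) 2 (volume.restrict U)) atTop (𝓝 0) ∧
    Tendsto (fun k => eLpNorm (fun x => weakGrad U u x - gradient (φ k) x) 2
      (volume.restrict U)) atTop (𝓝 0)

/-- The values that `v` takes on `∂U` are its boundary trace, and this trace is continuous:
some `G ∈ H¹(U) ∩ C⁰(closure U)` equals `v` on `∂U`, and `v - G ∈ H¹₀(U)`. -/
def HasContinuousTrace (U : Set Pt) (v : Pt → ℝ) : Prop :=
  ContinuousOn v (frontier U) ∧
  ∃ G : Pt → ℝ, ContinuousOn G (closure U) ∧ MemH1 U G ∧ EqOn G v (frontier U) ∧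
    MemH10 U (fun x => v x - G x)

/-! ### Polynomials -/

/-- `ℙ_k`, the polynomial functions of two variables of total degree at most `k`;
`ℙ_k = {0}` for `k < 0`. -/
def polySpace (k : ℤ) : Submodule ℝ (Pt → ℝ) :=
  Submodule.span ℝ
    {f | ∃ a b : ℕ, ((a : ℤ) + (b : ℤ) ≤ k) ∧ f = fun x : Pt => x 0 ^ a * x 1 ^ b}

/-! ### Polygons and meshes -/

/-- An open polygon: a bounded connected open set whose boundary is a simple closed polygonal
curve. Angles equal to `π` are allowed at the vertices. -/
structure Polygon where
  /-- number of vertices, which is the number of edges -/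
  n : ℕ
  three_le : 3 ≤ n
  /-- the vertices in cyclic order -/
  vert : Fin n → Pt
  /-- the interior of the polygon -/
  carrier : Set Pt
  isOpen : IsOpen carrier
  isBounded : Bornology.IsBounded carrier
  isConnected : IsConnected carrier
  frontier_eq : frontier carrier = ⋃ i, segment ℝ (vert i) (vert (finRotate n i))
  vert_injective : Function.Injective vert
  adjacent : ∀ i,
    segment ℝ (vert i) (vert (finRotate n i)) ∩
      segment ℝ (vert (finRotate n i)) (vert (finRotate n (finRotate n i)))
        = {vert (finRotate n i)}
  nonadjacent : ∀ i j, j ≠ i → j ≠ finRotate n i → i ≠ finRotate n j →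
    Disjoint (segment ℝ (vert i) (vert (finRotate n i)))
      (segment ℝ (vert j) (vert (finRotate n j)))

namespace Polygon

variable (E : Polygon)

/-- Endpoint of the `i`-th edge, which runs from `E.vert i` to `E.next i`. -/
def next (i : Fin E.n) : Pt := E.vert (finRotate E.n i)

/-- The diameter `h_E`. -/
def diam : ℝ := Metric.diam E.carrier

/-- Shape regularity: `E` is star-shaped with respect to a disc of radius `δ h_E`, and each of
its (finitely many) edges has length at least `c h_E`. -/
def ShapeRegular (δ c : ℝ) : Prop :=
  (∃ z : Pt, Metric.ball z (δ * E.diam) ⊆ E.carrier ∧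
    ∀ y ∈ Metric.ball z (δ * E.diam), StarConvex ℝ y E.carrier) ∧
  ∀ i, c * E.diam ≤ dist (E.vert i) (E.next i)

/-- `∫_{∂E} w ds`. -/
def boundaryIntegral (w : Pt → ℝ) : ℝ :=
  ∑ i, dist (E.vert i) (E.next i) *
    ∫ s in (0 : ℝ)..1, w (AffineMap.lineMap (E.vert i) (E.next i) s)

/-- The restriction of a function to the closed polygon (extended by zero). -/
def restr (w : Pt → ℝ) : Pt → ℝ := (closure E.carrier).indicator w

/-! ### Projections onto polynomials -/

/-- `q = 𝒫⁰_k u`, the `L²(E)` projection of `u` onto `ℙ_k`. -/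
def IsL2Proj (k : ℤ) (u q : Pt → ℝ) : Prop :=
  q ∈ polySpace k ∧ ∀ r ∈ polySpace k, ∫ x in E.carrier, (u x - q x) * r x = 0

open Classical in
/-- `𝒫⁰_k u`. -/
def l2Proj (k : ℤ) (u : Pt → ℝ) : Pt → ℝ :=
  if h : ∃ q, E.IsL2Proj k u q then h.choose else 0

/-- `𝒫⁰_k (∇u) ∈ (ℙ_k)²`, the `L²(E)` projection of the gradient; the projection onto `(ℙ_k)²`
acts on each component. -/
def gradProj (k : ℤ) (u : Pt → ℝ) (x : Pt) : Pt :=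
  !₂[E.l2Proj k (fun y => weakGrad E.carrier u y 0) x,
    E.l2Proj k (fun y => weakGrad E.carrier u y 1) x]

/-- `q = 𝒫^∇_p u`: `(∇(u - q), ∇r)_E = 0` for `r ∈ ℙ_p` and `∫_{∂E} (q - u) ds = 0`. -/
def IsEllProj (p : ℕ) (u q : Pt → ℝ) : Prop :=
  q ∈ polySpace p ∧
  (∀ r ∈ polySpace p,
    ∫ x in E.carrier, inner ℝ (weakGrad E.carrier u x - gradient q x) (gradient r x) = 0) ∧
  E.boundaryIntegral (fun x => q x - u x) = 0

open Classical in
/-- `𝒫^∇_p u`. -/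
def ellProj (p : ℕ) (u : Pt → ℝ) : Pt → ℝ :=
  if h : ∃ q, E.IsEllProj p u q then h.choose else 0

/-! ### Local virtual element spaces -/

/-- `v ∈ W_E^p`: `v ∈ H¹(E)` with continuous trace on `∂E`, a polynomial of degree at most `p`
on every edge, and `Δv ∈ ℙ_p(E)` in the sense of distributions. Functions on the closed polygon
are represented by their extensions by zero. -/
def MemW (p : ℕ) (v : Pt → ℝ) : Prop :=
  (∀ x, x ∉ closure E.carrier → v x = 0) ∧
  MemH1 E.carrier v ∧
  HasContinuousTrace E.carrier v ∧
  (∀ i, ∃ r : Polynomial ℝ, r.natDegree ≤ p ∧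
    ∀ s ∈ Icc (0 : ℝ) 1, v (AffineMap.lineMap (E.vert i) (E.next i) s) = r.eval s) ∧
  ∃ q ∈ polySpace p, ∀ φ : Pt → ℝ, IsTest E.carrier φ →
    ∫ x in E.carrier, inner ℝ (weakGrad E.carrier v x) (gradient φ x)
      = - ∫ x in E.carrier, q x * φ x

/-- `v ∈ V_E^p`, where the quotient `ℙ_p / ℙ_{p-2}` is represented by a space `C`. -/
def MemV (p : ℕ) (C : Submodule ℝ (Pt → ℝ)) (v : Pt → ℝ) : Prop :=
  E.MemW p v ∧ ∀ q ∈ C, ∫ x in E.carrier, (v x - E.ellProj p v x) * q x = 0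

end Polygon

/-- A partition of `Ω` into polygons. -/
structure Mesh (Ω : Set Pt) where
  card : ℕ
  elem : Fin card → Polygon
  subset : ∀ e, (elem e).carrier ⊆ Ω
  disjoint : ∀ e e', e ≠ e' → Disjoint (elem e).carrier (elem e').carrier
  cover : closure Ω = ⋃ e, closure (elem e).carrier

/-- A mesh together with the free choices in the virtual element method of order `p`:
a complement `compl e` of `ℙ_{p-2}` in `ℙ_p` for each element, which represents
`ℙ_p / ℙ_{p-2}` (its nonzero members have degree exactly `p-1` or `p`), and the local
stabilizations. Only the values of the latter on the local virtual element space matter. -/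
structure Discretization (Ω : Set Pt) (p : ℕ) extends Mesh Ω where
  compl : Fin card → Submodule ℝ (Pt → ℝ)
  compl_inf : ∀ e, compl e ⊓ polySpace ((p : ℤ) - 2) = ⊥
  compl_sup : ∀ e, compl e ⊔ polySpace ((p : ℤ) - 2) = polySpace p
  S1 : Fin card → LinearMap.BilinForm ℝ (Pt → ℝ)
  S2 : Fin card → LinearMap.BilinForm ℝ (Pt → ℝ)

/-- The coefficients of the system, as functions of time and space: diffusion `ξ i`, convection
`conv = (ω₁, ω₂)`, kinetic coefficients `A`, `Q`, `R` and right-hand sides `f i`. -/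
structure Coefficients (m : ℕ) where
  ξ : Fin m → ℝ → Pt → ℝ
  conv : ℝ → Pt → Pt
  A : Fin m → Fin m → ℝ → Pt → ℝ
  Q : Fin m → Fin m → Fin m → ℝ → Pt → ℝ
  R : Fin m → Fin m → ℝ → Pt → ℝ
  f : Fin m → ℝ → Pt → ℝ

/-- For each `t ∈ [0,T]`: all coefficients are measurable on `Ω`, bounded uniformly in time and
space, `ξ` is bounded below by a positive constant, and `f i t ∈ L²(Ω)`. -/
def Coefficients.Admissible {m : ℕ} (a : Coefficients m) (Ω : Set Pt) (T : ℝ) : Prop :=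
  ∃ ξ₀ > (0 : ℝ), ∃ B : ℝ, ∀ t ∈ Icc (0 : ℝ) T,
    (∀ i, AEStronglyMeasurable (a.ξ i t) (volume.restrict Ω) ∧
      ∀ᵐ x ∂(volume.restrict Ω), ξ₀ ≤ a.ξ i t x ∧ a.ξ i t x ≤ B) ∧
    (AEStronglyMeasurable (a.conv t) (volume.restrict Ω) ∧
      ∀ᵐ x ∂(volume.restrict Ω), ‖a.conv t x‖ ≤ B) ∧
    (∀ i j, AEStronglyMeasurable (a.A i j t) (volume.restrict Ω) ∧
      ∀ᵐ x ∂(volume.restrict Ω), |a.A i j t x| ≤ B) ∧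
    (∀ i l j, AEStronglyMeasurable (a.Q i l j t) (volume.restrict Ω) ∧
      ∀ᵐ x ∂(volume.restrict Ω), |a.Q i l j t x| ≤ B) ∧
    (∀ i j, AEStronglyMeasurable (a.R i j t) (volume.restrict Ω) ∧
      ∀ᵐ x ∂(volume.restrict Ω), |a.R i j t x| ≤ B) ∧
    (∀ i, MemLp (a.f i t) 2 (volume.restrict Ω))

namespace Discretization

variable {Ω : Set Pt} {p m : ℕ} (D : Discretization Ω p)

/-- Every element is shape regular with the constants `δ`, `c`. -/
def Regular (δ c : ℝ) : Prop := ∀ e, (D.elem e).ShapeRegular δ c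

/-- The stabilizations are symmetric on `V_E^p` and satisfy
`α_* ‖v‖²_{0,E} ≤ S₁(v,v) ≤ α^* ‖v‖²_{0,E}` if `𝒫v = 0` and
`β_* ‖∇v‖²_{0,E} ≤ S₂(v,v) ≤ β^* ‖∇v‖²_{0,E}` if `𝒫^∇v = 0`.
A polynomial `v ∈ ℙ_p` with `𝒫v = 0` or `𝒫^∇v = 0` is zero, so that nothing is demanded on
`ℙ_p` and less than the bounds on all of `V_E^p ∖ ℙ_p`. -/
def Stable (αl αu βl βu : ℝ) : Prop :=
  ∀ e,
    (∀ u v, (D.elem e).MemV p (D.compl e) u → (D.elem e).MemV p (D.compl e) v →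
      D.S1 e u v = D.S1 e v u ∧ D.S2 e u v = D.S2 e v u) ∧
    (∀ v, (D.elem e).MemV p (D.compl e) v → (D.elem e).l2Proj p v = 0 →
      αl * (∫ x in (D.elem e).carrier, v x ^ 2) ≤ D.S1 e v v ∧
      D.S1 e v v ≤ αu * ∫ x in (D.elem e).carrier, v x ^ 2) ∧
    (∀ v, (D.elem e).MemV p (D.compl e) v → (D.elem e).ellProj p v = 0 →
      βl * (∫ x in (D.elem e).carrier, ‖weakGrad (D.elem e).carrier v x‖ ^ 2) ≤ D.S2 e v v ∧
      D.S2 e v v ≤ βu * ∫ x in (D.elem e).carrier, ‖weakGrad (D.elem e).carrier v x‖ ^ 2)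

/-- `u ∈ V_h^p`: `u ∈ H¹₀(Ω)` and `u|_E ∈ V_E^p` for every element `E`. -/
def MemVh (u : Pt → ℝ) : Prop :=
  MemH10 Ω u ∧ ∀ e, (D.elem e).MemV p (D.compl e) ((D.elem e).restr u)

/-- `𝒫 u` on the element `e`. -/
def P (e : Fin D.card) (u : Pt → ℝ) : Pt → ℝ :=
  (D.elem e).l2Proj p ((D.elem e).restr u)

/-- `𝒫⁰_{p-1} ∇u` on the element `e`. -/
def PGrad (e : Fin D.card) (u : Pt → ℝ) : Pt → Pt :=
  (D.elem e).gradProj ((p : ℤ) - 1) ((D.elem e).restr u)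

/-- `(I - 𝒫) u` on the element `e`. -/
def ImP (e : Fin D.card) (u : Pt → ℝ) : Pt → ℝ :=
  (D.elem e).restr (fun x => u x - D.P e u x)

/-- `(I - 𝒫^∇_p) u` on the element `e`. -/
def ImEll (e : Fin D.card) (u : Pt → ℝ) : Pt → ℝ :=
  (D.elem e).restr (fun x => u x - (D.elem e).ellProj p ((D.elem e).restr u) x)

/-- `m_h(u, v)`. -/
def mh (u v : Pt → ℝ) : ℝ :=
  ∑ e, ((∫ x in (D.elem e).carrier, D.P e u x * D.P e v x) + D.S1 e (D.ImP e u) (D.ImP e v))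

/-- `a_h(u, v)` for the diffusion coefficient `ξ`, where the stabilization is weighted by
`ess sup_E |ξ|`. -/
def ah (ξ : Pt → ℝ) (u v : Pt → ℝ) : ℝ :=
  ∑ e, ((∫ x in (D.elem e).carrier, ξ x * inner ℝ (D.PGrad e u x) (D.PGrad e v x)) +
    (eLpNorm ξ ⊤ (volume.restrict (D.elem e).carrier)).toReal *
      D.S2 e (D.ImEll e u) (D.ImEll e v))

/-- `l_{1,h}(U_i, V_i)` at time `t`. -/
def l1 (a : Coefficients m) (t : ℝ) (u v : Pt → ℝ) : ℝ :=
  ∑ e, ∫ x in (D.elem e).carrier, inner ℝ (a.conv t x) (D.PGrad e u x) * D.P e v x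

/-- `l_{2,h}(U_i, V_i)` at time `t`, with previous iterate `W`. -/
def l2 (a : Coefficients m) (t : ℝ) (W : Fin m → Pt → ℝ) (i : Fin m) (u v : Pt → ℝ) : ℝ :=
  ∑ e, ∫ x in (D.elem e).carrier,
    D.P e u x * (∑ j, a.A i j t x * D.P e (W j) x) * D.P e v x

/-- `l_{3,h}(U_i, V_i)` at time `t`. -/
def l3 (a : Coefficients m) (t : ℝ) (i : Fin m) (u v : Pt → ℝ) : ℝ :=
  ∑ e, ∫ x in (D.elem e).carrier, a.R i i t x * D.P e u x * D.P e v x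

/-- `l_{4,h}` at time `t`, with previous iterate `W`. -/
def l4 (a : Coefficients m) (t : ℝ) (W : Fin m → Pt → ℝ) (i : Fin m) (v : Pt → ℝ) : ℝ :=
  ∑ e, ∫ x in (D.elem e).carrier,
    (∑ l ∈ Finset.univ.erase i, ∑ j ∈ Finset.univ.erase i,
      a.Q i l j t x * D.P e (W l) x * D.P e (W j) x) * D.P e v x

/-- `l_{5,h}` at time `t`, with previous iterate `W`. -/
def l5 (a : Coefficients m) (t : ℝ) (W : Fin m → Pt → ℝ) (i : Fin m) (v : Pt → ℝ) : ℝ :=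
  ∑ e, ∫ x in (D.elem e).carrier,
    (∑ j ∈ Finset.univ.erase i, a.R i j t x * D.P e (W j) x) * D.P e v x

/-- `(f_i, 𝒫 v)₀` at time `t`. -/
def load (a : Coefficients m) (t : ℝ) (i : Fin m) (v : Pt → ℝ) : ℝ :=
  ∑ e, ∫ x in (D.elem e).carrier, a.f i t x * D.P e v x

/-- `U ∈ [V_h^p]^m` solves the linearized scheme at time `t` with time step `dt` and previous
iterate `W`. -/
def SolvesStep (a : Coefficients m) (dt t : ℝ) (W U : Fin m → Pt → ℝ) : Prop :=
  (∀ i, D.MemVh (U i)) ∧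
  ∀ V : Fin m → Pt → ℝ, (∀ i, D.MemVh (V i)) →
    ∑ i, (D.mh (U i) (V i) - D.mh (W i) (V i) + dt * D.ah (a.ξ i t) (U i) (V i)
        + dt * D.l1 a t (U i) (V i) + dt * D.l2 a t W i (U i) (V i)
        + dt * D.l3 a t i (U i) (V i))
      = dt * ∑ i, (- D.l4 a t W i (V i) - D.l5 a t W i (V i) + D.load a t i (V i))

/-- `U⁰, …, Uⁿ ∈ [V_h^p]^m` solve the linearized scheme with time step `dt` and initial value
`u0` up to time level `n`. Functions are identified if they agree almost everywhere in `Ω`. -/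
def SolvesUpTo (a : Coefficients m) (dt : ℝ) (u0 : Fin m → Pt → ℝ) (n : ℕ)
    (U : ℕ → Fin m → Pt → ℝ) : Prop :=
  (∀ i, D.MemVh (U 0 i) ∧ U 0 i =ᵐ[volume.restrict Ω] u0 i) ∧
  ∀ k, k < n → D.SolvesStep a dt ((k + 1 : ℕ) * dt) (U k) (U (k + 1))

end Discretization

/-- `‖W_i‖_∞ ≤ μ + 1` for all components. -/
def BoundedIterate {m : ℕ} (Ω : Set Pt) (μ : ℝ) (W : Fin m → Pt → ℝ) : Prop :=
  ∀ i, eLpNorm (W i) ⊤ (volume.restrict Ω) ≤ ENNReal.ofReal (μ + 1)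

end VEM

end

/-!
The system of linearized equations is linear in the new iterate and decouples into one variational
problem `B(u, v) = F(v)` on `V_h^p` for each component, with
`B = m_h + δt (a_h + l₁ + l₂ + l₃)` (`Discretization.solvesStep_iff`).

*Definiteness.* The form `B` satisfies a Gårding inequality (`Discretization.le_stepForm`). By
Young's inequality the convection term is absorbed by the projected diffusion term up to a multiple
of `‖𝒫 u‖²`; the reaction terms are bounded by multiples of `‖𝒫 u‖²` as well. The only nonlinear
ingredient is the factor `𝒫 W` of the previous iterate, which is bounded in the maximum norm because
the `L²` projection onto polynomials is stable in `L^∞` on shape regular polygons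
(`Polygon.exists_abs_l2Proj_le`): on a disc of radius `h_E` around the centre of the inscribed disc,
polynomials satisfy an inverse inequality whose constant is scale invariant. Hence, for
`δt < 1 / (C + 1)` with `C` independent of the mesh, `B(u, u) = 0` forces `𝒫 u = 0` and
`S₁(u, u) = 0`, that is, `u = 0` almost everywhere (`Discretization.ae_eq_zero_of_stepForm_self`).
This gives uniqueness.

*Existence.* The members of `V_h^p` are functions rather than classes, and they may be modified on
null sets inside the elements; so `V_h^p` has infinite dimension, and definiteness holds only up to
null sets. Still, the operator `u ↦ B(u, ·)` has finite rank, since it factors through the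
projections `𝒫 u` and the values of `u` at `p + 1` points of every edge
(`Discretization.stepForm_eq_zero_of_dof`), and an operator of finite rank hits every functional `F`
that vanishes where `B(v, v) = 0` (`exists_apply_eq_of_finiteRank`).
The factorization rests on the unisolvence of these data (`Polygon.MemW.eq_zero`): if `v ∈ W_E^p`
has vanishing data, then `v = 0` on `∂E`, so that `v` lies in the closure of the test functions
(`HasWeakGrad.testApprox_of_zero_on_frontier`, proved by truncation and mollification), and testing
`Δv ∈ ℙ_p` with `v` gives `∇v = 0`; by the Poincaré inequality `v = 0`. Null vectors of the
semidefinite stabilizations lie in their radicals (`bilin_eq_zero_of_null`), so that they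
contribute neither to `B` nor to `F`.

The second assertion follows by induction on the time level, as the scheme does not see
modifications of the previous iterate on null sets (`Discretization.SolvesStep.congr`).
-/

open MeasureTheory Filter Topology Set
open scoped ContDiff

noncomputable section

namespace VEM

/-! ### Weak gradients -/

variable {U : Set Pt} {u v φ : Pt → ℝ} {g h : Pt → Pt}

theorem continuous_gradient {k : WithTop ℕ∞} {φ : Pt → ℝ} (hφ : ContDiff ℝ k φ) (hk : 1 ≤ k) :
    Continuous (gradient φ) :=
  (InnerProductSpace.toDual ℝ Pt).symm.continuous.comp
    (hφ.continuous_fderiv (by intro h; simp [h] at hk))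

theorem gradient_add {x : Pt} (hu : DifferentiableAt ℝ u x) (hv : DifferentiableAt ℝ v x) :
    gradient (fun y => u y + v y) x = gradient u x + gradient v x := by
  simp [gradient, fderiv_fun_add hu hv]

theorem gradient_const_mul {x : Pt} (c : ℝ) (hu : DifferentiableAt ℝ u x) :
    gradient (fun y => c * u y) x = c • gradient u x := by
  simp [gradient, fderiv_const_mul hu]

theorem gradient_mul {x : Pt} (hu : DifferentiableAt ℝ u x) (hv : DifferentiableAt ℝ v x) :
    gradient (fun y => u y * v y) x = u x • gradient v x + v x • gradient u x := by
  simp [gradient, fderiv_fun_mul hu hv]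

theorem gradient_comp {x : Pt} {ψ : ℝ → ℝ} (hψ : DifferentiableAt ℝ ψ (u x))
    (hu : DifferentiableAt ℝ u x) :
    gradient (fun y => ψ (u y)) x = deriv ψ (u x) • gradient u x := by
  have := (hψ.hasDerivAt.comp_hasFDerivAt x hu.hasFDerivAt).fderiv
  simp only [gradient]
  rw [show (fun y => ψ (u y)) = ψ ∘ u from rfl, this]
  simp

theorem norm_gradient (φ : Pt → ℝ) (x : Pt) : ‖gradient φ x‖ = ‖fderiv ℝ φ x‖ := by
  simp [gradient]

theorem hasCompactSupport_gradient (h : HasCompactSupport φ) :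
    HasCompactSupport (gradient φ) := by
  refine (h.fderiv ℝ).comp_left (g := (InnerProductSpace.toDual ℝ Pt).symm) (by simp)

theorem tsupport_gradient_subset : tsupport (gradient φ) ⊆ tsupport φ := by
  refine subset_trans (closure_mono ?_) (tsupport_fderiv_subset ℝ (f := φ))
  intro x hx
  simpa [gradient] using hx

namespace IsTest

theorem memLp (hφ : IsTest U φ) (p : ENNReal) (ν : Measure Pt) [IsFiniteMeasureOnCompacts ν] :
    MemLp φ p ν :=
  hφ.1.continuous.memLp_of_hasCompactSupport hφ.2.1

theorem continuous_gradient (hφ : IsTest U φ) : Continuous (gradient φ) :=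
  VEM.continuous_gradient hφ.1 (by simp)

theorem memLp_gradient (hφ : IsTest U φ) (p : ENNReal) (ν : Measure Pt)
    [IsFiniteMeasureOnCompacts ν] : MemLp (gradient φ) p ν :=
  hφ.continuous_gradient.memLp_of_hasCompactSupport (hasCompactSupport_gradient hφ.2.1)

theorem differentiable (hφ : IsTest U φ) : Differentiable ℝ φ :=
  hφ.1.differentiable (by simp)

theorem zero : IsTest U (fun _ => 0) :=
  ⟨contDiff_const, HasCompactSupport.zero, by
    rw [show (fun _ : Pt => (0 : ℝ)) = 0 from rfl, tsupport_zero]; simp⟩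

theorem add {ψ : Pt → ℝ} (hφ : IsTest U φ) (hψ : IsTest U ψ) : IsTest U (fun x => φ x + ψ x) :=
  ⟨hφ.1.add hψ.1, hφ.2.1.add hψ.2.1,
    (tsupport_add φ ψ).trans (union_subset hφ.2.2 hψ.2.2)⟩

theorem const_mul (c : ℝ) (hφ : IsTest U φ) : IsTest U (fun x => c * φ x) :=
  ⟨contDiff_const.mul hφ.1, hφ.2.1.mul_left,
    (closure_mono (Function.support_mul_subset_right _ _)).trans hφ.2.2⟩

theorem smooth_mul {η : Pt → ℝ} (hη : ContDiff ℝ ∞ η) (hφ : IsTest U φ) :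
    IsTest U (fun x => η x * φ x) :=
  ⟨hη.mul hφ.1, hφ.2.1.mul_left,
    (closure_mono (Function.support_mul_subset_right _ _)).trans hφ.2.2⟩

end IsTest

theorem integrable_smul_gradient (hu : MemLp u 2 (volume.restrict U)) (hφ : IsTest U φ) :
    Integrable (fun x => u x • gradient φ x) (volume.restrict U) :=
  memLp_one_iff_integrable.1 ((hφ.memLp_gradient 2 _).smul hu)

theorem integrable_test_smul (hg : MemLp g 2 (volume.restrict U)) (hφ : IsTest U φ) :
    Integrable (fun x => φ x • g x) (volume.restrict U) :=
  memLp_one_iff_integrable.1 (hg.smul (hφ.memLp 2 _))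

namespace HasWeakGrad

theorem add (hu : HasWeakGrad U u g) (hv : HasWeakGrad U v h) :
    HasWeakGrad U (fun x => u x + v x) (fun x => g x + h x) := by
  refine ⟨hu.1.add hv.1, hu.2.1.add hv.2.1, fun φ hφ => ?_⟩
  simp only [add_smul, smul_add]
  rw [integral_add (integrable_smul_gradient hu.1 hφ) (integrable_smul_gradient hv.1 hφ),
    integral_add (integrable_test_smul hu.2.1 hφ) (integrable_test_smul hv.2.1 hφ),
    hu.2.2 φ hφ, hv.2.2 φ hφ, neg_add]

theorem const_mul (c : ℝ) (hu : HasWeakGrad U u g) :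
    HasWeakGrad U (fun x => c * u x) (fun x => c • g x) := by
  refine ⟨hu.1.const_mul c, hu.2.1.const_smul c, fun φ hφ => ?_⟩
  simp only [mul_smul, smul_comm _ c]
  rw [integral_smul, integral_smul, hu.2.2 φ hφ, smul_neg]

theorem congr (hu : HasWeakGrad U u g) (huv : u =ᵐ[volume.restrict U] v)
    (hgh : g =ᵐ[volume.restrict U] h) : HasWeakGrad U v h := by
  refine ⟨(memLp_congr_ae huv).1 hu.1, (memLp_congr_ae hgh).1 hu.2.1, fun φ hφ => ?_⟩
  rw [← integral_congr_ae (huv.mono fun x hx =>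
      show u x • gradient φ x = v x • gradient φ x by rw [hx]),
    ← integral_congr_ae (hgh.mono fun x hx => show φ x • g x = φ x • h x by rw [hx])]
  exact hu.2.2 φ hφ

/-- The weak gradient is unique: the fundamental lemma of the calculus of variations. -/
theorem unique (hU : IsOpen U) (hg : HasWeakGrad U u g) (hh : HasWeakGrad U u h) :
    g =ᵐ[volume.restrict U] h := by
  have hloc : LocallyIntegrableOn (fun x => g x - h x) U volume :=
    locallyIntegrableOn_of_locallyIntegrable_restrict
      ((hg.2.1.sub hh.2.1).locallyIntegrable (by norm_num))
  have := hU.ae_eq_zero_of_integral_contDiff_smul_eq_zero hloc fun φ h1 h2 h3 => ?_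
  · filter_upwards [(ae_restrict_iff' hU.measurableSet).2 this] with x hx
    exact sub_eq_zero.1 hx
  · have hφ : IsTest U φ := ⟨h1, h2, h3⟩
    rw [← setIntegral_eq_integral_of_forall_compl_eq_zero (s := U)]
    · simp only [smul_sub]
      rw [integral_sub (integrable_test_smul hg.2.1 hφ) (integrable_test_smul hh.2.1 hφ),
        sub_eq_zero, ← neg_inj, ← hg.2.2 φ hφ, ← hh.2.2 φ hφ]
    · intro x hx
      rw [image_eq_zero_of_notMem_tsupport fun h' => hx (h3 h'), zero_smul]

end HasWeakGrad

theorem integral_smul_gradient_eq_neg (hu : ContDiff ℝ 1 u) (hφ : IsTest U φ) :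
    ∫ x, u x • gradient φ x = - ∫ x, φ x • gradient u x := by
  have hφc := hφ.1.continuous
  have huc := hu.continuous
  have hgu := VEM.continuous_gradient hu le_rfl
  have i1 : Integrable (fun x => u x • gradient φ x) :=
    (huc.smul hφ.continuous_gradient).integrable_of_hasCompactSupport
      (hasCompactSupport_gradient hφ.2.1).smul_left
  have i2 : Integrable (fun x => φ x • gradient u x) :=
    (hφc.smul hgu).integrable_of_hasCompactSupport hφ.2.1.smul_right
  refine ext_inner_left ℝ fun w => ?_
  rw [inner_neg_right, ← integral_inner i1, ← integral_inner i2]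
  simp only [inner_smul_right, inner_gradient_right, conj_trivial]
  have := integral_mul_fderiv_eq_neg_fderiv_mul_of_integrable (μ := (volume : Measure Pt))
    (f := u) (g := φ) (v := w) ?_ ?_ ?_ (fun x _ => (hu.differentiable one_ne_zero) x)
    (fun x _ => hφ.differentiable x)
  · rw [this]
    simp only [mul_comm]
  · have := i2.const_inner (𝕜 := ℝ) w
    simpa only [inner_smul_right, inner_gradient_right, conj_trivial, mul_comm] using this
  · have := i1.const_inner (𝕜 := ℝ) w
    simpa only [inner_smul_right, inner_gradient_right, conj_trivial] using this
  · exact (huc.mul hφc).integrable_of_hasCompactSupport hφ.2.1.mul_left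

theorem setIntegral_smul_gradient_eq (f : Pt → ℝ) (hφ : IsTest U φ) :
    ∫ x in U, f x • gradient φ x = ∫ x, f x • gradient φ x := by
  refine setIntegral_eq_integral_of_forall_compl_eq_zero fun x hx => ?_
  rw [image_eq_zero_of_notMem_tsupport fun h' => hx (hφ.2.2 (tsupport_gradient_subset h')),
    smul_zero]

theorem setIntegral_test_smul_eq (f : Pt → Pt) (hφ : IsTest U φ) :
    ∫ x in U, φ x • f x = ∫ x, φ x • f x := by
  refine setIntegral_eq_integral_of_forall_compl_eq_zero fun x hx => ?_
  rw [image_eq_zero_of_notMem_tsupport fun h' => hx (hφ.2.2 h'), zero_smul]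

theorem memLp_of_continuous_of_isBounded {F : Type*} [NormedAddCommGroup F] {f : Pt → F}
    (hf : Continuous f) (hU : Bornology.IsBounded U) (p : ENNReal) :
    MemLp f p (volume.restrict U) := by
  obtain ⟨R, hR⟩ := hU.subset_closedBall 0
  refine MemLp.mono_measure (Measure.restrict_mono hR le_rfl) ?_
  obtain ⟨C, hC⟩ := (isCompact_closedBall (0 : Pt) R).exists_bound_of_continuousOn hf.continuousOn
  have : IsFiniteMeasure (volume.restrict (Metric.closedBall (0 : Pt) R)) :=
    isFiniteMeasure_restrict.2 measure_closedBall_lt_top.ne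
  refine MemLp.of_bound hf.aestronglyMeasurable C ?_
  exact (ae_restrict_iff' measurableSet_closedBall).2 (Eventually.of_forall hC)

/-- On a bounded set the classical gradient of a smooth function is its weak gradient. -/
theorem hasWeakGrad_of_contDiff (hU : Bornology.IsBounded U) (hu : ContDiff ℝ 1 u) :
    HasWeakGrad U u (gradient u) := by
  refine ⟨memLp_of_continuous_of_isBounded hu.continuous hU 2,
    memLp_of_continuous_of_isBounded (VEM.continuous_gradient hu le_rfl) hU 2, fun φ hφ => ?_⟩
  rw [setIntegral_smul_gradient_eq _ hφ, setIntegral_test_smul_eq _ hφ,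
    integral_smul_gradient_eq_neg hu hφ]

theorem hasWeakGrad_test (hφ : IsTest U φ) : HasWeakGrad U φ (gradient φ) := by
  refine ⟨hφ.memLp 2 _, hφ.memLp_gradient 2 _, fun ψ hψ => ?_⟩
  rw [setIntegral_smul_gradient_eq _ hψ, setIntegral_test_smul_eq _ hψ,
    integral_smul_gradient_eq_neg (hφ.1.of_le (by simp)) hψ]

theorem MemH1.hasWeakGrad (hu : MemH1 U u) : HasWeakGrad U u (weakGrad U u) := by
  rw [weakGrad, dif_pos hu]
  exact hu.choose_spec

namespace HasWeakGrad

theorem memH1 (hu : HasWeakGrad U u g) : MemH1 U u := ⟨g, hu⟩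

theorem weakGrad_ae_eq (hu : HasWeakGrad U u g) (hU : IsOpen U) :
    weakGrad U u =ᵐ[volume.restrict U] g :=
  hu.memH1.hasWeakGrad.unique hU hu

end HasWeakGrad

namespace MemH1

theorem memLp (hu : MemH1 U u) : MemLp u 2 (volume.restrict U) := hu.hasWeakGrad.1

theorem memLp_weakGrad (hu : MemH1 U u) : MemLp (weakGrad U u) 2 (volume.restrict U) :=
  hu.hasWeakGrad.2.1

theorem add (hu : MemH1 U u) (hv : MemH1 U v) : MemH1 U (fun x => u x + v x) :=
  (hu.hasWeakGrad.add hv.hasWeakGrad).memH1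

theorem const_mul (c : ℝ) (hu : MemH1 U u) : MemH1 U (fun x => c * u x) :=
  (hu.hasWeakGrad.const_mul c).memH1

end MemH1

theorem weakGrad_add (hU : IsOpen U) (hu : MemH1 U u) (hv : MemH1 U v) :
    weakGrad U (fun x => u x + v x) =ᵐ[volume.restrict U]
      fun x => weakGrad U u x + weakGrad U v x :=
  (hu.hasWeakGrad.add hv.hasWeakGrad).weakGrad_ae_eq hU

theorem weakGrad_const_mul (hU : IsOpen U) (c : ℝ) (hu : MemH1 U u) :
    weakGrad U (fun x => c * u x) =ᵐ[volume.restrict U] fun x => c • weakGrad U u x :=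
  (hu.hasWeakGrad.const_mul c).weakGrad_ae_eq hU

theorem hasWeakGrad_zero : HasWeakGrad U (fun _ => 0) (fun _ => 0) :=
  ⟨MemLp.zero, MemLp.zero, fun φ _ => by simp⟩

/-! ### The space `H¹₀` -/

theorem tendsto_eLpNorm_add {F : Type*} [NormedAddCommGroup F] {ν : Measure Pt} {a b : Pt → F}
    {x y : ℕ → Pt → F} (ha : AEStronglyMeasurable a ν) (hb : AEStronglyMeasurable b ν)
    (hx : ∀ k, AEStronglyMeasurable (x k) ν) (hy : ∀ k, AEStronglyMeasurable (y k) ν)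
    (h1 : Tendsto (fun k => eLpNorm (fun z => a z - x k z) 2 ν) atTop (𝓝 0))
    (h2 : Tendsto (fun k => eLpNorm (fun z => b z - y k z) 2 ν) atTop (𝓝 0)) :
    Tendsto (fun k => eLpNorm (fun z => (a z + b z) - (x k z + y k z)) 2 ν) atTop (𝓝 0) := by
  have h3 := h1.add h2
  rw [add_zero] at h3
  refine tendsto_of_tendsto_of_tendsto_of_le_of_le tendsto_const_nhds h3
    (fun _ => zero_le) fun k => ?_
  refine le_trans (le_of_eq ?_) (eLpNorm_add_le (ha.sub (hx k)) (hb.sub (hy k)) (by norm_num))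
  congr 1
  ext z
  simp only [Pi.add_apply]
  abel

theorem MemH10.add (hU : IsOpen U) (hu : MemH10 U u) (hv : MemH10 U v) :
    MemH10 U (fun x => u x + v x) := by
  obtain ⟨hu1, φ, hφ, h1, h2⟩ := hu
  obtain ⟨hv1, ψ, hψ, h3, h4⟩ := hv
  refine ⟨hu1.add hv1, fun k x => φ k x + ψ k x, fun k => (hφ k).add (hψ k), ?_, ?_⟩
  · exact tendsto_eLpNorm_add hu1.memLp.1 hv1.memLp.1 (fun k => ((hφ k).memLp 2 _).1)
      (fun k => ((hψ k).memLp 2 _).1) h1 h3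
  · have := tendsto_eLpNorm_add hu1.memLp_weakGrad.1 hv1.memLp_weakGrad.1
      (fun k => ((hφ k).memLp_gradient 2 _).1) (fun k => ((hψ k).memLp_gradient 2 _).1) h2 h4
    refine this.congr fun k => eLpNorm_congr_ae ?_
    filter_upwards [weakGrad_add hU hu1 hv1] with x hx
    rw [hx, gradient_add ((hφ k).differentiable x) ((hψ k).differentiable x)]

theorem MemH10.const_mul (hU : IsOpen U) (c : ℝ) (hu : MemH10 U u) :
    MemH10 U (fun x => c * u x) := by
  obtain ⟨hu1, φ, hφ, h1, h2⟩ := hu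
  refine ⟨hu1.const_mul c, fun k x => c * φ k x, fun k => (hφ k).const_mul c, ?_, ?_⟩
  · have := ENNReal.Tendsto.const_mul (a := ‖c‖ₑ) h1 (Or.inr (by simp))
    rw [mul_zero] at this
    refine this.congr fun k => ?_
    rw [← eLpNorm_const_smul]
    congr 1; ext x
    simp only [Pi.smul_apply, smul_eq_mul]
    ring
  · have := ENNReal.Tendsto.const_mul (a := ‖c‖ₑ) h2 (Or.inr (by simp))
    rw [mul_zero] at this
    refine this.congr fun k => ?_
    rw [← eLpNorm_const_smul]
    refine eLpNorm_congr_ae ?_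
    filter_upwards [weakGrad_const_mul hU c hu1] with x hx
    rw [hx, gradient_const_mul c ((hφ k).differentiable x), Pi.smul_apply, smul_sub]

theorem memH10_zero (hU : IsOpen U) : MemH10 U (fun _ => 0) := by
  refine ⟨hasWeakGrad_zero.memH1, fun _ _ => 0, fun _ => IsTest.zero, ?_, ?_⟩
  · simp
  · refine tendsto_const_nhds.congr fun k => Eq.symm ?_
    rw [eLpNorm_congr_ae (g := fun _ => (0 : Pt)), eLpNorm_zero']
    filter_upwards [hasWeakGrad_zero.weakGrad_ae_eq hU] with x hx
    simp [hx, gradient]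

end VEM

namespace VEM

/-! ### Convergence in `L²` -/

section Lebesgue

variable {α F : Type*} [MeasurableSpace α] {ν : Measure α} [NormedAddCommGroup F]

theorem eLpNorm_two_pow (f : α → F) : eLpNorm f 2 ν ^ 2 = ∫⁻ x, ‖f x‖ₑ ^ 2 ∂ν := by
  have := eLpNorm_nnreal_pow_eq_lintegral (f := f) (μ := ν) (p := 2) (by norm_num)
  simpa using this

theorem tendsto_eLpNorm_two_zero_iff {ι : Type*} {l : Filter ι} {f : ι → α → F} :
    Tendsto (fun k => eLpNorm (f k) 2 ν) l (𝓝 0) ↔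
      Tendsto (fun k => ∫⁻ x, ‖f k x‖ₑ ^ 2 ∂ν) l (𝓝 0) := by
  simp only [← eLpNorm_two_pow]
  constructor
  · intro h
    simpa [Function.comp_def] using (ENNReal.continuous_pow 2).tendsto 0 |>.comp h
  · intro h
    have := (ENNReal.continuous_rpow_const (y := (1 / 2 : ℝ))).tendsto 0 |>.comp h
    rw [ENNReal.zero_rpow_of_pos (by norm_num)] at this
    refine this.congr fun k => ?_
    simp only [Function.comp]
    rw [← ENNReal.rpow_natCast, ← ENNReal.rpow_mul]
    norm_num

/-- Dominated convergence in `L²` for a fixed function with bounded multipliers. -/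
theorem tendsto_eLpNorm_smul_of_tendsto_ae [NormedSpace ℝ F] {g : α → F} (hg : MemLp g 2 ν)
    {a : ℕ → α → ℝ} (ha : ∀ k, AEStronglyMeasurable (a k) ν) (M : ℝ)
    (hM : ∀ k, ∀ᵐ x ∂ν, |a k x| ≤ M) (h0 : ∀ᵐ x ∂ν, Tendsto (fun k => a k x) atTop (𝓝 0)) :
    Tendsto (fun k => eLpNorm (fun x => a k x • g x) 2 ν) atTop (𝓝 0) := by
  rw [tendsto_eLpNorm_two_zero_iff]
  have key := tendsto_lintegral_of_dominated_convergence' (μ := ν)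
    (F := fun k x => ‖a k x • g x‖ₑ ^ 2) (f := fun _ => 0)
    (fun x => ‖M • g x‖ₑ ^ 2) (fun k => ((ha k).smul hg.1).enorm.pow_const 2) ?_ ?_ ?_
  · simpa using key
  · intro k
    filter_upwards [hM k] with x hx
    gcongr
    rw [enorm_smul, enorm_smul]
    gcongr
    rw [← ofReal_norm, ← ofReal_norm]
    exact ENNReal.ofReal_le_ofReal (by simpa using hx.trans (le_abs_self M))
  · rw [← eLpNorm_two_pow]
    exact ENNReal.pow_ne_top (hg.const_smul M).2.ne
  · filter_upwards [h0] with x hx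
    have h1 : Tendsto (fun k => ‖a k x • g x‖ₑ) atTop (𝓝 0) := by
      have := (hx.smul_const (g x)).enorm
      simpa using this
    simpa [Function.comp_def] using (ENNReal.continuous_pow 2).tendsto 0 |>.comp h1

/-- Passing to the limit in `∫ b(fₖ, h)` when `fₖ → f` in `L²` and `h ∈ L²`. -/
theorem tendsto_integral_bilin {G H : Type*} [NormedAddCommGroup G] [NormedAddCommGroup H]
    [NormedSpace ℝ H] (b : F → G → H) (hb : ∀ x y, ‖b x y‖ ≤ ‖x‖ * ‖y‖)
    (hsub : ∀ x x' y, b (x - x') y = b x y - b x' y)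
    {f : α → F} {h : α → G} {fk : ℕ → α → F} (hf : MemLp f 2 ν) (hh : MemLp h 2 ν)
    (hk : ∀ k, MemLp (fk k) 2 ν)
    (hm : AEStronglyMeasurable (fun x => b (f x) (h x)) ν)
    (hmk : ∀ k, AEStronglyMeasurable (fun x => b (fk k x) (h x)) ν)
    (hlim : Tendsto (fun k => eLpNorm (fun x => f x - fk k x) 2 ν) atTop (𝓝 0)) :
    Tendsto (fun k => ∫ x, b (fk k x) (h x) ∂ν) atTop (𝓝 (∫ x, b (f x) (h x) ∂ν)) := by
  have hint : ∀ w : α → F, MemLp w 2 ν → AEStronglyMeasurable (fun x => b (w x) (h x)) ν →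
      Integrable (fun x => b (w x) (h x)) ν := fun w hw hwm => by
    refine (memLp_one_iff_integrable.1 (hh.norm.smul hw.norm)).mono' hwm ?_
    exact Eventually.of_forall fun x => by simpa using hb (w x) (h x)
  refine tendsto_integral_of_L1' _ (hint f hf hm).1
    (Eventually.of_forall fun k => hint _ (hk k) (hmk k)) ?_
  have h3 := ENNReal.Tendsto.mul_const (b := eLpNorm h 2 ν) hlim (Or.inr hh.2.ne)
  rw [zero_mul] at h3
  refine tendsto_of_tendsto_of_tendsto_of_le_of_le tendsto_const_nhds h3
    (fun _ => zero_le) fun k => ?_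
  have := eLpNorm_le_eLpNorm_mul_eLpNorm'_of_norm (p := 2) (q := 2) (r := 1) (μ := ν)
    (hf.sub (hk k)).1 hh.1 b 1
    (Eventually.of_forall fun x => by simpa using hb _ _)
  refine le_trans (le_of_eq ?_) (this.trans (le_of_eq ?_))
  · rw [← eLpNorm_neg]
    congr 1; ext x
    simp only [Pi.sub_apply, Pi.neg_apply, hsub]
    abel
  · simp only [ENNReal.coe_one, one_mul]
    rfl

theorem lintegral_sq_le [IsProbabilityMeasure ν] {f : α → ENNReal} (hf : AEMeasurable f ν) :
    (∫⁻ x, f x ∂ν) ^ 2 ≤ ∫⁻ x, f x ^ 2 ∂ν := by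
  have := ENNReal.lintegral_mul_le_Lp_mul_Lq ν (p := 2) (q := 2)
    ⟨by norm_num, by norm_num, by norm_num⟩ hf (aemeasurable_const (b := (1 : ENNReal)))
  simp only [Pi.mul_apply, mul_one, ENNReal.one_rpow, lintegral_one, measure_univ] at this
  calc (∫⁻ x, f x ∂ν) ^ 2 ≤ ((∫⁻ x, f x ^ (2 : ℝ) ∂ν) ^ (1 / 2 : ℝ)) ^ 2 := by gcongr
    _ = _ := by
      rw [← ENNReal.rpow_natCast, ← ENNReal.rpow_mul]
      norm_num

end Lebesgue

/-! ### Mollification -/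

section Mollify

open ContinuousLinearMap

variable {F : Type*} [NormedAddCommGroup F] [NormedSpace ℝ F]

/-- Convolution with the normalized bump function `ρ`. -/
def mollify (ρ : ContDiffBump (0 : Pt)) (f : Pt → F) : Pt → F :=
  convolution (ρ.normed volume) f (lsmul ℝ ℝ) volume

variable (ρ : ContDiffBump (0 : Pt))

theorem mollify_apply (f : Pt → F) (x : Pt) :
    mollify ρ f x = ∫ t, ρ.normed volume t • f (x - t) := rfl

theorem mollify_eq_swap (f : Pt → F) (x : Pt) :
    mollify ρ f x = ∫ t, ρ.normed volume (x - t) • f t :=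
  convolution_lsmul_swap

theorem mollify_sub {f g : Pt → F} (hf : LocallyIntegrable f) (hg : LocallyIntegrable g) :
    mollify ρ (fun x => f x - g x) = fun x => mollify ρ f x - mollify ρ g x := by
  ext x
  have h1 : ConvolutionExists (ρ.normed volume) f (lsmul ℝ ℝ) volume :=
    ρ.hasCompactSupport_normed.convolutionExists_left _ ρ.continuous_normed hf
  have h2 : ConvolutionExists (ρ.normed volume) g (lsmul ℝ ℝ) volume :=
    ρ.hasCompactSupport_normed.convolutionExists_left _ ρ.continuous_normed hg
  simp only [mollify_apply, smul_sub]
  exact integral_sub (h1 x) (h2 x)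

theorem aestronglyMeasurable_mollify {f : Pt → F} (hf : LocallyIntegrable f) :
    AEStronglyMeasurable (mollify ρ f) :=
  (ρ.hasCompactSupport_normed.continuous_convolution_left (L := lsmul ℝ ℝ)
    ρ.continuous_normed hf).aestronglyMeasurable

/-- Mollification is a contraction of `L²`, by Jensen's inequality and Tonelli's theorem. -/
theorem eLpNorm_mollify_le {f : Pt → F} (hf : AEStronglyMeasurable f) :
    eLpNorm (mollify ρ f) 2 volume ≤ eLpNorm f 2 volume := by
  have hcongr : mollify ρ f = mollify ρ (hf.mk f) :=
    convolution_congr _ (ae_eq_refl _) hf.ae_eq_mk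
  rw [hcongr, eLpNorm_congr_ae hf.ae_eq_mk]
  have hfm := hf.stronglyMeasurable_mk
  set h := hf.mk f
  set w : Pt → ENNReal := fun t => ENNReal.ofReal (ρ.normed volume t) with hw
  have hwm : Measurable w := ρ.continuous_normed.measurable.ennreal_ofReal
  set κ : Measure Pt := volume.withDensity w
  have hκ : IsProbabilityMeasure κ := by
    refine ⟨?_⟩
    rw [withDensity_apply _ MeasurableSet.univ, Measure.restrict_univ,
      ← ofReal_integral_eq_lintegral_ofReal ρ.integrable_normed
        (Eventually.of_forall ρ.nonneg_normed), ρ.integral_normed, ENNReal.ofReal_one]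
  have hnm : Measurable fun z : Pt × Pt => ‖h (z.1 - z.2)‖ₑ ^ 2 :=
    (hfm.enorm.comp (measurable_fst.sub measurable_snd)).pow_const 2
  have hpt : ∀ x, ‖mollify ρ h x‖ₑ ^ 2 ≤ ∫⁻ t, ‖h (x - t)‖ₑ ^ 2 ∂κ := fun x => by
    have hm : Measurable fun t => ‖h (x - t)‖ₑ :=
      hfm.enorm.comp (measurable_const.sub measurable_id)
    refine le_trans ?_ (lintegral_sq_le hm.aemeasurable)
    gcongr
    rw [lintegral_withDensity_eq_lintegral_mul _ hwm hm]
    refine (enorm_integral_le_lintegral_enorm _).trans (le_of_eq (lintegral_congr fun t => ?_))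
    rw [lsmul_apply, enorm_smul, Real.enorm_of_nonneg (ρ.nonneg_normed t)]
    rfl
  have hsq : eLpNorm (mollify ρ h) 2 volume ^ 2 ≤ eLpNorm h 2 volume ^ 2 := by
    rw [eLpNorm_two_pow, eLpNorm_two_pow]
    calc ∫⁻ x, ‖mollify ρ h x‖ₑ ^ 2 ≤ ∫⁻ x, ∫⁻ t, ‖h (x - t)‖ₑ ^ 2 ∂κ := lintegral_mono hpt
      _ = ∫⁻ t, (∫⁻ x, ‖h (x - t)‖ₑ ^ 2) ∂κ := lintegral_lintegral_swap hnm.aemeasurable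
      _ = ∫⁻ t, (∫⁻ x, ‖h x‖ₑ ^ 2) ∂κ :=
        lintegral_congr fun t => lintegral_sub_right_eq_self (fun x => ‖h x‖ₑ ^ 2) t
      _ = _ := by simp
  exact le_of_not_gt fun hlt => hsq.not_gt ((ENNReal.pow_lt_pow_left_iff two_ne_zero).2 hlt)

/-- Mollifications converge in `L²`: this holds for continuous functions with compact support by
uniform continuity, and these are dense. -/
theorem tendsto_eLpNorm_sub_mollify [CompleteSpace F] {ρ : ℕ → ContDiffBump (0 : Pt)}
    (hρ : Tendsto (fun k => (ρ k).rOut) atTop (𝓝 0)) {f : Pt → F} (hf : MemLp f 2 volume) :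
    Tendsto (fun k => eLpNorm (fun x => f x - mollify (ρ k) f x) 2 volume) atTop (𝓝 0) := by
  rw [ENNReal.tendsto_nhds_zero]
  intro ε hε
  obtain ⟨c, hcs, hfc, hc, hcL⟩ := hf.exists_hasCompactSupport_eLpNorm_sub_le (by norm_num)
    (ε := ε / 3) (by simp [hε.ne'])
  have hfl : LocallyIntegrable f := hf.locallyIntegrable (by norm_num)
  have hcl : LocallyIntegrable c := hc.locallyIntegrable
  set K := Metric.cthickening 1 (tsupport c)
  have hK : IsCompact K := hcs.isCompact.cthickening
  have hKf : volume K ≠ ⊤ := hK.measure_lt_top.ne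
  -- the uniform distance `d` of `c` to its mollification that makes the `L²` distance small
  obtain ⟨d, hd, hdK⟩ : ∃ d : ℝ, 0 < d ∧
      ENNReal.ofReal d * volume K ^ (1 / 2 : ℝ) ≤ ε / 3 := by
    have hc0 : Tendsto (fun d : ℝ => ENNReal.ofReal d * volume K ^ (1 / 2 : ℝ)) (𝓝[>] 0)
        (𝓝 0) := by
      have h1 : Tendsto (fun d : ℝ => ENNReal.ofReal d) (𝓝[>] 0) (𝓝 0) := by
        have := (ENNReal.continuous_ofReal.tendsto 0).mono_left
          (nhdsWithin_le_nhds (s := Ioi (0 : ℝ)))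
        simpa using this
      have := ENNReal.Tendsto.mul_const (b := volume K ^ (1 / 2 : ℝ)) h1
        (Or.inr (ENNReal.rpow_ne_top_of_nonneg (by norm_num) hKf))
      simpa using this
    obtain ⟨d, h1, h2⟩ := ((ENNReal.tendsto_nhds_zero.1 hc0 (ε / 3) (by
      simpa [pos_iff_ne_zero] using hε.ne')).and self_mem_nhdsWithin).exists
    exact ⟨d, h2, h1⟩
  obtain ⟨r, hr, hcr⟩ := Metric.uniformContinuous_iff.1
    (hcs.uniformContinuous_of_continuous hc) d hd
  filter_upwards [hρ.eventually (gt_mem_nhds hr), hρ.eventually (gt_mem_nhds one_pos)]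
    with k hk1 hk2
  have hdist : ∀ x, ‖c x - mollify (ρ k) c x‖ ≤ d := fun x => by
    rw [← dist_eq_norm, dist_comm]
    refine (ρ k).dist_normed_convolution_le hc.aestronglyMeasurable fun y hy => ?_
    exact (hcr ((Metric.mem_ball.1 hy).trans hk1)).le
  have hsupp : ∀ x, x ∉ K → c x - mollify (ρ k) c x = 0 := fun x hx => by
    have h1 : ∀ y, dist y x < 1 → c y = 0 := fun y hy => by
      refine image_eq_zero_of_notMem_tsupport fun hyc => hx ?_
      exact Metric.mem_cthickening_of_dist_le x y 1 _ hyc (by rw [dist_comm]; exact hy.le)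
    rw [h1 x (by simp), zero_sub, neg_eq_zero, ← norm_le_zero_iff]
    have := (ρ k).dist_normed_convolution_le (μ := volume) (x₀ := x) (ε := 0)
      hc.aestronglyMeasurable fun y hy => by
        rw [h1 y ((Metric.mem_ball.1 hy).trans hk2), h1 x (by simp), dist_self]
    rw [h1 x (by simp), dist_zero_right] at this
    exact this
  have e2 : eLpNorm (fun x => c x - mollify (ρ k) c x) 2 volume ≤ ε / 3 := by
    rw [← eLpNorm_restrict_eq_of_support_subset (s := K)]
    · refine (eLpNorm_le_of_ae_bound (C := d) (Eventually.of_forall hdist)).trans ?_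
      rw [mul_comm, Measure.restrict_apply_univ]
      refine le_trans (le_of_eq ?_) hdK
      norm_num
    · intro x hx
      by_contra h
      exact hx (hsupp x h)
  have e3 : eLpNorm (mollify (ρ k) (fun x => f x - c x)) 2 volume ≤ ε / 3 :=
    (eLpNorm_mollify_le _ (hf.1.sub hcL.1)).trans hfc
  have m1 := aestronglyMeasurable_mollify (ρ k) hfl
  have m2 := aestronglyMeasurable_mollify (ρ k) hcl
  have heq : (fun x => f x - mollify (ρ k) f x) = (f - c) + ((fun x => c x - mollify (ρ k) c x)
      - mollify (ρ k) (fun x => f x - c x)) := by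
    rw [mollify_sub _ hfl hcl]
    ext x
    simp only [Pi.add_apply, Pi.sub_apply]
    abel
  rw [heq]
  refine (eLpNorm_add_le (hf.1.sub hcL.1) ((hcL.1.sub m2).sub ?_) (by norm_num)).trans ?_
  · rw [mollify_sub _ hfl hcl]
    exact m1.sub m2
  refine (add_le_add hfc ((eLpNorm_sub_le (hcL.1.sub m2) ?_ (by norm_num)).trans
    (add_le_add e2 e3))).trans ?_
  · rw [mollify_sub _ hfl hcl]
    exact m1.sub m2
  rw [← add_assoc, ENNReal.add_thirds]

theorem contDiff_mollify {H : Pt → ℝ} (hH : LocallyIntegrable H) :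
    ContDiff ℝ ∞ (mollify ρ H) :=
  ρ.hasCompactSupport_normed.contDiff_convolution_left (lsmul ℝ ℝ) ρ.contDiff_normed hH

/-- Mollification commutes with the weak gradient. -/
theorem gradient_mollify {H : Pt → ℝ} {g : Pt → Pt} (hH : HasWeakGrad univ H g) (x : Pt) :
    gradient (mollify ρ H) x = mollify ρ g x := by
  have hH1 : MemLp H 2 volume := by simpa using hH.1
  have hg1 : MemLp g 2 volume := by simpa using hH.2.1
  have hHl : LocallyIntegrable H := hH1.locallyIntegrable (by norm_num)
  have hgl : LocallyIntegrable g := hg1.locallyIntegrable (by norm_num)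
  have hρ : ContDiff ℝ ∞ (ρ.normed volume) := ρ.contDiff_normed
  have hder : ∀ t, HasGradientAt (fun t => ρ.normed volume (x - t))
      (-gradient (ρ.normed volume) (x - t)) t := fun t => by
    rw [hasGradientAt_iff_hasFDerivAt]
    have h1 := ((hρ.differentiable (by simp)) (x - t)).hasFDerivAt.comp t
      ((hasFDerivAt_const x t).sub (hasFDerivAt_id t))
    refine h1.congr_fderiv ?_
    ext w
    simp [gradient]
  have hcd : ContDiff ℝ ∞ fun t => ρ.normed volume (x - t) :=
    hρ.comp (contDiff_const.sub contDiff_id)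
  have htest : IsTest univ (fun t => ρ.normed volume (x - t)) :=
    ⟨hcd, ρ.hasCompactSupport_normed.comp_homeomorph (Homeomorph.subLeft x), subset_univ _⟩
  have hw := hH.2.2 _ htest
  rw [Measure.restrict_univ] at hw
  rw [mollify_eq_swap, ← neg_eq_iff_eq_neg.2 hw, ← integral_neg]
  have hfd := (ρ.hasCompactSupport_normed (μ := volume)).hasFDerivAt_convolution_left
    (lsmul ℝ ℝ) (hρ.of_le (by simp)) hHl x
  have hconv : mollify ρ H = convolution (ρ.normed volume) H (lsmul ℝ ℝ) volume := rfl
  rw [← hconv] at hfd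
  rw [gradient, hfd.fderiv]
  have hint : Integrable fun t => -(H t • gradient (fun t => ρ.normed volume (x - t)) t) := by
    have := integrable_smul_gradient hH.1 htest
    rw [Measure.restrict_univ] at this
    exact this.neg
  refine ext_inner_left ℝ fun w => ?_
  have hint2 := (((ρ.hasCompactSupport_normed (μ := volume)).fderiv ℝ).convolutionExists_left
    (precompL Pt (lsmul ℝ ℝ)) (hρ.continuous_fderiv (by simp)) hHl x).integrable_swap
  rw [← integral_inner hint, real_inner_comm, InnerProductSpace.toDual_symm_apply,
    convolution_eq_swap, ContinuousLinearMap.integral_apply hint2]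
  refine integral_congr_ae (Eventually.of_forall fun t => ?_)
  simp only [precompL_apply, lsmul_apply, (hder t).gradient, smul_neg, neg_neg, inner_smul_right,
    inner_gradient_right, conj_trivial, smul_eq_mul]
  ring

end Mollify

end VEM

namespace VEM

/-! ### Functions vanishing on the boundary -/

variable {U : Set Pt} {u v : Pt → ℝ} {g h : Pt → Pt}

/-- The pair `(u, g)` lies in the closure of the pairs `(φ, ∇φ)`, `φ` a test function, in `L²`. -/
def TestApprox (U : Set Pt) (u : Pt → ℝ) (g : Pt → Pt) : Prop :=
  ∀ ε : ENNReal, 0 < ε → ∃ φ, IsTest U φ ∧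
    eLpNorm (fun x => u x - φ x) 2 (volume.restrict U) ≤ ε ∧
    eLpNorm (fun x => g x - gradient φ x) 2 (volume.restrict U) ≤ ε

theorem TestApprox.exists_seq (h : TestApprox U u g) : ∃ φ : ℕ → Pt → ℝ, (∀ k, IsTest U (φ k)) ∧
    Tendsto (fun k => eLpNorm (fun x => u x - φ k x) 2 (volume.restrict U)) atTop (𝓝 0) ∧
    Tendsto (fun k => eLpNorm (fun x => g x - gradient (φ k) x) 2 (volume.restrict U))
      atTop (𝓝 0) := by
  choose φ h1 h2 h3 using fun k : ℕ => h ((k : ENNReal) + 1)⁻¹ (by simp)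
  have h0 : Tendsto (fun k : ℕ => ((k : ENNReal) + 1)⁻¹) atTop (𝓝 0) := by
    have := (tendsto_add_atTop_iff_nat 1).2 ENNReal.tendsto_inv_nat_nhds_zero
    simpa using this
  exact ⟨φ, h1, tendsto_of_tendsto_of_tendsto_of_le_of_le tendsto_const_nhds h0
    (fun _ => zero_le) h2, tendsto_of_tendsto_of_tendsto_of_le_of_le tendsto_const_nhds h0
    (fun _ => zero_le) h3⟩

theorem testApprox_of_seq {φ : ℕ → Pt → ℝ} (hφ : ∀ᶠ k in atTop, IsTest U (φ k))
    (h1 : Tendsto (fun k => eLpNorm (fun x => u x - φ k x) 2 (volume.restrict U)) atTop (𝓝 0))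
    (h2 : Tendsto (fun k => eLpNorm (fun x => g x - gradient (φ k) x) 2 (volume.restrict U))
      atTop (𝓝 0)) : TestApprox U u g := fun ε hε => by
  obtain ⟨k, ⟨h3, h4⟩, h5⟩ := ((((ENNReal.tendsto_nhds_zero.1 h1) ε hε).and
    ((ENNReal.tendsto_nhds_zero.1 h2) ε hε)).and hφ).exists
  exact ⟨φ k, h5, h3, h4⟩

theorem MemH10.testApprox (hu : MemH10 U u) : TestApprox U u (weakGrad U u) := by
  obtain ⟨-, φ, hφ, h1, h2⟩ := hu
  exact testApprox_of_seq (Eventually.of_forall hφ) h1 h2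

theorem TestApprox.add (hu : MemLp u 2 (volume.restrict U)) (hg : MemLp g 2 (volume.restrict U))
    (hv : MemLp v 2 (volume.restrict U)) (hh : MemLp h 2 (volume.restrict U))
    (h1 : TestApprox U u g) (h2 : TestApprox U v h) :
    TestApprox U (fun x => u x + v x) (fun x => g x + h x) := by
  obtain ⟨φ, hφ, h1, h3⟩ := h1.exists_seq
  obtain ⟨ψ, hψ, h2, h4⟩ := h2.exists_seq
  refine testApprox_of_seq (φ := fun k x => φ k x + ψ k x)
    (Eventually.of_forall fun k => (hφ k).add (hψ k)) ?_ ?_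
  · exact tendsto_eLpNorm_add hu.1 hv.1 (fun k => ((hφ k).memLp 2 _).1)
      (fun k => ((hψ k).memLp 2 _).1) h1 h2
  · refine (tendsto_eLpNorm_add hg.1 hh.1
      (fun k => ((hφ k).memLp_gradient 2 _).1) (fun k => ((hψ k).memLp_gradient 2 _).1)
      h3 h4).congr fun k => ?_
    congr 1; ext x : 1
    rw [gradient_add ((hφ k).differentiable x) ((hψ k).differentiable x)]

theorem TestApprox.congr (h1 : TestApprox U u g) (hgh : g =ᵐ[volume.restrict U] h) :
    TestApprox U u h := fun ε hε => by
  obtain ⟨φ, hφ, h2, h3⟩ := h1 ε hε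
  refine ⟨φ, hφ, h2, le_trans (le_of_eq (eLpNorm_congr_ae ?_)) h3⟩
  filter_upwards [hgh] with x hx
  rw [hx]

/-- The closure of the pairs `(φ, ∇φ)` is closed. -/
theorem TestApprox.of_limit {uk : ℕ → Pt → ℝ} {gk : ℕ → Pt → Pt}
    (hu : MemLp u 2 (volume.restrict U)) (hg : MemLp g 2 (volume.restrict U))
    (huk : ∀ k, MemLp (uk k) 2 (volume.restrict U))
    (hgk : ∀ k, MemLp (gk k) 2 (volume.restrict U)) (hk : ∀ k, TestApprox U (uk k) (gk k))
    (h1 : Tendsto (fun k => eLpNorm (fun x => u x - uk k x) 2 (volume.restrict U)) atTop (𝓝 0))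
    (h2 : Tendsto (fun k => eLpNorm (fun x => g x - gk k x) 2 (volume.restrict U)) atTop (𝓝 0)) :
    TestApprox U u g := fun ε hε => by
  have hε2 : 0 < ε / 2 := ENNReal.div_pos hε.ne' (by norm_num)
  obtain ⟨k, h3, h4⟩ := (((ENNReal.tendsto_nhds_zero.1 h1) _ hε2).and
    ((ENNReal.tendsto_nhds_zero.1 h2) _ hε2)).exists
  obtain ⟨φ, hφ, h5, h6⟩ := hk k _ hε2
  refine ⟨φ, hφ, ?_, ?_⟩
  · rw [show (fun x => u x - φ x) = (fun x => u x - uk k x) + fun x => uk k x - φ x by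
      ext x; simp]
    exact (eLpNorm_add_le (hu.sub (huk k)).1 ((huk k).sub (hφ.memLp 2 _)).1 (by norm_num)).trans
      ((add_le_add h3 h5).trans_eq (ENNReal.add_halves ε))
  · rw [show (fun x => g x - gradient φ x) = (fun x => g x - gk k x) +
      fun x => gk k x - gradient φ x by ext x : 1; simp]
    exact (eLpNorm_add_le (hg.sub (hgk k)).1 ((hgk k).sub (hφ.memLp_gradient 2 _)).1
      (by norm_num)).trans ((add_le_add h4 h6).trans_eq (ENNReal.add_halves ε))

theorem TestApprox.hasWeakGrad (hu : MemLp u 2 (volume.restrict U))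
    (hg : MemLp g 2 (volume.restrict U)) (hug : TestApprox U u g) : HasWeakGrad U u g := by
  obtain ⟨φ, hφ, h1, h2⟩ := hug.exists_seq
  refine ⟨hu, hg, fun ψ hψ => ?_⟩
  have l1 := tendsto_integral_bilin (fun (x : ℝ) (y : Pt) => x • y)
    (fun x y => (norm_smul x y).le) (fun x x' y => sub_smul x x' y) hu (hψ.memLp_gradient 2 _)
    (fun k => (hφ k).memLp 2 _) (hu.1.smul (hψ.memLp_gradient 2 _).1)
    (fun k => ((hφ k).memLp 2 _).1.smul (hψ.memLp_gradient 2 _).1) h1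
  have l2 := tendsto_integral_bilin (fun (y : Pt) (x : ℝ) => x • y)
    (fun y x => by rw [norm_smul, mul_comm]) (fun x x' y => smul_sub y x x') hg (hψ.memLp 2 _)
    (fun k => (hφ k).memLp_gradient 2 _) ((hψ.memLp 2 _).1.smul hg.1)
    (fun k => (hψ.memLp 2 _).1.smul ((hφ k).memLp_gradient 2 _).1) h2
  refine tendsto_nhds_unique l1 (l2.neg.congr fun k => ?_)
  exact ((hasWeakGrad_test (hφ k)).2.2 ψ hψ).symm

/-- A smooth function `ψ` which vanishes near zero, with `ψ(s) = s` for large `|s|`. Its rescalings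
`ε ψ(s / ε)` approximate the identity. -/
theorem exists_truncation : ∃ (ψ : ℝ → ℝ) (C : ℝ), ContDiff ℝ ∞ ψ ∧ (∀ s, |s| ≤ 1 → ψ s = 0) ∧
    (∀ s, |ψ s - s| ≤ 2) ∧ (∀ s, 2 < |s| → deriv ψ s = 1) ∧ ∀ s, |deriv ψ s| ≤ C := by
  let χ : ContDiffBump (0 : ℝ) := ⟨1, 2, one_pos, by norm_num⟩
  set ψ : ℝ → ℝ := fun s => s * (1 - χ s) with hψdef
  have hψ : ContDiff ℝ ∞ ψ := contDiff_id.mul (contDiff_const.sub χ.contDiff)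
  have hout : ∀ s : ℝ, 2 ≤ |s| → χ s = 0 := fun s hs =>
    χ.zero_of_le_dist (by simpa [Real.dist_eq] using hs)
  have hd : ∀ s, 2 < |s| → deriv ψ s = 1 := fun s hs => by
    have : ψ =ᶠ[𝓝 s] id := by
      filter_upwards [(isOpen_lt continuous_const continuous_abs).mem_nhds hs] with y hy
      simp [hψdef, hout y (le_of_lt hy)]
    rw [this.deriv_eq, deriv_id]
  have hdc : Continuous (deriv ψ) := hψ.continuous_deriv (by simp)
  obtain ⟨C, hC⟩ := (isCompact_Icc (a := (-2 : ℝ)) (b := 2)).exists_bound_of_continuousOn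
    hdc.continuousOn
  refine ⟨ψ, max C 1, hψ, fun s hs => ?_, fun s => ?_, hd, fun s => ?_⟩
  · have : χ s = 1 := χ.one_of_mem_closedBall (by simpa [Real.dist_eq] using hs)
    simp [hψdef, this]
  · rw [show ψ s - s = -(s * χ s) by simp only [hψdef]; ring, abs_neg, abs_mul,
      abs_of_nonneg χ.nonneg]
    rcases le_or_gt 2 |s| with h | h
    · simp [hout s h]
    · nlinarith [χ.nonneg (x := s), χ.le_one (x := s), abs_nonneg s]
  · rcases le_or_gt |s| 2 with h | h
    · exact le_max_of_le_left (hC s (abs_le.1 h))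
    · rw [hd s h]; simp

/-- The product of a weakly differentiable function in `U` and a test function, extended by zero,
is weakly differentiable in the plane. -/
theorem HasWeakGrad.test_mul (hU : IsOpen U) (hu : HasWeakGrad U u g) {η : Pt → ℝ}
    (hη : IsTest U η) :
    HasWeakGrad univ (fun x => η x * U.indicator u x)
      (U.indicator fun x => η x • g x + u x • gradient η x) := by
  obtain ⟨C, hC⟩ := hη.1.continuous.bounded_above_of_compact_support hη.2.1
  obtain ⟨C', hC'⟩ := hη.continuous_gradient.bounded_above_of_compact_support
    (hasCompactSupport_gradient hη.2.1)
  have m1 : MemLp (fun x => η x * u x) 2 (volume.restrict U) :=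
    hu.1.of_le_mul (c := C) (hη.1.continuous.aestronglyMeasurable.mul hu.1.1)
      (Eventually.of_forall fun x => by
        rw [norm_mul]; exact mul_le_mul_of_nonneg_right (hC x) (norm_nonneg _))
  have m2 : MemLp (fun x => η x • g x + u x • gradient η x) 2 (volume.restrict U) := by
    refine MemLp.add ?_ ?_
    · refine hu.2.1.of_le_mul (c := C) (hη.1.continuous.aestronglyMeasurable.smul hu.2.1.1)
        (Eventually.of_forall fun x => ?_)
      rw [norm_smul]
      exact mul_le_mul_of_nonneg_right (hC x) (norm_nonneg _)
    · refine hu.1.of_le_mul (c := C') (hu.1.1.smul hη.continuous_gradient.aestronglyMeasurable)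
        (Eventually.of_forall fun x => ?_)
      rw [norm_smul, mul_comm]
      exact mul_le_mul_of_nonneg_right (hC' x) (norm_nonneg _)
  have e1 : (fun x => η x * U.indicator u x) = U.indicator fun x => η x * u x := by
    ext x; by_cases hx : x ∈ U <;> simp [hx]
  rw [e1]
  refine ⟨?_, ?_, fun φ hφ => ?_⟩
  · rw [Measure.restrict_univ]
    exact (memLp_indicator_iff_restrict hU.measurableSet).2 m1
  · rw [Measure.restrict_univ]
    exact (memLp_indicator_iff_restrict hU.measurableSet).2 m2
  · have hηφ : IsTest U (fun x => φ x * η x) := hη.smooth_mul hφ.1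
    have hφ' : IsTest univ φ := hφ
    rw [Measure.restrict_univ]
    have e2 : ∀ x, U.indicator (fun x => η x * u x) x • gradient φ x =
        U.indicator (fun x => (η x * u x) • gradient φ x) x := fun x => by
      by_cases hx : x ∈ U <;> simp [hx]
    have e3 : ∀ x, φ x • U.indicator (fun x => η x • g x + u x • gradient η x) x =
        U.indicator (fun x => φ x • (η x • g x + u x • gradient η x)) x := fun x => by
      by_cases hx : x ∈ U <;> simp [hx]
    simp only [e2, e3]
    rw [integral_indicator hU.measurableSet, integral_indicator hU.measurableSet]
    have key := hu.2.2 _ hηφ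
    have e4 : ∀ x, u x • gradient (fun x => φ x * η x) x =
        (η x * u x) • gradient φ x + φ x • u x • gradient η x := fun x => by
      rw [gradient_mul (hφ.differentiable x) (hη.differentiable x)]
      module
    have i1 : Integrable (fun x => (η x * u x) • gradient φ x) (volume.restrict U) :=
      memLp_one_iff_integrable.1 ((hφ.memLp_gradient 2 _).smul m1)
    have i2 : Integrable (fun x => φ x • u x • gradient η x) (volume.restrict U) := by
      have := integrable_smul_gradient (U := U) (u := fun x => φ x * u x) (φ := η) ?_ hη
      · simpa only [mul_smul] using this
      · obtain ⟨B, hB⟩ := hφ.1.continuous.bounded_above_of_compact_support hφ.2.1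
        exact hu.1.of_le_mul (c := B) (hφ.1.continuous.aestronglyMeasurable.mul hu.1.1)
          (Eventually.of_forall fun x => by
            rw [norm_mul]; exact mul_le_mul_of_nonneg_right (hB x) (norm_nonneg _))
    have i3 : Integrable (fun x => φ x • η x • g x) (volume.restrict U) := by
      simpa only [mul_smul] using integrable_test_smul hu.2.1 hηφ
    simp only [e4] at key
    rw [integral_add i1 i2] at key
    simp only [smul_add]
    rw [integral_add i3 i2, neg_add, ← eq_sub_iff_add_eq] at *
    rw [key]
    simp only [mul_smul]
    abel

/-- The extension by zero of a continuous function that vanishes on the boundary. -/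
theorem continuous_indicator_of_zero_on_frontier (hc : ContinuousOn u (closure U))
    (h0 : ∀ x ∈ frontier U, u x = 0) : Continuous (U.indicator u) :=
  continuous_indicator (fun x hx => h0 x hx) hc

theorem exists_cutoff {K : Set Pt} (hU : IsOpen U) (hb : Bornology.IsBounded U) (hK : IsClosed K)
    (hKU : K ⊆ U) : ∃ η, IsTest U η ∧ (∀ x, 0 ≤ η x ∧ η x ≤ 1) ∧
      ∀ x ∈ K, η x = 1 ∧ gradient η x = 0 := by
  obtain ⟨f, h0, h1, h2⟩ := exists_contMDiffMap_zero_one_nhds_of_isClosed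
    (n := (⊤ : ℕ∞)) (modelWithCornersSelf ℝ Pt) hU.isClosed_compl hK
    (disjoint_left.2 fun x hx hx' => hx (hKU hx'))
  have hts : tsupport f ⊆ U := fun x hx => by
    by_contra hxU
    have := (Filter.eventually_of_mem (mem_of_superset
      (mem_nhdsSet_iff_forall.1 h0 x hxU) subset_rfl) fun y hy => hy : ∀ᶠ y in 𝓝 x, f y = 0)
    exact (notMem_tsupport_iff_eventuallyEq.2 this) hx
  refine ⟨f, ⟨f.contMDiff.contDiff, ?_, hts⟩, h2, fun x hx => ?_⟩
  · exact Metric.isCompact_of_isClosed_isBounded (isClosed_tsupport _) (hb.subset hts)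
  · have h3 : ∀ᶠ y in 𝓝 x, f y = 1 := mem_nhdsSet_iff_forall.1 h1 x hx
    refine ⟨h3.self_of_nhds, ?_⟩
    rw [Filter.EventuallyEq.gradient_eq (f₁ := f) (f := fun _ => 1) h3]
    simp [gradient]

/-- Chain rule and approximation at once: if `ψ` vanishes near zero and `u` vanishes on `∂U`, then
`ψ ∘ u` has compact support in `U`, and the functions `ψ ∘ (ρₖ * u)` are test functions that
approximate it. -/
theorem HasWeakGrad.testApprox_comp (hU : IsOpen U) (hb : Bornology.IsBounded U)
    (hc : ContinuousOn u (closure U)) (h0 : ∀ x ∈ frontier U, u x = 0) (hu : HasWeakGrad U u g)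
    {ψ : ℝ → ℝ} {ε C : ℝ} (hε : 0 < ε) (hψ : ContDiff ℝ ∞ ψ) (hψ0 : ∀ s, |s| ≤ ε → ψ s = 0)
    (hC : ∀ s, |deriv ψ s| ≤ C) :
    TestApprox U (fun x => ψ (u x)) (fun x => deriv ψ (u x) • g x) := by
  have hu0 := continuous_indicator_of_zero_on_frontier hc h0
  set u0 := U.indicator u with hu0def
  have hu0U : ∀ x ∈ U, u0 x = u x := fun x hx => indicator_of_mem hx _
  have hKU : {x | ε ≤ |u0 x|} ⊆ U := fun x hx => by
    by_contra h
    rw [mem_ofPred_eq, hu0def, indicator_of_notMem h, abs_zero] at hx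
    exact absurd hx (not_le.2 hε)
  obtain ⟨η, hη, hη01, hη1⟩ := exists_cutoff hU hb
    (isClosed_le continuous_const hu0.abs : IsClosed {x | ε ≤ |u0 x|}) hKU
  have hdψ : Continuous (deriv ψ) := hψ.continuous_deriv (by simp)
  have hdψ0 : ∀ s, |s| < ε → deriv ψ s = 0 := fun s hs => by
    have : ψ =ᶠ[𝓝 s] fun _ => 0 := by
      filter_upwards [(isOpen_lt continuous_abs continuous_const).mem_nhds hs] with y hy
      exact hψ0 y (le_of_lt hy)
    rw [this.deriv_eq, deriv_const]
  have hlip : ∀ s t, |ψ s - ψ t| ≤ C * |s - t| := fun s t =>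
    convex_univ.norm_image_sub_le_of_norm_deriv_le (fun x _ => (hψ.differentiable (by simp)) x)
      (fun x _ => hC x) (mem_univ _) (mem_univ _)
  set H : Pt → ℝ := fun x => η x * u0 x with hHdef
  set gH : Pt → Pt := U.indicator fun x => η x • g x + u x • gradient η x
  have hH : HasWeakGrad univ H gH := hu.test_mul hU hη
  have hH2 : MemLp H 2 volume := by simpa using hH.1
  have hg2 : MemLp gH 2 volume := by simpa using hH.2.1
  have hHc : Continuous H := hη.1.continuous.mul hu0
  have hHl : LocallyIntegrable H := hHc.locallyIntegrable
  have hgl : LocallyIntegrable gH := hg2.locallyIntegrable (by norm_num)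
  have hHu : ∀ x ∈ U, ψ (u x) = ψ (H x) ∧ deriv ψ (u x) • g x = deriv ψ (H x) • gH x := by
    intro x hx
    rcases le_or_gt ε |u0 x| with h | h
    · obtain ⟨e1, e2⟩ := hη1 x h
      simp [hHdef, gH, hx, e1, e2, hu0U x hx]
    · have h' : |H x| < ε := by
        rw [hHdef]
        simp only [abs_mul, abs_of_nonneg (hη01 x).1]
        exact lt_of_le_of_lt (mul_le_of_le_one_left (abs_nonneg _) (hη01 x).2) h
      rw [hu0U x hx] at h
      rw [hψ0 _ h.le, hψ0 _ h'.le, hdψ0 _ h, hdψ0 _ h']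
      simp
  let ρ : ℕ → ContDiffBump (0 : Pt) := fun k =>
    ⟨1 / ((k : ℝ) + 1) / 2, 1 / ((k : ℝ) + 1), by positivity, half_lt_self (by positivity)⟩
  have hρ : Tendsto (fun k => (ρ k).rOut) atTop (𝓝 0) := tendsto_one_div_add_atTop_nhds_zero_nat
  have hcd : ∀ k, ContDiff ℝ ∞ (mollify (ρ k) H) := fun k => contDiff_mollify _ hHl
  refine testApprox_of_seq (φ := fun k x => ψ (mollify (ρ k) H x)) ?_ ?_ ?_
  · -- the supports stay within a small closed neighbourhood of the support of the cutoff
    obtain ⟨r, hr, hrU⟩ := hη.2.1.isCompact.exists_cthickening_subset_open hU hη.2.2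
    filter_upwards [hρ.eventually (gt_mem_nhds hr)] with k hk
    have hsub : tsupport (fun x => ψ (mollify (ρ k) H x)) ⊆
        Metric.cthickening r (tsupport η) := by
      refine closure_minimal (fun x hx => ?_) Metric.isClosed_cthickening
      have hne : mollify (ρ k) H x ≠ 0 := fun h => hx (by
        simp only [h]; exact hψ0 0 (by simpa using hε.le))
      obtain ⟨y, hy, t, ht, rfl⟩ := support_convolution_subset_swap
        (ContinuousLinearMap.lsmul ℝ ℝ) (show x ∈ Function.support _ from hne)
      rw [(ρ k).support_normed_eq] at ht
      have hyη : y ∈ tsupport η := subset_tsupport _ fun h => hy (by simp [hHdef, h])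
      refine Metric.mem_cthickening_of_dist_le _ y r _ hyη ?_
      rw [dist_eq_norm, add_sub_cancel_left]
      exact ((mem_ball_zero_iff.1 ht).trans hk).le
    exact ⟨hψ.comp (hcd k), hη.2.1.isCompact.cthickening.of_isClosed_subset
      (isClosed_tsupport _) hsub, hsub.trans hrU⟩
  · have l1 := ENNReal.Tendsto.const_mul (a := ENNReal.ofReal C)
      (tendsto_eLpNorm_sub_mollify hρ hH2) (Or.inr ENNReal.ofReal_ne_top)
    rw [mul_zero] at l1
    refine tendsto_of_tendsto_of_tendsto_of_le_of_le tendsto_const_nhds l1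
      (fun _ => zero_le) fun k => ?_
    refine (eLpNorm_le_mul_eLpNorm_of_ae_le_mul (c := C)
      (g := fun x => H x - mollify (ρ k) H x) ?_ 2).trans ?_
    · refine (ae_restrict_iff' hU.measurableSet).2 (Eventually.of_forall fun x hx => ?_)
      rw [(hHu x hx).1]
      exact hlip _ _
    · gcongr
      exact Measure.restrict_le_self
  · have l1 := ENNReal.Tendsto.const_mul (a := ENNReal.ofReal C)
      (tendsto_eLpNorm_sub_mollify hρ hg2) (Or.inr ENNReal.ofReal_ne_top)
    have l2 := tendsto_eLpNorm_smul_of_tendsto_ae hg2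
      (a := fun k x => deriv ψ (H x) - deriv ψ (mollify (ρ k) H x))
      (fun k => ((hdψ.comp hHc).sub (hdψ.comp (hcd k).continuous)).aestronglyMeasurable) (C + C)
      (fun k => Eventually.of_forall fun x => (abs_sub _ _).trans (add_le_add (hC _) (hC _)))
      (Eventually.of_forall fun x => by
        have := (hdψ.tendsto (H x)).comp
          (ContDiffBump.convolution_tendsto_right_of_continuous (μ := volume) hρ hHc x)
        simpa [mollify, Function.comp_def] using
          tendsto_const_nhds (x := deriv ψ (H x)) |>.sub this)
    rw [mul_zero] at l1
    have l3 := l1.add l2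
    rw [add_zero] at l3
    refine tendsto_of_tendsto_of_tendsto_of_le_of_le tendsto_const_nhds l3
      (fun _ => zero_le) fun k => ?_
    have hmg := aestronglyMeasurable_mollify (ρ k) hgl
    have e1 : ∀ x ∈ U, deriv ψ (u x) • g x - gradient (fun x => ψ (mollify (ρ k) H x)) x =
        deriv ψ (mollify (ρ k) H x) • (gH x - mollify (ρ k) gH x) +
        (deriv ψ (H x) - deriv ψ (mollify (ρ k) H x)) • gH x := fun x hx => by
      rw [(hHu x hx).2, gradient_comp (hψ.differentiable (by simp) _)
        ((hcd k).differentiable (by simp) _), gradient_mollify _ hH]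
      module
    rw [eLpNorm_congr_ae ((ae_restrict_iff' hU.measurableSet).2 (Eventually.of_forall e1))]
    have hm1 : AEStronglyMeasurable (fun x => deriv ψ (mollify (ρ k) H x)) volume :=
      (hdψ.comp (hcd k).continuous).aestronglyMeasurable
    refine (eLpNorm_mono_measure _ Measure.restrict_le_self).trans
      ((eLpNorm_add_le (hm1.smul (hg2.1.sub hmg))
        (((hdψ.comp hHc).aestronglyMeasurable.sub hm1).smul hg2.1) (by norm_num)).trans ?_)
    refine add_le_add ?_ le_rfl
    refine eLpNorm_le_mul_eLpNorm_of_ae_le_mul (Eventually.of_forall fun x => ?_) 2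
    rw [Pi.smul_apply', norm_smul]
    exact mul_le_mul_of_nonneg_right (hC _) (norm_nonneg _)

/-- A function in `H¹(U) ∩ C⁰(closure U)` that vanishes on `∂U` lies in `H¹₀(U)`. The truncations
`ε ψ(u / ε)` have compact support; as `ε → 0`, their gradients converge to `∇u` restricted to
`{u ≠ 0}`, which therefore is a weak gradient of `u`, and equals `∇u` by uniqueness. -/
theorem HasWeakGrad.testApprox_of_zero_on_frontier (hU : IsOpen U) (hb : Bornology.IsBounded U)
    (hc : ContinuousOn u (closure U)) (h0 : ∀ x ∈ frontier U, u x = 0) (hu : HasWeakGrad U u g) :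
    TestApprox U u g := by
  have : IsFiniteMeasure (volume.restrict U) := isFiniteMeasure_restrict.2 hb.measure_lt_top.ne
  obtain ⟨ψ, C, hψ, hψ0, hψs, hψ1, hC⟩ := exists_truncation
  have hucU : AEStronglyMeasurable u (volume.restrict U) := hu.1.1
  let e : ℕ → ℝ := fun k => 1 / ((k : ℝ) + 1)
  have he : ∀ k, 0 < e k := fun k => by positivity
  have he0 : Tendsto e atTop (𝓝 0) := tendsto_one_div_add_atTop_nhds_zero_nat
  let Ψ : ℕ → ℝ → ℝ := fun k s => e k * ψ (s / e k)
  have hΨ : ∀ k, ContDiff ℝ ∞ (Ψ k) := fun k =>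
    contDiff_const.mul (hψ.comp (contDiff_id.div_const _))
  have hdΨ : ∀ k s, deriv (Ψ k) s = deriv ψ (s / e k) := fun k s => by
    have h1 : HasDerivAt (Ψ k) (e k * (deriv ψ (s / e k) * (1 / e k))) s :=
      (((hψ.differentiable (by simp)) (s / e k)).hasDerivAt.comp s
        ((hasDerivAt_id s).div_const (e k))).const_mul (e k)
    rw [h1.deriv]
    field_simp [(he k).ne']
  have hk : ∀ k, TestApprox U (fun x => Ψ k (u x)) (fun x => deriv (Ψ k) (u x) • g x) := fun k =>
    hu.testApprox_comp hU hb hc h0 (he k) (hΨ k) (fun s hs => by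
      have : |s / e k| ≤ 1 := by
        rw [abs_div, abs_of_pos (he k)]; exact div_le_one_of_le₀ hs (he k).le
      simp [Ψ, hψ0 _ this]) (fun s => by rw [hdΨ]; exact hC _)
  have hbd : ∀ k s, |s - Ψ k s| ≤ 2 * e k := fun k s => by
    have h1 : s - Ψ k s = -(e k * (ψ (s / e k) - s / e k)) := by
      simp only [Ψ]; field_simp [(he k).ne']; ring
    rw [h1, abs_neg, abs_mul, abs_of_pos (he k), mul_comm]
    exact mul_le_mul_of_nonneg_right (hψs _) (he k).le
  have hdc : ∀ k, Continuous (deriv (Ψ k)) := fun k => (hΨ k).continuous_deriv (by simp)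
  -- the pointwise limit of `(Ψ k)'`
  set χ : ℝ → ℝ := fun s => if s = 0 then 0 else 1 with hχ
  have hχm : Measurable χ := measurable_const.ite (measurableSet_singleton 0) measurable_const
  have hχb : ∀ s, |χ s| ≤ 1 := fun s => by simp only [hχ]; split_ifs <;> simp
  have hlim : ∀ s, Tendsto (fun k => χ s - deriv (Ψ k) s) atTop (𝓝 0) := fun s => by
    rcases eq_or_ne s 0 with rfl | hs
    · refine tendsto_const_nhds.congr fun k => ?_
      have : deriv ψ 0 = 0 := by
        have : ψ =ᶠ[𝓝 0] fun _ => 0 := by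
          filter_upwards [(isOpen_lt continuous_abs continuous_const).mem_nhds
            (show |(0 : ℝ)| < 1 by simp)] with y hy
          exact hψ0 y (le_of_lt hy)
        rw [this.deriv_eq, deriv_const]
      rw [hdΨ]; simp [hχ, this]
    · have h2 : ∀ᶠ k in atTop, e k < |s| / 2 := he0.eventually (gt_mem_nhds (by positivity))
      refine tendsto_const_nhds.congr' ?_
      filter_upwards [h2] with k hk
      have : 2 < |s / e k| := by
        rw [abs_div, abs_of_pos (he k), lt_div_iff₀ (he k)]; linarith
      rw [hdΨ, hψ1 _ this]; simp [hχ, hs]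
  have hmk : ∀ k, AEStronglyMeasurable (fun x => deriv (Ψ k) (u x)) (volume.restrict U) :=
    fun k => (hdc k).comp_aestronglyMeasurable hucU
  have hmχ : AEStronglyMeasurable (fun x => χ (u x)) (volume.restrict U) :=
    (hχm.comp_aemeasurable hucU.aemeasurable).aestronglyMeasurable
  have hg' : MemLp (fun x => χ (u x) • g x) 2 (volume.restrict U) :=
    hu.2.1.of_le_mul (c := 1) (hmχ.smul hu.2.1.1) (Eventually.of_forall fun x => by
      rw [norm_smul]; exact mul_le_mul_of_nonneg_right (hχb _) (norm_nonneg _))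
  have happ : TestApprox U u (fun x => χ (u x) • g x) := by
    refine TestApprox.of_limit (uk := fun k x => Ψ k (u x))
      (gk := fun k x => deriv (Ψ k) (u x) • g x) hu.1 hg' (fun k => ?_) (fun k => ?_) hk ?_ ?_
    · refine hu.1.of_le_mul (c := C) ((hΨ k).continuous.comp_aestronglyMeasurable hucU)
        (Eventually.of_forall fun x => ?_)
      have := convex_univ.norm_image_sub_le_of_norm_deriv_le (f := Ψ k) (C := C)
        (fun x _ => ((hΨ k).differentiable (by simp)) x)
        (fun x _ => by rw [hdΨ]; exact hC _) (mem_univ 0) (mem_univ (u x))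
      simpa [Ψ, hψ0 0] using this
    · exact hu.2.1.of_le_mul (c := C) ((hmk k).smul hu.2.1.1) (Eventually.of_forall fun x => by
        rw [norm_smul, hdΨ]; exact mul_le_mul_of_nonneg_right (hC _) (norm_nonneg _))
    · have l1 : Tendsto (fun k => (volume.restrict U) univ ^ (ENNReal.toReal 2)⁻¹ *
          ENNReal.ofReal (2 * e k)) atTop (𝓝 0) := by
        have h1 : Tendsto (fun k => ENNReal.ofReal (2 * e k)) atTop (𝓝 0) := by
          have := (ENNReal.continuous_ofReal.tendsto _).comp (he0.const_mul 2)
          simpa [Function.comp_def] using this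
        have := ENNReal.Tendsto.const_mul
          (a := (volume.restrict U) univ ^ (ENNReal.toReal 2)⁻¹) h1
          (Or.inr (ENNReal.rpow_ne_top_of_nonneg (by positivity) (measure_ne_top _ _)))
        simpa using this
      exact tendsto_of_tendsto_of_tendsto_of_le_of_le tendsto_const_nhds l1 (fun _ => zero_le)
        fun k => eLpNorm_le_of_ae_bound (Eventually.of_forall fun x => hbd k (u x))
    · have := tendsto_eLpNorm_smul_of_tendsto_ae hu.2.1
        (a := fun k x => χ (u x) - deriv (Ψ k) (u x)) (fun k => hmχ.sub (hmk k)) (1 + C)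
        (fun k => Eventually.of_forall fun x => (abs_sub _ _).trans
          (add_le_add (hχb _) (by rw [hdΨ]; exact hC _)))
        (Eventually.of_forall fun x => hlim (u x))
      simpa only [sub_smul] using this
  exact happ.congr ((happ.hasWeakGrad hu.1 hg').unique hU hu)

/-- A function in `H¹₀(U)` with vanishing gradient vanishes, by the Sobolev inequality
`‖φ‖_{L²} ≤ C ‖∇φ‖_{L¹}` for test functions in the plane. -/
theorem TestApprox.ae_eq_zero (hb : Bornology.IsBounded U)
    (hu : MemLp u 2 (volume.restrict U)) (h : TestApprox U u g)
    (hg : g =ᵐ[volume.restrict U] 0) : u =ᵐ[volume.restrict U] 0 := by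
  have hfin : volume U ≠ ⊤ := hb.measure_lt_top.ne
  obtain ⟨C, hC⟩ : ∃ C : ENNReal, C ≠ ⊤ ∧ ∀ φ, IsTest U φ →
      eLpNorm φ 2 (volume.restrict U) ≤ C * eLpNorm (gradient φ) 2 (volume.restrict U) := by
    refine ⟨eLpNormLESNormFDerivOneConst (volume : Measure Pt) ((2 : NNReal) : ℝ) *
      volume U ^ (1 / 2 : ℝ), ENNReal.mul_ne_top ENNReal.coe_ne_top
      (ENNReal.rpow_ne_top_of_nonneg (by norm_num) hfin), fun φ hφ => ?_⟩
    have h1 := eLpNorm_le_eLpNorm_fderiv_one (volume : Measure Pt) (hφ.1.of_le (by simp))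
      hφ.2.1 (p := 2) (by
        rw [NNReal.holderConjugate_iff]; simp; norm_num)
    have h2 : eLpNorm (fderiv ℝ φ) 1 volume = eLpNorm (gradient φ) 1 (volume.restrict U) := by
      rw [eLpNorm_restrict_eq_of_support_subset]
      · exact eLpNorm_congr_norm_ae (Eventually.of_forall fun x => (norm_gradient φ x).symm)
      · exact (subset_tsupport _).trans (tsupport_gradient_subset.trans hφ.2.2)
    have h3 := eLpNorm_le_eLpNorm_mul_rpow_measure_univ (μ := volume.restrict U)
      (p := 1) (q := 2) (by norm_num) (hφ.memLp_gradient 2 _).1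
    rw [Measure.restrict_apply_univ] at h3
    refine (eLpNorm_mono_measure _ Measure.restrict_le_self).trans (h1.trans ?_)
    rw [h2, mul_assoc]
    gcongr
    refine h3.trans (le_of_eq ?_)
    rw [mul_comm]
    norm_num
  obtain ⟨φ, hφ, h1, h2⟩ := h.exists_seq
  have h3 := h1.add (ENNReal.Tendsto.const_mul (a := C) h2 (Or.inr hC.1))
  rw [mul_zero, add_zero] at h3
  refine (eLpNorm_eq_zero_iff hu.1 (p := 2) (by norm_num)).1 (le_antisymm ?_ zero_le)
  refine ge_of_tendsto' h3 fun k => ?_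
  have h4 : eLpNorm (gradient (φ k)) 2 (volume.restrict U) =
      eLpNorm (fun x => g x - gradient (φ k) x) 2 (volume.restrict U) := by
    refine eLpNorm_congr_norm_ae ?_
    filter_upwards [hg] with x hx
    simp [hx]
  rw [← h4]
  calc eLpNorm u 2 (volume.restrict U)
      = eLpNorm ((fun x => u x - φ k x) + φ k) 2 (volume.restrict U) := by
        congr 1; ext x; simp
    _ ≤ _ := (eLpNorm_add_le (hu.1.sub ((hφ k).memLp 2 _).1) ((hφ k).memLp 2 _).1
        (by norm_num)).trans (add_le_add le_rfl (hC.2 _ (hφ k)))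

end VEM

namespace VEM

/-! ### Polynomials of bounded degree -/

theorem monomial_mem_polySpace {k : ℤ} {a b : ℕ} (h : (a : ℤ) + b ≤ k) :
    (fun x : Pt => x 0 ^ a * x 1 ^ b) ∈ polySpace k :=
  Submodule.subset_span ⟨a, b, h, rfl⟩

theorem polySpace_mono {k l : ℤ} (h : k ≤ l) : polySpace k ≤ polySpace l :=
  Submodule.span_mono fun _ ⟨a, b, hab, hf⟩ => ⟨a, b, hab.trans h, hf⟩

theorem const_mem_polySpace {k : ℤ} (hk : 0 ≤ k) (c : ℝ) : (fun _ : Pt => c) ∈ polySpace k := by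
  have := (polySpace k).smul_mem c (monomial_mem_polySpace (a := 0) (b := 0) (by simpa using hk))
  convert! this using 1
  ext x; simp

instance finiteDimensional_polySpace (k : ℤ) : FiniteDimensional ℝ (polySpace k) := by
  refine FiniteDimensional.span_of_finite ℝ (Set.Finite.subset
    ((Set.finite_Iic (k.toNat, k.toNat)).image fun ab : ℕ × ℕ =>
      fun x : Pt => x 0 ^ ab.1 * x 1 ^ ab.2) ?_)
  rintro _ ⟨a, b, h, rfl⟩
  exact ⟨(a, b), ⟨by simp; omega, by simp; omega⟩, rfl⟩

theorem mul_mem_polySpace {k l : ℤ} {f g : Pt → ℝ} (hf : f ∈ polySpace k) (hg : g ∈ polySpace l) :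
    f * g ∈ polySpace (k + l) := by
  have : polySpace k * polySpace l ≤ polySpace (k + l) := by
    rw [polySpace, polySpace, Submodule.span_mul_span]
    refine Submodule.span_le.2 ?_
    rintro _ ⟨_, ⟨a, b, h, rfl⟩, _, ⟨a', b', h', rfl⟩, rfl⟩
    refine Submodule.subset_span ⟨a + a', b + b', by push_cast; omega, ?_⟩
    ext x
    simp only [Pi.mul_apply]
    ring
  exact this (Submodule.mul_mem_mul hf hg)

theorem pow_mem_polySpace {k : ℤ} {f : Pt → ℝ} (hf : f ∈ polySpace k) (n : ℕ) :
    f ^ n ∈ polySpace (n * k) := by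
  induction n with
  | zero =>
    rw [Nat.cast_zero, zero_mul]
    exact const_mem_polySpace (le_refl 0) 1
  | succ n ih =>
    have := mul_mem_polySpace ih hf
    rw [pow_succ]
    convert this using 2
    push_cast; ring

theorem analyticOnNhd_of_mem_polySpace {k : ℤ} {f : Pt → ℝ} (hf : f ∈ polySpace k) :
    AnalyticOnNhd ℝ f univ := by
  induction hf using Submodule.span_induction with
  | mem f hf =>
    obtain ⟨a, b, -, rfl⟩ := hf
    have h : ∀ i, AnalyticOnNhd ℝ (fun x : Pt => x i) univ := fun i =>
      (EuclideanSpace.proj (𝕜 := ℝ) i : Pt →L[ℝ] ℝ).analyticOnNhd univ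
    exact ((h 0).pow a).mul ((h 1).pow b)
  | zero => exact analyticOnNhd_const
  | add f g _ _ hf hg => exact hf.add hg
  | smul c f _ hf =>
    exact (analyticOnNhd_const.mul hf : AnalyticOnNhd ℝ (fun x => c * f x) univ)

theorem contDiff_of_mem_polySpace {k : ℤ} {f : Pt → ℝ} (hf : f ∈ polySpace k) :
    ContDiff ℝ ∞ f := by
  have h : ContDiffOn ℝ ω f univ :=
    (analyticOnNhd_of_mem_polySpace hf).contDiffOn uniqueDiffOn_univ
  exact (contDiffOn_univ.1 h).of_le le_top

theorem differentiable_of_mem_polySpace {k : ℤ} {f : Pt → ℝ} (hf : f ∈ polySpace k) :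
    Differentiable ℝ f := (contDiff_of_mem_polySpace hf).differentiable (by simp)

theorem continuous_of_mem_polySpace {k : ℤ} {f : Pt → ℝ} (hf : f ∈ polySpace k) :
    Continuous f := (contDiff_of_mem_polySpace hf).continuous

theorem continuous_gradient_of_mem_polySpace {k : ℤ} {f : Pt → ℝ} (hf : f ∈ polySpace k) :
    Continuous (gradient f) := continuous_gradient (contDiff_of_mem_polySpace hf) (by simp)

theorem eq_zero_of_mem_polySpace {k : ℤ} {f : Pt → ℝ} (hf : f ∈ polySpace k) {U : Set Pt}
    (hU : IsOpen U) (hne : U.Nonempty) (h : f =ᵐ[volume.restrict U] 0) : f = 0 := by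
  have h1 : EqOn f 0 U := Measure.eqOn_open_of_ae_eq h hU
    (continuous_of_mem_polySpace hf).continuousOn continuousOn_const
  obtain ⟨z, hz⟩ := hne
  exact (analyticOnNhd_of_mem_polySpace hf).eq_of_eventuallyEq analyticOnNhd_const
    (h1.eventuallyEq_of_mem (hU.mem_nhds hz))

theorem gradient_apply (f : Pt → ℝ) (x : Pt) (i : Fin 2) :
    gradient f x i = fderiv ℝ f x (EuclideanSpace.single i 1) := by
  rw [← inner_gradient_left, EuclideanSpace.inner_single_right]
  simp

theorem gradient_apply_mem_polySpace {k : ℤ} {f : Pt → ℝ} (hf : f ∈ polySpace k) (i : Fin 2) :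
    (fun x => gradient f x i) ∈ polySpace k := by
  have hzero : (fun _ => 0) ∈ polySpace k := (polySpace k).zero_mem
  induction hf using Submodule.span_induction with
  | mem f hf =>
    obtain ⟨a, b, h, rfl⟩ := hf
    have hd : ∀ x : Pt, HasFDerivAt (fun x : Pt => x 0 ^ a * x 1 ^ b)
        (x 0 ^ a • ((b * x 1 ^ (b - 1)) • (EuclideanSpace.proj (𝕜 := ℝ) 1 : Pt →L[ℝ] ℝ)) +
          x 1 ^ b • ((a * x 0 ^ (a - 1)) • (EuclideanSpace.proj (𝕜 := ℝ) 0 : Pt →L[ℝ] ℝ))) x :=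
      fun x => ((hasDerivAt_pow a (x 0)).comp_hasFDerivAt x
        (EuclideanSpace.proj (𝕜 := ℝ) 0 : Pt →L[ℝ] ℝ).hasFDerivAt).fun_mul
        ((hasDerivAt_pow b (x 1)).comp_hasFDerivAt x
        (EuclideanSpace.proj (𝕜 := ℝ) 1 : Pt →L[ℝ] ℝ).hasFDerivAt)
    simp only [gradient_apply, fun x => (hd x).fderiv]
    fin_cases i
    · rcases a with _ | a
      · simpa using hzero
      · have := (polySpace k).smul_mem ((a : ℝ) + 1) (monomial_mem_polySpace (a := a) (b := b)
          (by push_cast at h; omega))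
        convert! this using 1
        ext x
        simp
        ring
    · rcases b with _ | b
      · simpa using hzero
      · have := (polySpace k).smul_mem ((b : ℝ) + 1) (monomial_mem_polySpace (a := a) (b := b)
          (by push_cast at h; omega))
        convert! this using 1
        ext x
        simp
        ring
  | zero =>
    simpa [gradient_apply] using hzero
  | add f g hf' hg' hf hg =>
    have := (polySpace k).add_mem hf hg
    convert! this using 1
    ext x
    have := gradient_add (differentiable_of_mem_polySpace hf' x)
      (differentiable_of_mem_polySpace hg' x)
    simp only [Pi.add_apply]
    rw [← PiLp.add_apply, ← this]
    rfl
  | smul c f hf' hf =>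
    have := (polySpace k).smul_mem c hf
    convert! this using 1
    ext x
    have := gradient_const_mul c (differentiable_of_mem_polySpace hf' x)
    simp only [Pi.smul_apply]
    rw [← PiLp.smul_apply, ← this]
    rfl

theorem eq_const_of_gradient_eq_zero {k : ℤ} {f : Pt → ℝ} (hf : f ∈ polySpace k) {U : Set Pt}
    (hU : IsOpen U) (hne : U.Nonempty) (h : gradient f =ᵐ[volume.restrict U] 0) (x y : Pt) :
    f x = f y := by
  refine is_const_of_fderiv_eq_zero (differentiable_of_mem_polySpace hf) (fun z => ?_) x y
  have h1 : ∀ i, (fun x => gradient f x i) = 0 := fun i =>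
    eq_zero_of_mem_polySpace (gradient_apply_mem_polySpace hf i) hU hne
      (h.mono fun x hx => by simp [hx])
  rw [← norm_eq_zero, ← norm_gradient, norm_eq_zero]
  ext i
  exact congrFun (h1 i) z

/-- The restriction of a polynomial to a line. -/
theorem exists_polynomial_lineMap {p : ℕ} {f : Pt → ℝ} (hf : f ∈ polySpace p) (a b : Pt) :
    ∃ r : Polynomial ℝ, r.natDegree ≤ p ∧ ∀ s : ℝ, f (AffineMap.lineMap a b s) = r.eval s := by
  induction hf using Submodule.span_induction with
  | mem f hf =>
    obtain ⟨m, n, h, rfl⟩ := hf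
    have hd : ∀ i : Fin 2, (Polynomial.C (b i - a i) * Polynomial.X + Polynomial.C (a i) :
        Polynomial ℝ).natDegree ≤ 1 := fun i => Polynomial.natDegree_linear_le
    refine ⟨(Polynomial.C (b 0 - a 0) * Polynomial.X + Polynomial.C (a 0)) ^ m *
      (Polynomial.C (b 1 - a 1) * Polynomial.X + Polynomial.C (a 1)) ^ n, ?_, fun s => ?_⟩
    · have h1 := Polynomial.natDegree_pow_le_of_le m (hd 0)
      have h2 := Polynomial.natDegree_pow_le_of_le n (hd 1)
      refine Polynomial.natDegree_mul_le.trans ?_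
      omega
    · simp [AffineMap.lineMap_apply, mul_comm]
  | zero => exact ⟨0, by simp, by simp⟩
  | add f g _ _ hf hg =>
    obtain ⟨r, hr, hr'⟩ := hf
    obtain ⟨r', hr1, hr2⟩ := hg
    exact ⟨r + r', Polynomial.natDegree_add_le_of_degree_le hr hr1, fun s => by
      simp [hr', hr2]⟩
  | smul c f _ hf =>
    obtain ⟨r, hr, hr'⟩ := hf
    exact ⟨c • r, (Polynomial.natDegree_smul_le c r).trans hr, fun s => by simp [hr']⟩

/-- `ℙ_k` is invariant under translations and dilations. -/
theorem comp_affine_mem_polySpace {k : ℤ} {f : Pt → ℝ} (hf : f ∈ polySpace k) (z : Pt) (h : ℝ) :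
    (fun y => f (z + h • y)) ∈ polySpace k := by
  induction hf using Submodule.span_induction with
  | mem f hf =>
    obtain ⟨a, b, hab, rfl⟩ := hf
    have hl : ∀ i : Fin 2, (fun y : Pt => z i + h * y i) ∈ polySpace 1 := fun i => by
      refine (polySpace 1).add_mem (const_mem_polySpace (by norm_num) (z i))
        ((polySpace 1).smul_mem h ?_)
      fin_cases i
      · simpa using monomial_mem_polySpace (k := 1) (a := 1) (b := 0) (by norm_num)
      · simpa using monomial_mem_polySpace (k := 1) (a := 0) (b := 1) (by norm_num)
    have := mul_mem_polySpace (pow_mem_polySpace (hl 0) a) (pow_mem_polySpace (hl 1) b)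
    rw [mul_one, mul_one] at this
    exact polySpace_mono hab this
  | zero => exact (polySpace k).zero_mem
  | add f g _ _ hf hg => exact (polySpace k).add_mem hf hg
  | smul c f _ hf => exact (polySpace k).smul_mem c hf

theorem memLp_of_mem_polySpace {k : ℤ} {f : Pt → ℝ} (hf : f ∈ polySpace k) {U : Set Pt}
    (hb : Bornology.IsBounded U) (p : ENNReal) : MemLp f p (volume.restrict U) :=
  memLp_of_continuous_of_isBounded (continuous_of_mem_polySpace hf) hb p

theorem memLp_gradient_of_mem_polySpace {k : ℤ} {f : Pt → ℝ} (hf : f ∈ polySpace k) {U : Set Pt}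
    (hb : Bornology.IsBounded U) (p : ENNReal) : MemLp (gradient f) p (volume.restrict U) :=
  memLp_of_continuous_of_isBounded (continuous_gradient_of_mem_polySpace hf) hb p

theorem integrable_mul_of_memLp {α : Type*} [MeasurableSpace α] {ν : Measure α} {f g : α → ℝ}
    (hf : MemLp f 2 ν) (hg : MemLp g 2 ν) : Integrable (fun x => f x * g x) ν :=
  hf.integrable_mul hg

theorem integrable_inner_of_memLp {α : Type*} [MeasurableSpace α] {ν : Measure α} {f g : α → Pt}
    (hf : MemLp f 2 ν) (hg : MemLp g 2 ν) : Integrable (fun x => inner ℝ (f x) (g x)) ν := by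
  refine (hf.norm.integrable_mul hg.norm).mono' (hf.1.inner hg.1)
    (Eventually.of_forall fun x => ?_)
  exact abs_real_inner_le_norm _ _

/-- The Laplacian of a polynomial in the sense of distributions is a polynomial. -/
theorem exists_laplacian_of_mem_polySpace {k : ℤ} {f : Pt → ℝ} (hf : f ∈ polySpace k)
    (U : Set Pt) : ∃ q ∈ polySpace k, ∀ φ, IsTest U φ →
      ∫ x in U, inner ℝ (gradient f x) (gradient φ x) = - ∫ x in U, q x * φ x := by
  refine ⟨fun x => ∑ i, gradient (fun y => gradient f y i) x i, ?_, fun φ hφ => ?_⟩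
  · exact (Finset.sum_fn _ fun i (x : Pt) => gradient (fun y => gradient f y i) x i) ▸
      (polySpace k).sum_mem fun i _ =>
        gradient_apply_mem_polySpace (gradient_apply_mem_polySpace hf i) i
  · have hi := fun i => gradient_apply_mem_polySpace hf i
    have hgl : ∀ i, LocallyIntegrable (fun x => gradient f x i) := fun i =>
      (continuous_of_mem_polySpace (hi i)).locallyIntegrable
    have i1 : ∀ i, Integrable (fun x => gradient f x i • gradient φ x)
        (volume.restrict U) := fun i => by
      refine Integrable.integrableOn ?_
      exact ((continuous_of_mem_polySpace (hi i)).smul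
        hφ.continuous_gradient).integrable_of_hasCompactSupport
        (hasCompactSupport_gradient hφ.2.1).smul_left
    have i2 : ∀ i, Integrable (fun x => φ x • gradient (fun y => gradient f y i) x)
        (volume.restrict U) := fun i => by
      refine Integrable.integrableOn ?_
      exact (hφ.1.continuous.smul
        (continuous_gradient_of_mem_polySpace (hi i))).integrable_of_hasCompactSupport
        hφ.2.1.smul_right
    have key : ∀ i : Fin 2, ∫ x in U, gradient f x i * gradient φ x i =
        - ∫ x in U, φ x * gradient (fun y => gradient f y i) x i := fun i => by
      have h1 := integral_smul_gradient_eq_neg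
        ((contDiff_of_mem_polySpace (hi i)).of_le (by simp)) hφ
      rw [← setIntegral_smul_gradient_eq _ hφ, ← setIntegral_test_smul_eq _ hφ] at h1
      have h2 := congrArg (EuclideanSpace.proj (𝕜 := ℝ) i : Pt →L[ℝ] ℝ) h1
      rw [map_neg, ← ContinuousLinearMap.integral_comp_comm _ (i1 i),
        ← ContinuousLinearMap.integral_comp_comm _ (i2 i)] at h2
      simpa using h2
    have j1 : ∀ i : Fin 2, Integrable (fun x => gradient f x i * gradient φ x i)
        (volume.restrict U) := fun i => by
      simpa using (EuclideanSpace.proj (𝕜 := ℝ) i : Pt →L[ℝ] ℝ).integrable_comp (i1 i)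
    have j2 : ∀ i : Fin 2, Integrable (fun x => φ x * gradient (fun y => gradient f y i) x i)
        (volume.restrict U) := fun i => by
      simpa using (EuclideanSpace.proj (𝕜 := ℝ) i : Pt →L[ℝ] ℝ).integrable_comp (i2 i)
    calc ∫ x in U, inner ℝ (gradient f x) (gradient φ x)
        = ∫ x in U, ∑ i, gradient f x i * gradient φ x i := by
          refine integral_congr_ae (Eventually.of_forall fun x => ?_)
          simp only [PiLp.inner_apply, RCLike.inner_apply, conj_trivial, mul_comm]
      _ = ∑ i, ∫ x in U, gradient f x i * gradient φ x i :=
          integral_finsetSum _ fun i _ => j1 i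
      _ = - ∑ i, ∫ x in U, φ x * gradient (fun y => gradient f y i) x i := by
          simp only [key, Finset.sum_neg_distrib]
      _ = _ := by
          rw [← integral_finsetSum _ fun i _ => j2 i]
          congr 1
          refine integral_congr_ae (Eventually.of_forall fun x => ?_)
          simp only [Finset.mul_sum, mul_comm]

/-! ### Representation of functionals on polynomials and the inverse inequality -/

/-- Lax–Milgram in finite dimensions. -/
theorem exists_representer {V : Type*} [AddCommGroup V] [Module ℝ V] [FiniteDimensional ℝ V]
    (B : V →ₗ[ℝ] V →ₗ[ℝ] ℝ) (hB : ∀ v, B v v = 0 → v = 0) (F : V →ₗ[ℝ] ℝ) :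
    ∃ v, ∀ w, B v w = F w := by
  have hinj : Function.Injective B := by
    refine (injective_iff_map_eq_zero B).2 fun v hv => hB v ?_
    rw [hv, LinearMap.zero_apply]
  have hsurj : Function.Surjective B :=
    (LinearMap.injective_iff_surjective_of_finrank_eq_finrank
      (Subspace.dual_finrank_eq (K := ℝ) (V := V)).symm).1 hinj
  obtain ⟨v, hv⟩ := hsurj F
  exact ⟨v, fun w => by rw [hv]⟩

/-- The `L²(U)` inner product on `ℙ_k`. -/
def l2Form {U : Set Pt} (hb : Bornology.IsBounded U) (k : ℤ) :
    polySpace k →ₗ[ℝ] polySpace k →ₗ[ℝ] ℝ :=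
  LinearMap.mk₂ ℝ (fun q r => ∫ x in U, (q : Pt → ℝ) x * (r : Pt → ℝ) x)
    (fun q q' r => by
      simp only [Submodule.coe_add, Pi.add_apply, add_mul]
      exact integral_add (integrable_mul_of_memLp (memLp_of_mem_polySpace q.2 hb 2)
        (memLp_of_mem_polySpace r.2 hb 2)) (integrable_mul_of_memLp
        (memLp_of_mem_polySpace q'.2 hb 2) (memLp_of_mem_polySpace r.2 hb 2)))
    (fun c q r => by
      simp only [Submodule.coe_smul, Pi.smul_apply, smul_eq_mul, mul_assoc]
      exact integral_const_mul _ _)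
    (fun q r r' => by
      simp only [Submodule.coe_add, Pi.add_apply, mul_add]
      exact integral_add (integrable_mul_of_memLp (memLp_of_mem_polySpace q.2 hb 2)
        (memLp_of_mem_polySpace r.2 hb 2)) (integrable_mul_of_memLp
        (memLp_of_mem_polySpace q.2 hb 2) (memLp_of_mem_polySpace r'.2 hb 2)))
    (fun c q r => by
      simp only [Submodule.coe_smul, Pi.smul_apply, smul_eq_mul, mul_left_comm _ c]
      exact integral_const_mul _ _)

theorem eq_zero_of_integral_sq {k : ℤ} {f : Pt → ℝ} (hf : f ∈ polySpace k) {U : Set Pt}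
    (hU : IsOpen U) (hne : U.Nonempty) (hb : Bornology.IsBounded U)
    (h : ∫ x in U, f x * f x = 0) : f = 0 := by
  refine eq_zero_of_mem_polySpace hf hU hne ?_
  have := (integral_eq_zero_iff_of_nonneg (fun x => mul_self_nonneg (f x))
    (integrable_mul_of_memLp (memLp_of_mem_polySpace hf hb 2)
      (memLp_of_mem_polySpace hf hb 2))).1 h
  exact this.mono fun x hx => mul_self_eq_zero.1 hx

/-- Every linear functional on `ℙ_k` is the `L²(U)` inner product with a polynomial. -/
theorem exists_l2_representer {U : Set Pt} (hU : IsOpen U) (hne : U.Nonempty)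
    (hb : Bornology.IsBounded U) {k : ℤ} (F : polySpace k →ₗ[ℝ] ℝ) :
    ∃ q ∈ polySpace k, ∀ r : polySpace k, ∫ x in U, q x * (r : Pt → ℝ) x = F r := by
  obtain ⟨q, hq⟩ := exists_representer (l2Form hb k)
    (fun v hv => Subtype.ext (eq_zero_of_integral_sq v.2 hU hne hb hv)) F
  exact ⟨q, q.2, hq⟩

/-- The reference inequality between the maximum over the unit disc and the `L²` norm over a disc.
With the reproducing kernel `K(x, y)` of `ℙ_k` for the `L²` inner product one has
`q(y)² ≤ K(y, y) ‖q‖²`, and `K(y, y)` is a polynomial in `y`. -/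
theorem exists_sq_le_integral (k : ℤ) {d : ℝ} (hd : 0 < d) :
    ∃ K : ℝ, 0 < K ∧ ∀ q ∈ polySpace k, ∀ y ∈ Metric.closedBall (0 : Pt) 1,
      q y ^ 2 ≤ K * ∫ x in Metric.ball (0 : Pt) d, q x ^ 2 := by
  have hb : Bornology.IsBounded (Metric.ball (0 : Pt) d) := Metric.isBounded_ball
  let b := Module.finBasis ℝ (polySpace k)
  choose r hr hrep using fun i => exists_l2_representer Metric.isOpen_ball
    ⟨0, Metric.mem_ball_self hd⟩ hb (b.coord i)
  have hcont : Continuous fun y : Pt => ∑ i, (b i : Pt → ℝ) y * r i y :=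
    continuous_finsetSum _ fun i _ => (continuous_of_mem_polySpace (b i).2).mul
      (continuous_of_mem_polySpace (hr i))
  obtain ⟨K, hK⟩ := (isCompact_closedBall (0 : Pt) 1).exists_bound_of_continuousOn
    hcont.continuousOn
  refine ⟨|K| + 1, by positivity, fun q hq y hy => ?_⟩
  set κ : Pt → ℝ := fun x => ∑ i, (b i : Pt → ℝ) y * r i x
  have hκ : κ ∈ polySpace k := by
    have := (polySpace k).sum_mem (t := Finset.univ) (f := fun i => (b i : Pt → ℝ) y • r i)
      fun i _ => (polySpace k).smul_mem _ (hr i)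
    convert! this using 1
    ext x; simp [κ]
  -- the reproducing property
  have hrepr : ∀ f : polySpace k, ∫ x in Metric.ball (0 : Pt) d, κ x * (f : Pt → ℝ) x =
      (f : Pt → ℝ) y := fun f => by
    have h1 : ∀ x, κ x * (f : Pt → ℝ) x =
        ∑ i, (b i : Pt → ℝ) y * (r i x * (f : Pt → ℝ) x) := fun x => by
      simp only [κ, Finset.sum_mul, mul_assoc]
    simp only [h1]
    rw [integral_finsetSum _ fun i _ => (integrable_mul_of_memLp
      (memLp_of_mem_polySpace (hr i) hb 2) (memLp_of_mem_polySpace f.2 hb 2)).const_mul _]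
    simp only [integral_const_mul, hrep]
    have h2 := congrArg (fun g : polySpace k => (g : Pt → ℝ) y) (b.sum_repr f)
    simp only [Submodule.coe_sum, Finset.sum_apply, Submodule.coe_smul, Pi.smul_apply,
      smul_eq_mul] at h2
    rw [← h2]
    exact Finset.sum_congr rfl fun i _ => mul_comm _ _
  have h1 := hrepr ⟨q, hq⟩
  have h2 := hrepr ⟨κ, hκ⟩
  simp only at h1 h2
  have h3 : κ y ≤ |K| + 1 := (le_abs_self _).trans ((hK y hy).trans (by linarith [le_abs_self K]))
  set t := q y / (|K| + 1) with ht
  have iqq := integrable_mul_of_memLp (memLp_of_mem_polySpace hq hb 2)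
    (memLp_of_mem_polySpace hq hb 2)
  have iκq := integrable_mul_of_memLp (memLp_of_mem_polySpace hκ hb 2)
    (memLp_of_mem_polySpace hq hb 2)
  have iκκ := integrable_mul_of_memLp (memLp_of_mem_polySpace hκ hb 2)
    (memLp_of_mem_polySpace hκ hb 2)
  have h4 : 0 ≤ ∫ x in Metric.ball (0 : Pt) d, (q x - t * κ x) ^ 2 :=
    integral_nonneg fun x => sq_nonneg _
  have h5 : ∀ x, (q x - t * κ x) ^ 2 =
      q x * q x - (2 * t) * (κ x * q x) + t ^ 2 * (κ x * κ x) := fun x => by ring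
  simp only [h5] at h4
  rw [integral_add (show Integrable (fun x => q x * q x - 2 * t * (κ x * q x)) _ from
      iqq.sub (iκq.const_mul _)) (iκκ.const_mul _),
    integral_sub iqq (iκq.const_mul _), integral_const_mul, integral_const_mul, h1, h2] at h4
  simp only [pow_two (q _)]
  have hKp : 0 < |K| + 1 := by positivity
  have hqt : q y = t * (|K| + 1) := by rw [ht]; field_simp
  rw [hqt] at h4 ⊢
  nlinarith [mul_le_mul_of_nonneg_left h3 (sq_nonneg t)]

/-- The inverse inequality on a disc of radius `h`: the maximum of a polynomial is bounded by
`C h⁻¹` times its `L²` norm over a concentric disc of comparable radius. -/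
theorem exists_inverse_inequality (k : ℤ) {d : ℝ} (hd : 0 < d) :
    ∃ K : ℝ, 0 < K ∧ ∀ (z : Pt) (h : ℝ), 0 < h → ∀ q ∈ polySpace k,
      ∀ x ∈ Metric.closedBall z h,
        q x ^ 2 * h ^ 2 ≤ K * ∫ y in Metric.ball z (d * h), q y ^ 2 := by
  obtain ⟨K, hK, hKq⟩ := exists_sq_le_integral k hd
  refine ⟨K, hK, fun z h hh q hq x hx => ?_⟩
  have h1 := hKq _ (comp_affine_mem_polySpace hq z h) (h⁻¹ • (x - z)) (by
    rw [mem_closedBall_zero_iff, norm_smul, norm_inv, Real.norm_of_nonneg hh.le,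
      inv_mul_le_iff₀ hh, mul_one, ← dist_eq_norm]
    exact hx)
  rw [smul_inv_smul₀ hh.ne', add_sub_cancel] at h1
  have h2 : ∫ y in Metric.ball (0 : Pt) d, q (z + h • y) ^ 2 =
      (h ^ 2)⁻¹ * ∫ y in Metric.ball z (d * h), q y ^ 2 := by
    let G : Pt → ℝ := (Metric.ball z (d * h)).indicator fun y => q y ^ 2
    have e1 : ∀ y, (Metric.ball (0 : Pt) d).indicator (fun y => q (z + h • y) ^ 2) y =
        G (z + h • y) := fun y => by
      have : y ∈ Metric.ball (0 : Pt) d ↔ z + h • y ∈ Metric.ball z (d * h) := by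
        rw [mem_ball_zero_iff, mem_ball_iff_norm, add_sub_cancel_left, norm_smul,
          Real.norm_of_nonneg hh.le, mul_comm h, mul_lt_mul_iff_left₀ hh]
      by_cases hy : y ∈ Metric.ball (0 : Pt) d
      · simp only [G, indicator_of_mem hy, indicator_of_mem (this.1 hy)]
      · simp only [G, indicator_of_notMem hy, indicator_of_notMem fun h' => hy (this.2 h')]
    rw [← integral_indicator measurableSet_ball, ← integral_indicator measurableSet_ball,
      integral_congr_ae (Eventually.of_forall e1),
      Measure.integral_comp_smul volume (fun y => G (z + y)) h, integral_add_left_eq_self]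
    simp [G]
  rw [h2] at h1
  calc q x ^ 2 * h ^ 2
      ≤ (K * ((h ^ 2)⁻¹ * ∫ y in Metric.ball z (d * h), q y ^ 2)) * h ^ 2 := by gcongr
    _ = _ := by field_simp

end VEM

namespace VEM

/-! ### Polygons -/

theorem volume_segment (a b : Pt) : volume (segment ℝ a b) = 0 := by
  refine measure_mono_null (t := (line[ℝ, a, b] : Set Pt)) ?_
    (Measure.addHaar_affineSubspace volume _ fun h => ?_)
  · rw [← convexHull_pair]
    exact convexHull_subset_affineSpan _
  · have h1 := collinear_iff_finrank_le_one.1 (collinear_pair ℝ a b)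
    rw [← direction_affineSpan, h, AffineSubspace.direction_top, finrank_top,
      finrank_euclideanSpace_fin] at h1
    omega

theorem finRotate_ne_self {n : ℕ} (hn : 2 ≤ n) (i : Fin n) : finRotate n i ≠ i := fun h => by
  obtain ⟨m, rfl⟩ : ∃ m, n = m + 1 := ⟨n - 1, by omega⟩
  rw [finRotate_apply] at h
  have h2 := congrArg Fin.val h
  rw [Fin.val_add_one] at h2
  split_ifs at h2 with h4
  · rw [h4, Fin.val_last] at h2
    omega
  · omega

namespace Polygon

variable (E : Polygon) {p : ℕ} {k : ℤ} {u v q r : Pt → ℝ}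

theorem measurableSet : MeasurableSet E.carrier := E.isOpen.measurableSet

theorem nonempty : E.carrier.Nonempty := E.isConnected.nonempty

theorem volume_frontier : volume (frontier E.carrier) = 0 := by
  rw [E.frontier_eq]
  exact measure_iUnion_null fun i => volume_segment _ _

theorem lineMap_mem_frontier (i : Fin E.n) {s : ℝ} (hs : s ∈ Icc (0 : ℝ) 1) :
    AffineMap.lineMap (E.vert i) (E.next i) s ∈ frontier E.carrier := by
  rw [E.frontier_eq]
  refine mem_iUnion.2 ⟨i, ?_⟩
  rw [segment_eq_image_lineMap]
  exact ⟨s, hs, rfl⟩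

theorem exists_lineMap_of_mem_frontier {x : Pt} (hx : x ∈ frontier E.carrier) :
    ∃ i, ∃ s ∈ Icc (0 : ℝ) 1, AffineMap.lineMap (E.vert i) (E.next i) s = x := by
  rw [E.frontier_eq] at hx
  obtain ⟨i, hi⟩ := mem_iUnion.1 hx
  rw [segment_eq_image_lineMap] at hi
  obtain ⟨s, hs, h⟩ := hi
  exact ⟨i, s, hs, h⟩

theorem dist_next_pos (i : Fin E.n) : 0 < dist (E.vert i) (E.next i) := by
  refine dist_pos.2 fun h => ?_
  exact finRotate_ne_self (by have := E.three_le; omega) i (E.vert_injective h).symm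

/-! ### Boundary integrals -/

/-- The restrictions of `u` to the edges are integrable. -/
def EdgeIntegrable (u : Pt → ℝ) : Prop :=
  ∀ i, IntervalIntegrable (fun s : ℝ => u (AffineMap.lineMap (E.vert i) (E.next i) s)) volume 0 1

variable {E}

theorem EdgeIntegrable.add (hu : E.EdgeIntegrable u) (hv : E.EdgeIntegrable v) :
    E.EdgeIntegrable (fun x => u x + v x) := fun i => (hu i).add (hv i)

theorem EdgeIntegrable.const_mul (c : ℝ) (hu : E.EdgeIntegrable u) :
    E.EdgeIntegrable (fun x => c * u x) := fun i => (hu i).const_mul c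

theorem edgeIntegrable_of_continuous (hu : Continuous u) : E.EdgeIntegrable u := fun _ =>
  (hu.comp AffineMap.lineMap_continuous).intervalIntegrable _ _

theorem EdgeIntegrable.congr (hu : E.EdgeIntegrable u)
    (huv : ∀ x ∈ frontier E.carrier, u x = v x) : E.EdgeIntegrable v := fun i =>
  (hu i).congr fun s hs => huv _ (E.lineMap_mem_frontier i (by
    rw [uIoc_of_le zero_le_one] at hs; exact Ioc_subset_Icc_self hs))

theorem boundaryIntegral_add (hu : E.EdgeIntegrable u) (hv : E.EdgeIntegrable v) :
    E.boundaryIntegral (fun x => u x + v x) = E.boundaryIntegral u + E.boundaryIntegral v := by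
  simp only [boundaryIntegral]
  rw [← Finset.sum_add_distrib]
  refine Finset.sum_congr rfl fun i _ => ?_
  rw [intervalIntegral.integral_add (hu i) (hv i), mul_add]

theorem boundaryIntegral_const_mul (c : ℝ) (u : Pt → ℝ) :
    E.boundaryIntegral (fun x => c * u x) = c * E.boundaryIntegral u := by
  simp only [boundaryIntegral, intervalIntegral.integral_const_mul, Finset.mul_sum]
  exact Finset.sum_congr rfl fun i _ => by ring

theorem boundaryIntegral_sub (hu : E.EdgeIntegrable u) (hv : E.EdgeIntegrable v) :
    E.boundaryIntegral (fun x => u x - v x) = E.boundaryIntegral u - E.boundaryIntegral v := by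
  have := boundaryIntegral_add hu (hv.const_mul (-1))
  rw [boundaryIntegral_const_mul] at this
  simpa [sub_eq_add_neg] using this

theorem boundaryIntegral_congr (huv : ∀ x ∈ frontier E.carrier, u x = v x) :
    E.boundaryIntegral u = E.boundaryIntegral v := by
  refine Finset.sum_congr rfl fun i _ => ?_
  congr 1
  refine intervalIntegral.integral_congr fun s hs => huv _ (E.lineMap_mem_frontier i ?_)
  rwa [uIcc_of_le zero_le_one] at hs

theorem boundaryIntegral_const_eq_zero {c : ℝ} (h : E.boundaryIntegral (fun _ => c) = 0) :
    c = 0 := by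
  simp only [boundaryIntegral, intervalIntegral.integral_const, sub_zero, one_smul] at h
  rw [← Finset.sum_mul] at h
  refine (mul_eq_zero.1 h).resolve_left (ne_of_gt ?_)
  exact Finset.sum_pos (fun i _ => E.dist_next_pos i)
    ⟨⟨0, by have := E.three_le; omega⟩, Finset.mem_univ _⟩

/-! ### Restriction to the closed polygon -/

theorem restr_of_mem_closure {x : Pt} (hx : x ∈ closure E.carrier) : E.restr u x = u x :=
  indicator_of_mem hx _

theorem restr_of_mem {x : Pt} (hx : x ∈ E.carrier) : E.restr u x = u x :=
  restr_of_mem_closure (subset_closure hx)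

theorem restr_of_mem_frontier {x : Pt} (hx : x ∈ frontier E.carrier) : E.restr u x = u x :=
  restr_of_mem_closure (frontier_subset_closure hx)

theorem restr_of_notMem {x : Pt} (hx : x ∉ closure E.carrier) : E.restr u x = 0 :=
  indicator_of_notMem hx _

theorem restr_ae_eq (u : Pt → ℝ) : E.restr u =ᵐ[volume.restrict E.carrier] u :=
  (ae_restrict_iff' E.measurableSet).2 (Eventually.of_forall fun _ hx => restr_of_mem hx)

theorem restr_add (u v : Pt → ℝ) : E.restr (fun x => u x + v x) = fun x =>
    E.restr u x + E.restr v x := indicator_add _ _ _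

theorem restr_const_mul (c : ℝ) (u : Pt → ℝ) : E.restr (fun x => c * u x) = fun x =>
    c * E.restr u x := funext fun x => indicator_const_mul _ _ _ x

theorem restr_sub (u v : Pt → ℝ) : E.restr (fun x => u x - v x) = fun x =>
    E.restr u x - E.restr v x := indicator_sub _ _ _

theorem hasWeakGrad_restr (hq : q ∈ polySpace k) :
    HasWeakGrad E.carrier (E.restr q) (gradient q) :=
  (hasWeakGrad_of_contDiff E.isBounded ((contDiff_of_mem_polySpace hq).of_le (by simp))).congr
    (restr_ae_eq q).symm (ae_eq_refl _)

/-! ### The `L²` projection -/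

theorem integrable_mul_poly (hu : MemLp u 2 (volume.restrict E.carrier)) (hr : r ∈ polySpace k) :
    Integrable (fun x => u x * r x) (volume.restrict E.carrier) :=
  integrable_mul_of_memLp hu (memLp_of_mem_polySpace hr E.isBounded 2)

theorem isL2Proj_iff (hu : MemLp u 2 (volume.restrict E.carrier)) (hq : q ∈ polySpace k) :
    E.IsL2Proj k u q ↔ ∀ r ∈ polySpace k,
      ∫ x in E.carrier, u x * r x = ∫ x in E.carrier, q x * r x := by
  rw [IsL2Proj, and_iff_right hq]
  refine forall₂_congr fun r hr => ?_
  simp only [sub_mul]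
  rw [integral_sub (integrable_mul_poly hu hr)
    (integrable_mul_poly (memLp_of_mem_polySpace hq E.isBounded 2) hr), sub_eq_zero]

theorem exists_isL2Proj (k : ℤ) (hu : MemLp u 2 (volume.restrict E.carrier)) :
    ∃ q, E.IsL2Proj k u q := by
  let F : polySpace k →ₗ[ℝ] ℝ :=
    { toFun := fun r => ∫ x in E.carrier, u x * (r : Pt → ℝ) x
      map_add' := fun r r' => by
        simp only [Submodule.coe_add, Pi.add_apply, mul_add]
        exact integral_add (integrable_mul_poly hu r.2) (integrable_mul_poly hu r'.2)
      map_smul' := fun c r => by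
        simp only [Submodule.coe_smul, Pi.smul_apply, smul_eq_mul, mul_left_comm _ c]
        exact integral_const_mul _ _ }
  obtain ⟨q, hq, h⟩ := exists_l2_representer E.isOpen E.nonempty E.isBounded F
  exact ⟨q, (isL2Proj_iff hu hq).2 fun r hr => (h ⟨r, hr⟩).symm⟩

theorem l2Proj_spec (k : ℤ) (hu : MemLp u 2 (volume.restrict E.carrier)) :
    E.IsL2Proj k u (E.l2Proj k u) := by
  rw [l2Proj, dif_pos (exists_isL2Proj k hu)]
  exact (exists_isL2Proj k hu).choose_spec

theorem l2Proj_mem (E : Polygon) (k : ℤ) (u : Pt → ℝ) : E.l2Proj k u ∈ polySpace k := by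
  rw [l2Proj]
  split_ifs with h
  · exact h.choose_spec.1
  · exact (polySpace k).zero_mem

theorem l2Proj_eq (hu : MemLp u 2 (volume.restrict E.carrier)) (hq : E.IsL2Proj k u q) :
    E.l2Proj k u = q := by
  have hd : E.l2Proj k u - q ∈ polySpace k := (polySpace k).sub_mem (l2Proj_mem E k u) hq.1
  refine sub_eq_zero.1 (eq_zero_of_integral_sq hd E.isOpen E.nonempty E.isBounded ?_)
  have h1 := (isL2Proj_iff hu (l2Proj_mem E k u)).1 (l2Proj_spec k hu) _ hd
  have h2 := (isL2Proj_iff hu hq.1).1 hq _ hd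
  simp only [Pi.sub_apply, sub_mul] at h1 h2 ⊢
  rw [integral_sub, ← h1, ← h2, sub_self]
  · exact integrable_mul_poly (memLp_of_mem_polySpace (l2Proj_mem E k u) E.isBounded 2) hd
  · exact integrable_mul_poly (memLp_of_mem_polySpace hq.1 E.isBounded 2) hd

theorem l2Proj_add (k : ℤ) (hu : MemLp u 2 (volume.restrict E.carrier))
    (hv : MemLp v 2 (volume.restrict E.carrier)) :
    E.l2Proj k (fun x => u x + v x) = fun x => E.l2Proj k u x + E.l2Proj k v x := by
  have hm := (polySpace k).add_mem (l2Proj_mem E k u) (l2Proj_mem E k v)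
  refine l2Proj_eq (hu.add hv) ((isL2Proj_iff (hu.add hv) hm).2 fun r hr => ?_)
  have h1 := (isL2Proj_iff hu (l2Proj_mem E k u)).1 (l2Proj_spec k hu) r hr
  have h2 := (isL2Proj_iff hv (l2Proj_mem E k v)).1 (l2Proj_spec k hv) r hr
  simp only [Pi.add_apply, add_mul]
  rw [integral_add (integrable_mul_poly hu hr) (integrable_mul_poly hv hr), h1, h2,
    integral_add (integrable_mul_poly (memLp_of_mem_polySpace (l2Proj_mem E k u) E.isBounded 2) hr)
    (integrable_mul_poly (memLp_of_mem_polySpace (l2Proj_mem E k v) E.isBounded 2) hr)]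

theorem l2Proj_const_mul (k : ℤ) (c : ℝ) (hu : MemLp u 2 (volume.restrict E.carrier)) :
    E.l2Proj k (fun x => c * u x) = fun x => c * E.l2Proj k u x := by
  have hm := (polySpace k).smul_mem c (l2Proj_mem E k u)
  refine l2Proj_eq (hu.const_mul c) ((isL2Proj_iff (hu.const_mul c) hm).2 fun r hr => ?_)
  have h1 := (isL2Proj_iff hu (l2Proj_mem E k u)).1 (l2Proj_spec k hu) r hr
  simp only [Pi.smul_apply, smul_eq_mul, mul_assoc]
  rw [integral_const_mul, integral_const_mul, h1]

theorem l2Proj_congr (k : ℤ) (hu : MemLp u 2 (volume.restrict E.carrier))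
    (huv : u =ᵐ[volume.restrict E.carrier] v) : E.l2Proj k u = E.l2Proj k v := by
  have hv := (memLp_congr_ae huv).1 hu
  refine l2Proj_eq hu ((isL2Proj_iff hu (l2Proj_mem E k v)).2 fun r hr => ?_)
  rw [← (isL2Proj_iff hv (l2Proj_mem E k v)).1 (l2Proj_spec k hv) r hr]
  exact integral_congr_ae (huv.mono fun x hx => by simp only [hx])

theorem l2Proj_of_ae_eq (hq : q ∈ polySpace k) (huq : u =ᵐ[volume.restrict E.carrier] q) :
    E.l2Proj k u = q := by
  have hqL := memLp_of_mem_polySpace hq E.isBounded 2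
  rw [← l2Proj_congr k hqL huq.symm]
  exact l2Proj_eq hqL ((isL2Proj_iff hqL hq).2 fun r _ => rfl)

theorem l2Proj_eq_zero (h : u =ᵐ[volume.restrict E.carrier] 0) : E.l2Proj k u = 0 :=
  l2Proj_of_ae_eq (polySpace k).zero_mem h

/-- The `L²` projection does not increase the `L²` norm. -/
theorem integral_l2Proj_sq_le (k : ℤ) (hu : MemLp u 2 (volume.restrict E.carrier)) :
    ∫ x in E.carrier, E.l2Proj k u x ^ 2 ≤ ∫ x in E.carrier, u x ^ 2 := by
  have hm := l2Proj_mem E k u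
  have hmL := memLp_of_mem_polySpace hm E.isBounded 2
  have h1 := (isL2Proj_iff hu hm).1 (l2Proj_spec k hu) _ hm
  have h2 : 0 ≤ ∫ x in E.carrier, (u x - E.l2Proj k u x) ^ 2 :=
    integral_nonneg fun x => sq_nonneg _
  have e : ∀ x, (u x - E.l2Proj k u x) ^ 2 =
      u x * u x - 2 * (u x * E.l2Proj k u x) + E.l2Proj k u x * E.l2Proj k u x := fun x => by ring
  simp only [e] at h2
  have i1 := integrable_mul_of_memLp hu hu
  have i2 := integrable_mul_of_memLp hu hmL
  have i3 := integrable_mul_of_memLp hmL hmL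
  rw [integral_add (show Integrable (fun x => u x * u x - 2 * (u x * E.l2Proj k u x)) _ from
    i1.sub (i2.const_mul _)) i3, integral_sub i1 (i2.const_mul _), integral_const_mul, h1] at h2
  simp only [pow_two]
  linarith

/-! ### The projection of the gradient -/

theorem memLp_weakGrad_apply (hu : MemH1 E.carrier u) (i : Fin 2) :
    MemLp (fun x => weakGrad E.carrier u x i) 2 (volume.restrict E.carrier) :=
  (EuclideanSpace.proj (𝕜 := ℝ) i : Pt →L[ℝ] ℝ).comp_memLp' hu.memLp_weakGrad

theorem gradProj_add (k : ℤ) (hu : MemH1 E.carrier u) (hv : MemH1 E.carrier v) (x : Pt) :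
    E.gradProj k (fun x => u x + v x) x = E.gradProj k u x + E.gradProj k v x := by
  have h : ∀ i, E.l2Proj k (fun y => weakGrad E.carrier (fun x => u x + v x) y i) =
      fun x => E.l2Proj k (fun y => weakGrad E.carrier u y i) x +
        E.l2Proj k (fun y => weakGrad E.carrier v y i) x := fun i => by
    rw [← l2Proj_add k (memLp_weakGrad_apply hu i) (memLp_weakGrad_apply hv i)]
    exact l2Proj_congr k (memLp_weakGrad_apply (hu.add hv) i)
      ((weakGrad_add E.isOpen hu hv).mono fun x hx => by simp only [hx, PiLp.add_apply])
  ext i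
  fin_cases i <;> simp [gradProj, h]

theorem gradProj_const_mul (k : ℤ) (c : ℝ) (hu : MemH1 E.carrier u) (x : Pt) :
    E.gradProj k (fun x => c * u x) x = c • E.gradProj k u x := by
  have h : ∀ i, E.l2Proj k (fun y => weakGrad E.carrier (fun x => c * u x) y i) =
      fun x => c * E.l2Proj k (fun y => weakGrad E.carrier u y i) x := fun i => by
    rw [← l2Proj_const_mul k c (memLp_weakGrad_apply hu i)]
    exact l2Proj_congr k (memLp_weakGrad_apply (hu.const_mul c) i)
      ((weakGrad_const_mul E.isOpen c hu).mono fun x hx => by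
        simp only [hx, PiLp.smul_apply, smul_eq_mul])
  ext i
  fin_cases i <;> simp [gradProj, h]

theorem gradProj_eq_zero (k : ℤ) (hu : weakGrad E.carrier u =ᵐ[volume.restrict E.carrier] 0)
    (x : Pt) : E.gradProj k u x = 0 := by
  have h : ∀ i, E.l2Proj k (fun y => weakGrad E.carrier u y i) = 0 := fun i =>
    l2Proj_eq_zero (hu.mono fun x hx => by simp [hx])
  ext i
  fin_cases i <;> simp [gradProj, h]

theorem continuous_gradProj (E : Polygon) (k : ℤ) (u : Pt → ℝ) : Continuous (E.gradProj k u) := by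
  have h : ∀ i, Continuous (E.l2Proj k fun y => weakGrad E.carrier u y i) := fun i =>
    continuous_of_mem_polySpace (l2Proj_mem E k _)
  refine (PiLp.continuous_toLp 2 _).comp (continuous_pi fun i => ?_)
  fin_cases i
  · exact h 0
  · exact h 1

/-! ### The elliptic projection -/

/-- The functions to which the elliptic projection applies. -/
def EllAdmissible (E : Polygon) (u : Pt → ℝ) : Prop := MemH1 E.carrier u ∧ E.EdgeIntegrable u

theorem EllAdmissible.add (hu : E.EllAdmissible u) (hv : E.EllAdmissible v) :
    E.EllAdmissible (fun x => u x + v x) := ⟨hu.1.add hv.1, hu.2.add hv.2⟩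

theorem EllAdmissible.const_mul (c : ℝ) (hu : E.EllAdmissible u) :
    E.EllAdmissible (fun x => c * u x) := ⟨hu.1.const_mul c, hu.2.const_mul c⟩

theorem integrable_inner_gradient (hu : MemH1 E.carrier u) (hr : r ∈ polySpace k) :
    Integrable (fun x => inner ℝ (weakGrad E.carrier u x) (gradient r x))
      (volume.restrict E.carrier) :=
  integrable_inner_of_memLp hu.memLp_weakGrad (memLp_gradient_of_mem_polySpace hr E.isBounded 2)

theorem integrable_gradient_gradient (hq : q ∈ polySpace k) (hr : r ∈ polySpace k) :
    Integrable (fun x => inner ℝ (gradient q x) (gradient r x)) (volume.restrict E.carrier) :=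
  integrable_inner_of_memLp (memLp_gradient_of_mem_polySpace hq E.isBounded 2)
    (memLp_gradient_of_mem_polySpace hr E.isBounded 2)

theorem isEllProj_iff (hu : E.EllAdmissible u) (hq : q ∈ polySpace p) :
    E.IsEllProj p u q ↔ (∀ r ∈ polySpace p,
      ∫ x in E.carrier, inner ℝ (weakGrad E.carrier u x) (gradient r x) =
        ∫ x in E.carrier, inner ℝ (gradient q x) (gradient r x)) ∧
      E.boundaryIntegral q = E.boundaryIntegral u := by
  rw [IsEllProj, and_iff_right hq, boundaryIntegral_sub
    (edgeIntegrable_of_continuous (continuous_of_mem_polySpace hq)) hu.2, sub_eq_zero]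
  refine and_congr_left fun _ => forall₂_congr fun r hr => ?_
  simp only [inner_sub_left]
  rw [integral_sub (integrable_inner_gradient hu.1 hr) (integrable_gradient_gradient hq hr),
    sub_eq_zero]

theorem eq_zero_of_ell (hq : q ∈ polySpace k)
    (h1 : ∫ x in E.carrier, inner ℝ (gradient q x) (gradient q x) = 0)
    (h2 : E.boundaryIntegral q = 0) : q = 0 := by
  have h3 := (integral_eq_zero_iff_of_nonneg (fun x => real_inner_self_nonneg)
    (integrable_gradient_gradient hq hq)).1 h1
  obtain ⟨z, hz⟩ := E.nonempty
  have hc : q = fun _ => q z := funext fun x => eq_const_of_gradient_eq_zero hq E.isOpen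
    E.nonempty (h3.mono fun x hx => inner_self_eq_zero.1 hx) x z
  rw [hc] at h2 ⊢
  rw [boundaryIntegral_const_eq_zero h2]
  rfl

/-- The inner product `(∇q, ∇r)_E + ∫_{∂E} q ds ∫_{∂E} r ds` on `ℙ_p`. -/
def ellForm (E : Polygon) (p : ℕ) : polySpace p →ₗ[ℝ] polySpace p →ₗ[ℝ] ℝ :=
  have hg : ∀ q r : polySpace p, gradient ((q + r : polySpace p) : Pt → ℝ) =
      fun x => gradient (q : Pt → ℝ) x + gradient (r : Pt → ℝ) x := fun q r => funext fun x =>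
    gradient_add (differentiable_of_mem_polySpace q.2 x) (differentiable_of_mem_polySpace r.2 x)
  have hs : ∀ (c : ℝ) (q : polySpace p), gradient ((c • q : polySpace p) : Pt → ℝ) =
      fun x => c • gradient (q : Pt → ℝ) x := fun c q => funext fun x =>
    gradient_const_mul c (differentiable_of_mem_polySpace q.2 x)
  have hb : ∀ q r : polySpace p, E.boundaryIntegral ((q + r : polySpace p) : Pt → ℝ) =
      E.boundaryIntegral q + E.boundaryIntegral r := fun q r =>
    boundaryIntegral_add (edgeIntegrable_of_continuous (continuous_of_mem_polySpace q.2))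
      (edgeIntegrable_of_continuous (continuous_of_mem_polySpace r.2))
  have hbs : ∀ (c : ℝ) (q : polySpace p), E.boundaryIntegral ((c • q : polySpace p) : Pt → ℝ) =
      c * E.boundaryIntegral q := fun c q => boundaryIntegral_const_mul c q
  LinearMap.mk₂ ℝ (fun q r =>
      (∫ x in E.carrier, inner ℝ (gradient (q : Pt → ℝ) x) (gradient (r : Pt → ℝ) x)) +
      E.boundaryIntegral q * E.boundaryIntegral r)
    (fun q q' r => by
      simp only [hg, hb, inner_add_left]
      rw [integral_add (integrable_gradient_gradient q.2 r.2)
        (integrable_gradient_gradient q'.2 r.2)]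
      ring)
    (fun c q r => by
      simp only [hs, hbs, inner_smul_left, conj_trivial, smul_eq_mul]
      rw [integral_const_mul]
      ring)
    (fun q r r' => by
      simp only [hg, hb, inner_add_right]
      rw [integral_add (integrable_gradient_gradient q.2 r.2)
        (integrable_gradient_gradient q.2 r'.2)]
      ring)
    (fun c q r => by
      simp only [hs, hbs, inner_smul_right, smul_eq_mul]
      rw [integral_const_mul]
      ring)

theorem ellForm_self_eq_zero (v : polySpace p) (h : E.ellForm p v v = 0) : v = 0 := by
  have h1 : 0 ≤ ∫ x in E.carrier, inner ℝ (gradient (v : Pt → ℝ) x) (gradient (v : Pt → ℝ) x) :=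
    integral_nonneg fun x => real_inner_self_nonneg
  have h2 := mul_self_nonneg (E.boundaryIntegral v)
  change (∫ x in E.carrier, inner ℝ (gradient (v : Pt → ℝ) x) (gradient (v : Pt → ℝ) x)) +
    E.boundaryIntegral v * E.boundaryIntegral v = 0 at h
  exact Subtype.ext (eq_zero_of_ell v.2 (by linarith) (mul_self_eq_zero.1 (by linarith)))

theorem exists_isEllProj (p : ℕ) (hu : E.EllAdmissible u) : ∃ q, E.IsEllProj p u q := by
  let F : polySpace p →ₗ[ℝ] ℝ :=
    { toFun := fun r =>
        (∫ x in E.carrier, inner ℝ (weakGrad E.carrier u x) (gradient (r : Pt → ℝ) x)) +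
        E.boundaryIntegral u * E.boundaryIntegral r
      map_add' := fun r r' => by
        have e1 : ∀ x, gradient ((r + r' : polySpace p) : Pt → ℝ) x =
            gradient (r : Pt → ℝ) x + gradient (r' : Pt → ℝ) x := fun x =>
          gradient_add (differentiable_of_mem_polySpace r.2 x)
            (differentiable_of_mem_polySpace r'.2 x)
        have e2 : E.boundaryIntegral ((r + r' : polySpace p) : Pt → ℝ) =
            E.boundaryIntegral r + E.boundaryIntegral r' :=
          boundaryIntegral_add (edgeIntegrable_of_continuous (continuous_of_mem_polySpace r.2))
            (edgeIntegrable_of_continuous (continuous_of_mem_polySpace r'.2))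
        simp only [e1, e2, inner_add_right]
        rw [integral_add (integrable_inner_gradient hu.1 r.2)
          (integrable_inner_gradient hu.1 r'.2)]
        ring
      map_smul' := fun c r => by
        have e1 : ∀ x, gradient ((c • r : polySpace p) : Pt → ℝ) x =
            c • gradient (r : Pt → ℝ) x := fun x =>
          gradient_const_mul c (differentiable_of_mem_polySpace r.2 x)
        have e2 : E.boundaryIntegral ((c • r : polySpace p) : Pt → ℝ) =
            c * E.boundaryIntegral r := boundaryIntegral_const_mul c r
        simp only [e1, e2, inner_smul_right, smul_eq_mul, RingHom.id_apply]
        rw [integral_const_mul]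
        ring }
  obtain ⟨q, hq⟩ := exists_representer (E.ellForm p) ellForm_self_eq_zero F
  have hq' : ∀ r : polySpace p,
      (∫ x in E.carrier, inner ℝ (gradient (q : Pt → ℝ) x) (gradient (r : Pt → ℝ) x)) +
      E.boundaryIntegral q * E.boundaryIntegral r =
      (∫ x in E.carrier, inner ℝ (weakGrad E.carrier u x) (gradient (r : Pt → ℝ) x)) +
        E.boundaryIntegral u * E.boundaryIntegral r := hq
  -- testing with constants gives the condition on the boundary integral
  have h1 : E.boundaryIntegral q = E.boundaryIntegral u := by
    have h2 := hq' ⟨fun _ => 1, const_mem_polySpace (Int.natCast_nonneg p) 1⟩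
    have h3 : ∀ x : Pt, gradient (fun _ : Pt => (1 : ℝ)) x = 0 := fun x => by simp [gradient]
    simp only [h3, inner_zero_right, integral_zero, zero_add] at h2
    exact mul_right_cancel₀ (fun h => one_ne_zero (boundaryIntegral_const_eq_zero h)) h2
  refine ⟨q, (isEllProj_iff hu q.2).2 ⟨fun r hr => ?_, h1⟩⟩
  have h2 := hq' ⟨r, hr⟩
  rw [h1] at h2
  exact (add_right_cancel h2).symm

theorem ellProj_spec (p : ℕ) (hu : E.EllAdmissible u) : E.IsEllProj p u (E.ellProj p u) := by
  rw [ellProj, dif_pos (exists_isEllProj p hu)]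
  exact (exists_isEllProj p hu).choose_spec

theorem ellProj_mem (E : Polygon) (p : ℕ) (u : Pt → ℝ) : E.ellProj p u ∈ polySpace p := by
  rw [ellProj]
  split_ifs with h
  · exact h.choose_spec.1
  · exact (polySpace p).zero_mem

theorem ellProj_eq (hu : E.EllAdmissible u) (hq : E.IsEllProj p u q) : E.ellProj p u = q := by
  have hm := ellProj_mem E p u
  have hd : E.ellProj p u - q ∈ polySpace p := (polySpace p).sub_mem hm hq.1
  obtain ⟨h1, h2⟩ := (isEllProj_iff hu hm).1 (ellProj_spec p hu)
  obtain ⟨h3, h4⟩ := (isEllProj_iff hu hq.1).1 hq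
  refine sub_eq_zero.1 (eq_zero_of_ell (E := E) hd ?_ ?_)
  · have e : ∀ x, gradient (E.ellProj p u - q) x = gradient (E.ellProj p u) x - gradient q x :=
      fun x => by
        have h6 := gradient_const_mul (-1) (differentiable_of_mem_polySpace hq.1 x)
        have h5 := gradient_add (differentiable_of_mem_polySpace hm x)
          ((differentiable_of_mem_polySpace hq.1 x).const_mul (-1))
        rw [h6] at h5
        rw [show E.ellProj p u - q = fun y => E.ellProj p u y + -1 * q y by
          ext y; simp [sub_eq_add_neg], h5]
        module
    have h5 := (h1 _ hd).symm.trans (h3 _ hd)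
    have h7 : ∀ x, inner ℝ (gradient (E.ellProj p u - q) x) (gradient (E.ellProj p u - q) x) =
        inner ℝ (gradient (E.ellProj p u) x) (gradient (E.ellProj p u - q) x) -
        inner ℝ (gradient q x) (gradient (E.ellProj p u - q) x) := fun x => by
      rw [← inner_sub_left, ← e]
    simp only [h7]
    rw [integral_sub (integrable_gradient_gradient hm hd)
      (integrable_gradient_gradient hq.1 hd), h5, sub_self]
  · have := boundaryIntegral_sub (E := E)
      (edgeIntegrable_of_continuous (continuous_of_mem_polySpace hm))
      (edgeIntegrable_of_continuous (continuous_of_mem_polySpace hq.1))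
    rw [h2, h4, sub_self] at this
    exact this

theorem ellProj_add (p : ℕ) (hu : E.EllAdmissible u) (hv : E.EllAdmissible v) :
    E.ellProj p (fun x => u x + v x) = fun x => E.ellProj p u x + E.ellProj p v x := by
  have hmu := ellProj_mem E p u
  have hmv := ellProj_mem E p v
  have hm := (polySpace p).add_mem hmu hmv
  obtain ⟨h1, h2⟩ := (isEllProj_iff hu hmu).1 (ellProj_spec p hu)
  obtain ⟨h3, h4⟩ := (isEllProj_iff hv hmv).1 (ellProj_spec p hv)
  refine ellProj_eq (hu.add hv) ((isEllProj_iff (hu.add hv) hm).2 ⟨fun r hr => ?_, ?_⟩)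
  · have e1 : ∀ᵐ x ∂(volume.restrict E.carrier),
        inner ℝ (weakGrad E.carrier (fun x => u x + v x) x) (gradient r x) =
        inner ℝ (weakGrad E.carrier u x) (gradient r x) +
        inner ℝ (weakGrad E.carrier v x) (gradient r x) :=
      (weakGrad_add E.isOpen hu.1 hv.1).mono fun x hx => by rw [hx, inner_add_left]
    have e2 : ∀ x, inner ℝ (gradient (E.ellProj p u + E.ellProj p v) x) (gradient r x) =
        inner ℝ (gradient (E.ellProj p u) x) (gradient r x) +
        inner ℝ (gradient (E.ellProj p v) x) (gradient r x) := fun x => by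
      rw [← inner_add_left, ← gradient_add (differentiable_of_mem_polySpace hmu x)
        (differentiable_of_mem_polySpace hmv x)]
      rfl
    rw [integral_congr_ae e1]
    simp only [e2]
    rw [integral_add (integrable_inner_gradient hu.1 hr) (integrable_inner_gradient hv.1 hr),
      integral_add (integrable_gradient_gradient hmu hr) (integrable_gradient_gradient hmv hr),
      h1 r hr, h3 r hr]
  · rw [boundaryIntegral_add hu.2 hv.2, ← h2, ← h4]
    exact boundaryIntegral_add (edgeIntegrable_of_continuous (continuous_of_mem_polySpace hmu))
      (edgeIntegrable_of_continuous (continuous_of_mem_polySpace hmv))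

theorem ellProj_const_mul (p : ℕ) (c : ℝ) (hu : E.EllAdmissible u) :
    E.ellProj p (fun x => c * u x) = fun x => c * E.ellProj p u x := by
  have hmu := ellProj_mem E p u
  have hm := (polySpace p).smul_mem c hmu
  obtain ⟨h1, h2⟩ := (isEllProj_iff hu hmu).1 (ellProj_spec p hu)
  refine ellProj_eq (hu.const_mul c) ((isEllProj_iff (hu.const_mul c) hm).2 ⟨fun r hr => ?_, ?_⟩)
  · have e1 : ∀ᵐ x ∂(volume.restrict E.carrier),
        inner ℝ (weakGrad E.carrier (fun x => c * u x) x) (gradient r x) =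
        c * inner ℝ (weakGrad E.carrier u x) (gradient r x) :=
      (weakGrad_const_mul E.isOpen c hu.1).mono fun x hx => by
        rw [hx, inner_smul_left, conj_trivial]
    have e2 : ∀ x, inner ℝ (gradient (c • E.ellProj p u) x) (gradient r x) =
        c * inner ℝ (gradient (E.ellProj p u) x) (gradient r x) := fun x => by
      have := gradient_const_mul c (differentiable_of_mem_polySpace hmu x)
      rw [show c • E.ellProj p u = fun y => c * E.ellProj p u y from rfl, this, inner_smul_left,
        conj_trivial]
    rw [integral_congr_ae e1]
    simp only [e2]
    rw [integral_const_mul, integral_const_mul, h1 r hr]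
  · rw [boundaryIntegral_const_mul, ← h2]
    exact boundaryIntegral_const_mul c _

theorem ellAdmissible_restr (hq : q ∈ polySpace k) : E.EllAdmissible (E.restr q) :=
  ⟨(hasWeakGrad_restr hq).memH1, (edgeIntegrable_of_continuous
    (continuous_of_mem_polySpace hq)).congr fun _ hx => (restr_of_mem_frontier hx).symm⟩

/-- The elliptic projection reproduces polynomials. -/
theorem ellProj_restr (hq : q ∈ polySpace p) : E.ellProj p (E.restr q) = q := by
  refine ellProj_eq (ellAdmissible_restr hq)
    ((isEllProj_iff (ellAdmissible_restr hq) hq).2 ⟨fun r _ => integral_congr_ae ?_,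
      boundaryIntegral_congr fun x hx => (restr_of_mem_frontier hx).symm⟩)
  exact ((hasWeakGrad_restr hq).weakGrad_ae_eq E.isOpen).mono fun x hx => by simp only [hx]

theorem ellProj_eq_zero (hu : E.EllAdmissible u)
    (h1 : weakGrad E.carrier u =ᵐ[volume.restrict E.carrier] 0)
    (h2 : ∀ x ∈ frontier E.carrier, u x = 0) : E.ellProj p u = 0 := by
  refine ellProj_eq hu ((isEllProj_iff hu (polySpace p).zero_mem).2 ⟨fun r _ => ?_, ?_⟩)
  · refine integral_congr_ae (h1.mono fun x hx => ?_)
    simp [hx, gradient]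
  · rw [boundaryIntegral_congr h2]
    rfl

end Polygon

end VEM

namespace VEM

/-! ### Continuous traces -/

theorem HasContinuousTrace.add {U : Set Pt} {u v : Pt → ℝ} (hU : IsOpen U)
    (hu : HasContinuousTrace U u) (hv : HasContinuousTrace U v) :
    HasContinuousTrace U (fun x => u x + v x) := by
  obtain ⟨c1, G1, h1, h2, h3, h4⟩ := hu
  obtain ⟨c2, G2, k1, k2, k3, k4⟩ := hv
  refine ⟨c1.add c2, fun x => G1 x + G2 x, h1.add k1, h2.add k2, fun x hx => ?_, ?_⟩
  · simp only [h3 hx, k3 hx]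
  · have := h4.add hU k4
    simpa only [add_sub_add_comm] using this

theorem HasContinuousTrace.const_mul {U : Set Pt} {u : Pt → ℝ} (hU : IsOpen U) (c : ℝ)
    (hu : HasContinuousTrace U u) : HasContinuousTrace U (fun x => c * u x) := by
  obtain ⟨c1, G1, h1, h2, h3, h4⟩ := hu
  refine ⟨continuousOn_const.mul c1, fun x => c * G1 x, continuousOn_const.mul h1,
    h2.const_mul c, fun x hx => ?_, ?_⟩
  · simp only [h3 hx]
  · have := h4.const_mul hU c
    simpa only [mul_sub] using this

namespace Polygon

variable {E : Polygon} {p : ℕ} {k : ℤ} {C : Submodule ℝ (Pt → ℝ)} {u v q r : Pt → ℝ}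

/-! ### The local virtual element space is a vector space containing the polynomials -/

theorem MemW.memH1 (hv : E.MemW p v) : MemH1 E.carrier v := hv.2.1

theorem MemW.memLp (hv : E.MemW p v) : MemLp v 2 (volume.restrict E.carrier) := hv.memH1.memLp

theorem MemW.ellAdmissible (hv : E.MemW p v) : E.EllAdmissible v := by
  refine ⟨hv.memH1, fun i => ?_⟩
  obtain ⟨r, -, hr⟩ := hv.2.2.2.1 i
  refine (r.continuous.intervalIntegrable 0 1).congr fun s hs => ?_
  rw [uIoc_of_le zero_le_one] at hs
  exact (hr s (Ioc_subset_Icc_self hs)).symm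

theorem integrable_inner_test {φ : Pt → ℝ} (hv : MemH1 E.carrier v) (hφ : IsTest E.carrier φ) :
    Integrable (fun x => inner ℝ (weakGrad E.carrier v x) (gradient φ x))
      (volume.restrict E.carrier) :=
  integrable_inner_of_memLp hv.memLp_weakGrad (hφ.memLp_gradient 2 _)

theorem integrable_poly_test {φ : Pt → ℝ} (hq : q ∈ polySpace k) (hφ : IsTest E.carrier φ) :
    Integrable (fun x => q x * φ x) (volume.restrict E.carrier) :=
  integrable_mul_of_memLp (memLp_of_mem_polySpace hq E.isBounded 2) (hφ.memLp 2 _)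

theorem MemW.add (hu : E.MemW p u) (hv : E.MemW p v) : E.MemW p (fun x => u x + v x) := by
  obtain ⟨h1, h2, h3, h4, q, hq, h5⟩ := hu
  obtain ⟨k1, k2, k3, k4, q', hq', k5⟩ := hv
  refine ⟨fun x hx => by simp only [h1 x hx, k1 x hx, add_zero], h2.add k2, h3.add E.isOpen k3,
    fun i => ?_, q + q', (polySpace p).add_mem hq hq', fun φ hφ => ?_⟩
  · obtain ⟨r, hr, hr'⟩ := h4 i
    obtain ⟨r', hr1, hr2⟩ := k4 i
    exact ⟨r + r', Polynomial.natDegree_add_le_of_degree_le hr hr1, fun s hs => by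
      simp only [hr' s hs, hr2 s hs, Polynomial.eval_add]⟩
  · have e : ∀ᵐ x ∂(volume.restrict E.carrier),
        inner ℝ (weakGrad E.carrier (fun x => u x + v x) x) (gradient φ x) =
        inner ℝ (weakGrad E.carrier u x) (gradient φ x) +
        inner ℝ (weakGrad E.carrier v x) (gradient φ x) :=
      (weakGrad_add E.isOpen h2 k2).mono fun x hx => by rw [hx, inner_add_left]
    rw [integral_congr_ae e, integral_add (integrable_inner_test h2 hφ)
      (integrable_inner_test k2 hφ), h5 φ hφ, k5 φ hφ]
    simp only [Pi.add_apply, add_mul]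
    rw [integral_add (integrable_poly_test hq hφ) (integrable_poly_test hq' hφ), neg_add]

theorem MemW.const_mul (c : ℝ) (hu : E.MemW p u) : E.MemW p (fun x => c * u x) := by
  obtain ⟨h1, h2, h3, h4, q, hq, h5⟩ := hu
  refine ⟨fun x hx => by simp only [h1 x hx, mul_zero], h2.const_mul c, h3.const_mul E.isOpen c,
    fun i => ?_, c • q, (polySpace p).smul_mem c hq, fun φ hφ => ?_⟩
  · obtain ⟨r, hr, hr'⟩ := h4 i
    exact ⟨c • r, (Polynomial.natDegree_smul_le c r).trans hr, fun s hs => by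
      simp only [hr' s hs, Polynomial.eval_smul, smul_eq_mul]⟩
  · have e : ∀ᵐ x ∂(volume.restrict E.carrier),
        inner ℝ (weakGrad E.carrier (fun x => c * u x) x) (gradient φ x) =
        c * inner ℝ (weakGrad E.carrier u x) (gradient φ x) :=
      (weakGrad_const_mul E.isOpen c h2).mono fun x hx => by
        rw [hx, inner_smul_left, conj_trivial]
    rw [integral_congr_ae e, integral_const_mul, h5 φ hφ]
    simp only [Pi.smul_apply, smul_eq_mul, mul_assoc]
    rw [integral_const_mul, mul_neg]

theorem memW_restr (hq : q ∈ polySpace p) : E.MemW p (E.restr q) := by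
  have hc : ContinuousOn (E.restr q) (closure E.carrier) :=
    (continuous_of_mem_polySpace hq).continuousOn.congr fun x hx => restr_of_mem_closure hx
  refine ⟨fun x hx => restr_of_notMem hx, (hasWeakGrad_restr hq).memH1,
    ⟨hc.mono frontier_subset_closure, E.restr q, hc, (hasWeakGrad_restr hq).memH1,
      fun _ _ => rfl, ?_⟩, fun i => ?_, ?_⟩
  · simpa only [sub_self] using memH10_zero E.isOpen
  · obtain ⟨r, hr, hr'⟩ := exists_polynomial_lineMap hq (E.vert i) (E.next i)
    exact ⟨r, hr, fun s hs => by
      rw [restr_of_mem_frontier (E.lineMap_mem_frontier i hs), hr']⟩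
  · obtain ⟨l, hl, hl'⟩ := exists_laplacian_of_mem_polySpace hq E.carrier
    refine ⟨l, hl, fun φ hφ => ?_⟩
    rw [← hl' φ hφ]
    exact integral_congr_ae (((hasWeakGrad_restr hq).weakGrad_ae_eq E.isOpen).mono
      fun x hx => by simp only [hx])

theorem integrable_sub_ellProj_mul (hv : E.MemW p v) (hq : q ∈ polySpace p) :
    Integrable (fun x => (v x - E.ellProj p v x) * q x) (volume.restrict E.carrier) :=
  integrable_mul_poly (hv.memLp.sub (memLp_of_mem_polySpace (ellProj_mem E p v) E.isBounded 2)) hq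

theorem MemV.add (hC : C ≤ polySpace p) (hu : E.MemV p C u) (hv : E.MemV p C v) :
    E.MemV p C (fun x => u x + v x) := by
  refine ⟨hu.1.add hv.1, fun q hq => ?_⟩
  rw [ellProj_add p hu.1.ellAdmissible hv.1.ellAdmissible]
  have e : ∀ x, (u x + v x - (E.ellProj p u x + E.ellProj p v x)) * q x =
      (u x - E.ellProj p u x) * q x + (v x - E.ellProj p v x) * q x := fun x => by ring
  simp only [e]
  rw [integral_add (integrable_sub_ellProj_mul hu.1 (hC hq))
    (integrable_sub_ellProj_mul hv.1 (hC hq)), hu.2 q hq, hv.2 q hq, add_zero]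

theorem MemV.const_mul (c : ℝ) (hu : E.MemV p C u) : E.MemV p C (fun x => c * u x) := by
  refine ⟨hu.1.const_mul c, fun q hq => ?_⟩
  rw [ellProj_const_mul p c hu.1.ellAdmissible]
  have e : ∀ x, (c * u x - c * E.ellProj p u x) * q x =
      c * ((u x - E.ellProj p u x) * q x) := fun x => by ring
  simp only [e]
  rw [integral_const_mul, hu.2 q hq, mul_zero]

theorem memV_restr (hq : q ∈ polySpace p) : E.MemV p C (E.restr q) := by
  refine ⟨memW_restr hq, fun r _ => ?_⟩
  rw [ellProj_restr hq]
  refine integral_eq_zero_of_ae ((restr_ae_eq q).mono fun x hx => ?_)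
  simp [hx]

theorem MemV.sub (hC : C ≤ polySpace p) (hu : E.MemV p C u) (hv : E.MemV p C v) :
    E.MemV p C (fun x => u x - v x) := by
  have := hu.add hC (hv.const_mul (-1))
  simpa only [neg_mul, one_mul, ← sub_eq_add_neg] using this

/-! ### Unisolvence -/

/-- The degrees of freedom of a virtual element function: if `v ∈ W_E^p` vanishes at `p + 1` points
of every edge and is orthogonal to `ℙ_p`, then it vanishes. Indeed `v` vanishes on `∂E`, hence
`v ∈ H¹₀(E)` and `∫_E |∇v|² = - ∫_E v Δv = 0`. -/
theorem MemW.eq_zero (hp : 1 ≤ p) (hv : E.MemW p v)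
    (h0 : ∀ i, ∀ j : Fin (p + 1),
      v (AffineMap.lineMap (E.vert i) (E.next i) ((j : ℝ) / p)) = 0)
    (hP : E.l2Proj p v = 0) :
    (∀ x ∈ frontier E.carrier, v x = 0) ∧ v =ᵐ[volume.restrict E.carrier] 0 ∧
      weakGrad E.carrier v =ᵐ[volume.restrict E.carrier] 0 := by
  have hp0 : (0 : ℝ) < p := by exact_mod_cast hp
  have hfr : ∀ x ∈ frontier E.carrier, v x = 0 := by
    intro x hx
    obtain ⟨i, s, hs, rfl⟩ := E.exists_lineMap_of_mem_frontier hx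
    obtain ⟨r, hr, hr'⟩ := hv.2.2.2.1 i
    have hr0 : r = 0 := by
      refine Polynomial.eq_zero_of_natDegree_lt_card_of_eval_eq_zero r
        (f := fun j : Fin (p + 1) => (j : ℝ) / p) (fun j j' h => ?_) (fun j => ?_) (by simp; omega)
      · have h2 : (j : ℝ) = j' := (div_left_inj' hp0.ne').1 h
        exact Fin.ext (by exact_mod_cast h2)
      · rw [← hr' _ ⟨by positivity, ?_⟩, h0 i j]
        rw [div_le_one hp0]
        exact_mod_cast Nat.lt_succ_iff.1 j.2
    rw [hr' s hs, hr0, Polynomial.eval_zero]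
  obtain ⟨-, hH1, ⟨-, G, hGc, hG1, hGv, hvG⟩, -, q, hq, hlap⟩ := hv
  have hGapp : TestApprox E.carrier G (weakGrad E.carrier G) :=
    hG1.hasWeakGrad.testApprox_of_zero_on_frontier E.isOpen E.isBounded hGc
      fun x hx => by rw [hGv hx, hfr x hx]
  have happ : TestApprox E.carrier v (weakGrad E.carrier v) := by
    have h1 := TestApprox.add hvG.1.memLp hvG.1.memLp_weakGrad hG1.memLp hG1.memLp_weakGrad
      hvG.testApprox hGapp
    have h2 := weakGrad_add E.isOpen hvG.1 hG1
    simp only [sub_add_cancel] at h1 h2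
    exact h1.congr h2.symm
  obtain ⟨φ, hφ, h1, h2⟩ := happ.exists_seq
  have hL := hH1.memLp
  have hgL := hH1.memLp_weakGrad
  have hqL := memLp_of_mem_polySpace hq E.isBounded 2
  have l1 := tendsto_integral_bilin (fun x y : Pt => (inner ℝ x y : ℝ))
    (fun x y => norm_inner_le_norm x y) (fun x x' y => inner_sub_left x x' y) hgL hgL
    (fun k => (hφ k).memLp_gradient 2 _) (hgL.1.inner hgL.1)
    (fun k => ((hφ k).memLp_gradient 2 _).1.inner hgL.1) h2
  have l2 := tendsto_integral_bilin (fun x y : ℝ => x * y)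
    (fun x y => (norm_mul x y).le) (fun x x' y => sub_mul x x' y) hL hqL
    (fun k => (hφ k).memLp 2 _) (hL.1.mul hqL.1) (fun k => ((hφ k).memLp 2 _).1.mul hqL.1) h1
  have h3 : ∫ x in E.carrier, v x * q x = 0 := by
    rw [(isL2Proj_iff hL (l2Proj_mem E p v)).1 (l2Proj_spec p hL) q hq, hP]
    simp
  have h4 : ∫ x in E.carrier, inner ℝ (weakGrad E.carrier v x) (weakGrad E.carrier v x) = 0 := by
    rw [h3] at l2
    have l3 := l2.neg
    rw [neg_zero] at l3
    refine tendsto_nhds_unique l1 (l3.congr fun k => ?_)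
    simp only [real_inner_comm _ (gradient (φ k) _), mul_comm (φ k _)]
    exact (hlap (φ k) (hφ k)).symm
  have h5 : weakGrad E.carrier v =ᵐ[volume.restrict E.carrier] 0 := by
    have := (integral_eq_zero_iff_of_nonneg (fun x => real_inner_self_nonneg)
      (integrable_inner_of_memLp hgL hgL)).1 h4
    exact this.mono fun x hx => inner_self_eq_zero.1 hx
  exact ⟨hfr, happ.ae_eq_zero E.isBounded hL h5, h5⟩

/-! ### Stability of the `L²` projection in the maximum norm -/

theorem diam_pos (E : Polygon) : 0 < E.diam := by
  obtain ⟨z, hz⟩ := E.nonempty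
  exact Metric.diam_pos (infinite_of_mem_nhds z (E.isOpen.mem_nhds hz)).nontrivial E.isBounded

/-- On shape regular polygons the `L²` projection is bounded in `L^∞`. -/
theorem exists_abs_l2Proj_le (k : ℤ) {δ : ℝ} (hδ : 0 < δ) :
    ∃ K : ℝ, 0 < K ∧ ∀ (E : Polygon) (c : ℝ), E.ShapeRegular δ c → ∀ (u : Pt → ℝ) (M : ℝ),
      0 ≤ M → AEStronglyMeasurable u (volume.restrict E.carrier) →
      (∀ᵐ x ∂(volume.restrict E.carrier), |u x| ≤ M) →
      ∀ x ∈ E.carrier, |E.l2Proj k u x| ≤ K * M := by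
  obtain ⟨K, hK, hKq⟩ := exists_inverse_inequality k hδ
  set A := volume.real (Metric.closedBall (0 : Pt) 1)
  refine ⟨√(K * A) + 1, by positivity, fun E c hE u M hM hum huM x hx => ?_⟩
  obtain ⟨⟨z, hz, -⟩, -⟩ := hE
  have hd := E.diam_pos
  have hfin : IsFiniteMeasure (volume.restrict E.carrier) :=
    isFiniteMeasure_restrict.2 E.isBounded.measure_lt_top.ne
  have huL : MemLp u 2 (volume.restrict E.carrier) := MemLp.of_bound hum M huM
  have hzE : z ∈ E.carrier := hz (Metric.mem_ball_self (mul_pos hδ hd))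
  have hsub : E.carrier ⊆ Metric.closedBall z E.diam := fun y hy =>
    Metric.dist_le_diam_of_mem E.isBounded hy hzE
  have hm := l2Proj_mem E k u
  have h1 := hKq z E.diam hd _ hm x (hsub hx)
  have hi : Integrable (fun x => E.l2Proj k u x ^ 2) (volume.restrict E.carrier) :=
    (memLp_of_mem_polySpace hm E.isBounded 2).integrable_sq
  have h2 : ∫ y in Metric.ball z (δ * E.diam), E.l2Proj k u y ^ 2 ≤
      ∫ y in E.carrier, E.l2Proj k u y ^ 2 :=
    setIntegral_mono_set hi (Eventually.of_forall fun x => sq_nonneg _)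
      (LE.le.eventuallyLE hz)
  have h3 := integral_l2Proj_sq_le k huL
  have h4 : ∫ y in E.carrier, u y ^ 2 ≤ M ^ 2 * (E.diam ^ 2 * A) := by
    have h5 : ∫ y in E.carrier, u y ^ 2 ≤ ∫ y in E.carrier, M ^ 2 := by
      refine integral_mono_ae huL.integrable_sq (integrable_const _) (huM.mono fun x hx => ?_)
      exact sq_le_sq' (by linarith [neg_abs_le (u x)]) ((le_abs_self _).trans hx)
    refine h5.trans ?_
    rw [setIntegral_const, smul_eq_mul, mul_comm]
    refine mul_le_mul_of_nonneg_left ?_ (sq_nonneg M)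
    refine (measureReal_mono hsub measure_closedBall_lt_top.ne).trans (le_of_eq ?_)
    rw [Measure.real, Measure.addHaar_closedBall' _ _ hd.le, finrank_euclideanSpace_fin,
      ENNReal.toReal_mul, ENNReal.toReal_ofReal (by positivity)]
    rfl
  have h6 : E.l2Proj k u x ^ 2 ≤ K * A * M ^ 2 := by
    have h7 : E.l2Proj k u x ^ 2 * E.diam ^ 2 ≤ K * A * M ^ 2 * E.diam ^ 2 := by
      calc _ ≤ K * (M ^ 2 * (E.diam ^ 2 * A)) :=
            h1.trans (mul_le_mul_of_nonneg_left (h2.trans (h3.trans h4)) hK.le)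
        _ = _ := by ring
    exact le_of_mul_le_mul_right h7 (by positivity)
  calc |E.l2Proj k u x| = √(E.l2Proj k u x ^ 2) := (Real.sqrt_sq_eq_abs _).symm
    _ ≤ √(K * A * M ^ 2) := Real.sqrt_le_sqrt h6
    _ = √(K * A) * M := by rw [Real.sqrt_mul' _ (sq_nonneg M), Real.sqrt_sq hM]
    _ ≤ _ := by gcongr; linarith

end Polygon

end VEM

namespace VEM

/-! ### Semidefinite, bilinear and linear forms -/

/-- For a form that is symmetric and positive semidefinite on the span of `a` and `b`, a null vector
`b` lies in the radical. -/
theorem bilin_eq_zero_of_null {X : Type*} [AddCommGroup X] [Module ℝ X]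
    (S : LinearMap.BilinForm ℝ X) {a b : X} (hpos : ∀ t : ℝ, 0 ≤ S (a + t • b) (a + t • b))
    (hsymm : S a b = S b a) (hb : S b b ≤ 0) : S a b = 0 ∧ S b a = 0 := by
  have key : ∀ t : ℝ, 0 ≤ S a a + 2 * t * S a b := fun t => by
    have h := hpos t
    simp only [map_add, map_smul, LinearMap.add_apply, LinearMap.smul_apply, smul_eq_mul,
      ← hsymm] at h
    nlinarith [mul_nonpos_of_nonneg_of_nonpos (mul_self_nonneg t) hb]
  have h0 : S a b = 0 := by
    by_contra hne
    have h := key (-(S a a + 1) / (2 * S a b))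
    have e : 2 * (-(S a a + 1) / (2 * S a b)) * S a b = -(S a a + 1) := by field_simp
    rw [e] at h
    linarith
  exact ⟨h0, hsymm ▸ h0⟩

/-- `f` is bilinear on the subspace `S`. -/
structure BilinOn (S : Submodule ℝ (Pt → ℝ)) (f : (Pt → ℝ) → (Pt → ℝ) → ℝ) : Prop where
  add_left : ∀ u ∈ S, ∀ u' ∈ S, ∀ v ∈ S, f (u + u') v = f u v + f u' v
  smul_left : ∀ c : ℝ, ∀ u ∈ S, ∀ v ∈ S, f (c • u) v = c * f u v
  add_right : ∀ u ∈ S, ∀ v ∈ S, ∀ v' ∈ S, f u (v + v') = f u v + f u v'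
  smul_right : ∀ c : ℝ, ∀ u ∈ S, ∀ v ∈ S, f u (c • v) = c * f u v

namespace BilinOn

variable {S : Submodule ℝ (Pt → ℝ)} {f g : (Pt → ℝ) → (Pt → ℝ) → ℝ}

theorem add (hf : BilinOn S f) (hg : BilinOn S g) : BilinOn S fun u v => f u v + g u v where
  add_left u hu u' hu' v hv := by
    rw [hf.add_left u hu u' hu' v hv, hg.add_left u hu u' hu' v hv]; ring
  smul_left c u hu v hv := by rw [hf.smul_left c u hu v hv, hg.smul_left c u hu v hv]; ring
  add_right u hu v hv v' hv' := by
    rw [hf.add_right u hu v hv v' hv', hg.add_right u hu v hv v' hv']; ring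
  smul_right c u hu v hv := by rw [hf.smul_right c u hu v hv, hg.smul_right c u hu v hv]; ring

theorem const_mul (a : ℝ) (hf : BilinOn S f) : BilinOn S fun u v => a * f u v where
  add_left u hu u' hu' v hv := by rw [hf.add_left u hu u' hu' v hv]; ring
  smul_left c u hu v hv := by rw [hf.smul_left c u hu v hv]; ring
  add_right u hu v hv v' hv' := by rw [hf.add_right u hu v hv v' hv']; ring
  smul_right c u hu v hv := by rw [hf.smul_right c u hu v hv]; ring

theorem sum {ι : Type*} {s : Finset ι} {f : ι → (Pt → ℝ) → (Pt → ℝ) → ℝ}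
    (hf : ∀ i ∈ s, BilinOn S (f i)) : BilinOn S fun u v => ∑ i ∈ s, f i u v where
  add_left u hu u' hu' v hv := by
    rw [← Finset.sum_add_distrib]
    exact Finset.sum_congr rfl fun i hi => (hf i hi).add_left u hu u' hu' v hv
  smul_left c u hu v hv := by
    rw [Finset.mul_sum]
    exact Finset.sum_congr rfl fun i hi => (hf i hi).smul_left c u hu v hv
  add_right u hu v hv v' hv' := by
    rw [← Finset.sum_add_distrib]
    exact Finset.sum_congr rfl fun i hi => (hf i hi).add_right u hu v hv v' hv'
  smul_right c u hu v hv := by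
    rw [Finset.mul_sum]
    exact Finset.sum_congr rfl fun i hi => (hf i hi).smul_right c u hu v hv

theorem zero_right (hf : BilinOn S f) {u : Pt → ℝ} (hu : u ∈ S) : f u 0 = 0 := by
  simpa using hf.smul_right 0 u hu 0 S.zero_mem

end BilinOn

/-- `f` is linear on the subspace `S`. -/
structure LinOn (S : Submodule ℝ (Pt → ℝ)) (f : (Pt → ℝ) → ℝ) : Prop where
  add : ∀ v ∈ S, ∀ v' ∈ S, f (v + v') = f v + f v'
  smul : ∀ c : ℝ, ∀ v ∈ S, f (c • v) = c * f v

namespace LinOn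

variable {S : Submodule ℝ (Pt → ℝ)} {f g : (Pt → ℝ) → ℝ}

theorem add' (hf : LinOn S f) (hg : LinOn S g) : LinOn S fun v => f v + g v where
  add v hv v' hv' := by rw [hf.add v hv v' hv', hg.add v hv v' hv']; ring
  smul c v hv := by rw [hf.smul c v hv, hg.smul c v hv]; ring

theorem const_mul (a : ℝ) (hf : LinOn S f) : LinOn S fun v => a * f v where
  add v hv v' hv' := by rw [hf.add v hv v' hv']; ring
  smul c v hv := by rw [hf.smul c v hv]; ring

theorem sum {ι : Type*} {s : Finset ι} {f : ι → (Pt → ℝ) → ℝ}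
    (hf : ∀ i ∈ s, LinOn S (f i)) : LinOn S fun v => ∑ i ∈ s, f i v where
  add v hv v' hv' := by
    rw [← Finset.sum_add_distrib]
    exact Finset.sum_congr rfl fun i hi => (hf i hi).add v hv v' hv'
  smul c v hv := by
    rw [Finset.mul_sum]
    exact Finset.sum_congr rfl fun i hi => (hf i hi).smul c v hv

end LinOn

theorem BilinOn.linOn {S : Submodule ℝ (Pt → ℝ)} {f : (Pt → ℝ) → (Pt → ℝ) → ℝ}
    (hf : BilinOn S f) {u : Pt → ℝ} (hu : u ∈ S) : LinOn S (f u) where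
  add v hv v' hv' := hf.add_right u hu v hv v' hv'
  smul c v hv := hf.smul_right c u hu v hv

theorem BilinOn.congr {S : Submodule ℝ (Pt → ℝ)} {f g : (Pt → ℝ) → (Pt → ℝ) → ℝ}
    (hf : BilinOn S f) (h : ∀ u v, f u v = g u v) : BilinOn S g :=
  (funext fun u => funext fun v => h u v : f = g) ▸ hf

theorem LinOn.mul {S : Submodule ℝ (Pt → ℝ)} {f g : (Pt → ℝ) → ℝ}
    (hf : LinOn S f) (hg : LinOn S g) : BilinOn S fun u v => f u * g v where
  add_left u hu u' hu' v _ := by rw [hf.add u hu u' hu']; ring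
  smul_left c u hu v _ := by rw [hf.smul c u hu]; ring
  add_right u _ v hv v' hv' := by rw [hg.add v hv v' hv']; ring
  smul_right c u _ v hv := by rw [hg.smul c v hv]; ring

theorem BilinOn.integral {S : Submodule ℝ (Pt → ℝ)} {ν : Measure Pt}
    {F : Pt → (Pt → ℝ) → (Pt → ℝ) → ℝ} (hF : ∀ x, BilinOn S (F x))
    (hi : ∀ u ∈ S, ∀ v ∈ S, Integrable (fun x => F x u v) ν) :
    BilinOn S fun u v => ∫ x, F x u v ∂ν where
  add_left u hu u' hu' v hv := by
    rw [← integral_add (hi u hu v hv) (hi u' hu' v hv)]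
    exact integral_congr_ae (.of_forall fun x => (hF x).add_left u hu u' hu' v hv)
  smul_left c u hu v hv := by
    rw [← integral_const_mul]
    exact integral_congr_ae (.of_forall fun x => (hF x).smul_left c u hu v hv)
  add_right u hu v hv v' hv' := by
    rw [← integral_add (hi u hu v hv) (hi u hu v' hv')]
    exact integral_congr_ae (.of_forall fun x => (hF x).add_right u hu v hv v' hv')
  smul_right c u hu v hv := by
    rw [← integral_const_mul]
    exact integral_congr_ae (.of_forall fun x => (hF x).smul_right c u hu v hv)

theorem LinOn.integral {S : Submodule ℝ (Pt → ℝ)} {ν : Measure Pt}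
    {F : Pt → (Pt → ℝ) → ℝ} (hF : ∀ x, LinOn S (F x))
    (hi : ∀ v ∈ S, Integrable (fun x => F x v) ν) : LinOn S fun v => ∫ x, F x v ∂ν where
  add v hv v' hv' := by
    rw [← integral_add (hi v hv) (hi v' hv')]
    exact integral_congr_ae (.of_forall fun x => (hF x).add v hv v' hv')
  smul c v hv := by
    rw [← integral_const_mul]
    exact integral_congr_ae (.of_forall fun x => (hF x).smul c v hv)

/-! ### Weights -/

/-- Products of `a` with continuous functions are integrable on the polygon `E`. -/
def Polygon.IsWeight (E : Polygon) (a : Pt → ℝ) : Prop :=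
  ∀ g : Pt → ℝ, Continuous g → Integrable (fun x => a x * g x) (volume.restrict E.carrier)

namespace Polygon

variable {E : Polygon} {a : Pt → ℝ}

theorem isWeight_of_memLp (ha : MemLp a 2 (volume.restrict E.carrier)) : E.IsWeight a :=
  fun _ hg => integrable_mul_of_memLp ha (memLp_of_continuous_of_isBounded hg E.isBounded 2)

instance isFiniteMeasure_restrict_carrier (E : Polygon) :
    IsFiniteMeasure (volume.restrict E.carrier) :=
  isFiniteMeasure_restrict.2 E.isBounded.measure_lt_top.ne

theorem isWeight_of_bound {B : ℝ} (ha : AEStronglyMeasurable a (volume.restrict E.carrier))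
    (hB : ∀ᵐ x ∂(volume.restrict E.carrier), |a x| ≤ B) : E.IsWeight a :=
  isWeight_of_memLp (MemLp.of_bound ha B hB)

theorem IsWeight.mul_continuous (ha : E.IsWeight a) {h : Pt → ℝ} (hh : Continuous h) :
    E.IsWeight fun x => a x * h x := fun g hg => by
  simp only [mul_assoc]
  exact ha (fun x => h x * g x) (hh.mul hg)

theorem isWeight_sum {ι : Type*} {s : Finset ι} {a : ι → Pt → ℝ}
    (ha : ∀ i ∈ s, E.IsWeight (a i)) : E.IsWeight fun x => ∑ i ∈ s, a i x := fun g hg => by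
  simp only [Finset.sum_mul]
  exact integrable_finsetSum _ fun i hi => ha i hi g hg

end Polygon

/-! ### The global space and the discrete forms -/

namespace Discretization

variable {Ω : Set Pt} {p m : ℕ} {D : Discretization Ω p} {u v : Pt → ℝ}

theorem compl_le (D : Discretization Ω p) (e : Fin D.card) : D.compl e ≤ polySpace p :=
  le_sup_left.trans_eq (D.compl_sup e)

/-- `V_h^p` as a vector space. -/
def Vh (D : Discretization Ω p) (hΩ : IsOpen Ω) : Submodule ℝ (Pt → ℝ) where
  carrier := {u | D.MemVh u}
  add_mem' := fun {u v} hu hv => ⟨hu.1.add hΩ hv.1, fun e => by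
    have := (hu.2 e).add (D.compl_le e) (hv.2 e)
    rw [← Polygon.restr_add] at this
    exact this⟩
  zero_mem' := ⟨memH10_zero hΩ, fun _ => Polygon.memV_restr (polySpace p).zero_mem⟩
  smul_mem' := fun c u hu => ⟨hu.1.const_mul hΩ c, fun e => by
    have := (hu.2 e).const_mul c
    rw [← Polygon.restr_const_mul] at this
    exact this⟩

theorem MemVh.memLp_restr (hu : D.MemVh u) (e : Fin D.card) :
    MemLp ((D.elem e).restr u) 2 (volume.restrict (D.elem e).carrier) := (hu.2 e).1.memLp

theorem P_add (hu : D.MemVh u) (hv : D.MemVh v) (e : Fin D.card) :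
    D.P e (u + v) = D.P e u + D.P e v := by
  have := (D.elem e).l2Proj_add p (hu.memLp_restr e) (hv.memLp_restr e)
  rw [← Polygon.restr_add] at this
  exact this

theorem P_smul (c : ℝ) (hu : D.MemVh u) (e : Fin D.card) : D.P e (c • u) = c • D.P e u := by
  have := (D.elem e).l2Proj_const_mul p c (hu.memLp_restr e)
  rw [← Polygon.restr_const_mul] at this
  exact this

theorem continuous_P (D : Discretization Ω p) (e : Fin D.card) (u : Pt → ℝ) :
    Continuous (D.P e u) := continuous_of_mem_polySpace (Polygon.l2Proj_mem _ _ _)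

theorem linOn_P (D : Discretization Ω p) (hΩ : IsOpen Ω) (e : Fin D.card) (x : Pt) :
    LinOn (D.Vh hΩ) fun u => D.P e u x where
  add u hu v hv := by rw [P_add hu hv]; rfl
  smul c u hu := by rw [P_smul c hu]; rfl

theorem PGrad_add (hu : D.MemVh u) (hv : D.MemVh v) (e : Fin D.card) (x : Pt) :
    D.PGrad e (u + v) x = D.PGrad e u x + D.PGrad e v x := by
  have := (D.elem e).gradProj_add ((p : ℤ) - 1) (hu.2 e).1.memH1 (hv.2 e).1.memH1 x
  rw [← Polygon.restr_add] at this
  exact this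

theorem PGrad_smul (c : ℝ) (hu : D.MemVh u) (e : Fin D.card) (x : Pt) :
    D.PGrad e (c • u) x = c • D.PGrad e u x := by
  have := (D.elem e).gradProj_const_mul ((p : ℤ) - 1) c (hu.2 e).1.memH1 x
  rw [← Polygon.restr_const_mul] at this
  exact this

theorem continuous_PGrad (D : Discretization Ω p) (e : Fin D.card) (u : Pt → ℝ) :
    Continuous (D.PGrad e u) := Polygon.continuous_gradProj _ _ _

theorem linOn_inner_PGrad (D : Discretization Ω p) (hΩ : IsOpen Ω) (e : Fin D.card) (w x : Pt) :
    LinOn (D.Vh hΩ) fun u => inner ℝ w (D.PGrad e u x) where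
  add u hu v hv := by rw [PGrad_add hu hv, inner_add_right]
  smul c u hu := by rw [PGrad_smul c hu, real_inner_smul_right]

theorem bilinOn_inner_PGrad (D : Discretization Ω p) (hΩ : IsOpen Ω) (e : Fin D.card) (x : Pt) :
    BilinOn (D.Vh hΩ) fun u v => inner ℝ (D.PGrad e u x) (D.PGrad e v x) where
  add_left u hu u' hu' v _ := by rw [PGrad_add hu hu', inner_add_left]
  smul_left c u hu v _ := by rw [PGrad_smul c hu, real_inner_smul_left]
  add_right u _ v hv v' hv' := by rw [PGrad_add hv hv', inner_add_right]
  smul_right c u _ v hv := by rw [PGrad_smul c hv, real_inner_smul_right]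

theorem ImP_add (hu : D.MemVh u) (hv : D.MemVh v) (e : Fin D.card) :
    D.ImP e (u + v) = D.ImP e u + D.ImP e v := by
  have := (D.elem e).restr_add (fun x => u x - D.P e u x) (fun x => v x - D.P e v x)
  refine Eq.trans ?_ this
  unfold ImP
  rw [P_add hu hv]
  congr 1
  funext x
  simp only [Pi.add_apply]
  ring

theorem ImP_smul (c : ℝ) (hu : D.MemVh u) (e : Fin D.card) :
    D.ImP e (c • u) = c • D.ImP e u := by
  have := (D.elem e).restr_const_mul c (fun x => u x - D.P e u x)
  refine Eq.trans ?_ this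
  unfold ImP
  rw [P_smul c hu]
  congr 1
  funext x
  simp only [Pi.smul_apply, smul_eq_mul]
  ring

theorem ImEll_add (hu : D.MemVh u) (hv : D.MemVh v) (e : Fin D.card) :
    D.ImEll e (u + v) = D.ImEll e u + D.ImEll e v := by
  have h := (D.elem e).ellProj_add p (hu.2 e).1.ellAdmissible (hv.2 e).1.ellAdmissible
  rw [← Polygon.restr_add] at h
  refine Eq.trans ?_ ((D.elem e).restr_add
    (fun x => u x - (D.elem e).ellProj p ((D.elem e).restr u) x)
    (fun x => v x - (D.elem e).ellProj p ((D.elem e).restr v) x))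
  unfold ImEll
  congr 1
  funext x
  have hx : (D.elem e).ellProj p ((D.elem e).restr (u + v)) x = _ := congrFun h x
  rw [hx, Pi.add_apply]
  ring

theorem ImEll_smul (c : ℝ) (hu : D.MemVh u) (e : Fin D.card) :
    D.ImEll e (c • u) = c • D.ImEll e u := by
  have h := (D.elem e).ellProj_const_mul p c (hu.2 e).1.ellAdmissible
  rw [← Polygon.restr_const_mul] at h
  refine Eq.trans ?_ ((D.elem e).restr_const_mul c
    (fun x => u x - (D.elem e).ellProj p ((D.elem e).restr u) x))
  unfold ImEll
  congr 1
  funext x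
  have hx : (D.elem e).ellProj p ((D.elem e).restr (c • u)) x = _ := congrFun h x
  rw [hx, Pi.smul_apply, smul_eq_mul]
  ring

theorem memV_ImP (hu : D.MemVh u) (e : Fin D.card) :
    (D.elem e).MemV p (D.compl e) (D.ImP e u) := by
  have h := (hu.2 e).sub (D.compl_le e)
    (Polygon.memV_restr (C := D.compl e) (Polygon.l2Proj_mem (D.elem e) p ((D.elem e).restr u)))
  rw [← Polygon.restr_sub] at h
  exact h

theorem memV_ImEll (hu : D.MemVh u) (e : Fin D.card) :
    (D.elem e).MemV p (D.compl e) (D.ImEll e u) := by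
  have h := (hu.2 e).sub (D.compl_le e)
    (Polygon.memV_restr (C := D.compl e) (Polygon.ellProj_mem (D.elem e) p ((D.elem e).restr u)))
  rw [← Polygon.restr_sub] at h
  exact h

theorem l2Proj_ImP (hu : D.MemVh u) (e : Fin D.card) : (D.elem e).l2Proj p (D.ImP e u) = 0 := by
  set q := D.P e u with hq
  have hqm : q ∈ polySpace p := Polygon.l2Proj_mem _ _ _
  have hL : MemLp (fun x => (-1) * (D.elem e).restr q x) 2
      (volume.restrict (D.elem e).carrier) :=
    ((Polygon.memV_restr (C := ⊥) hqm).1.memLp).const_mul (-1)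
  have h := (D.elem e).l2Proj_add p (hu.memLp_restr e) hL
  have h1 := (D.elem e).l2Proj_const_mul p (-1)
    ((Polygon.memV_restr (E := D.elem e) (C := ⊥) hqm).1.memLp)
  have h2 : (D.elem e).l2Proj p ((D.elem e).restr q) = q :=
    Polygon.l2Proj_of_ae_eq hqm (Polygon.restr_ae_eq q)
  have h3 : D.ImP e u = fun x => (D.elem e).restr u x + (-1) * (D.elem e).restr q x := by
    unfold ImP
    rw [Polygon.restr_sub]
    funext x
    ring
  rw [h3, h, h1, h2]
  funext x
  change q x + -1 * q x = 0
  ring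

theorem ellProj_ImEll (hu : D.MemVh u) (e : Fin D.card) :
    (D.elem e).ellProj p (D.ImEll e u) = 0 := by
  set q := (D.elem e).ellProj p ((D.elem e).restr u) with hq
  have hqm : q ∈ polySpace p := Polygon.ellProj_mem _ _ _
  have hA : (D.elem e).EllAdmissible ((D.elem e).restr q) := Polygon.ellAdmissible_restr hqm
  have h := (D.elem e).ellProj_add p (hu.2 e).1.ellAdmissible (hA.const_mul (-1))
  have h1 := (D.elem e).ellProj_const_mul p (-1) hA
  have h2 : (D.elem e).ellProj p ((D.elem e).restr q) = q := Polygon.ellProj_restr hqm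
  have h3 : D.ImEll e u = fun x => (D.elem e).restr u x + (-1) * (D.elem e).restr q x := by
    unfold ImEll
    rw [Polygon.restr_sub]
    funext x
    ring
  rw [h3, h, h1, h2]
  funext x
  change q x + -1 * q x = 0
  ring

end Discretization

theorem BilinOn.ofBilinForm {S : Submodule ℝ (Pt → ℝ)} (B : LinearMap.BilinForm ℝ (Pt → ℝ))
    {L : (Pt → ℝ) → Pt → ℝ} (hadd : ∀ u ∈ S, ∀ v ∈ S, L (u + v) = L u + L v)
    (hsmul : ∀ c : ℝ, ∀ u ∈ S, L (c • u) = c • L u) :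
    BilinOn S fun u v => B (L u) (L v) where
  add_left u hu u' hu' v _ := by rw [hadd u hu u' hu', map_add, LinearMap.add_apply]
  smul_left c u hu v _ := by
    rw [hsmul c u hu, map_smul, LinearMap.smul_apply, smul_eq_mul]
  add_right u _ v hv v' hv' := by rw [hadd v hv v' hv', map_add]
  smul_right c u _ v hv := by rw [hsmul c v hv, map_smul, smul_eq_mul]

namespace Discretization

variable {Ω : Set Pt} {p m : ℕ} {D : Discretization Ω p} {u v : Pt → ℝ}

theorem bilinOn_S1 (D : Discretization Ω p) (hΩ : IsOpen Ω) (e : Fin D.card) :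
    BilinOn (D.Vh hΩ) fun u v => D.S1 e (D.ImP e u) (D.ImP e v) :=
  .ofBilinForm _ (fun _ hu _ hv => ImP_add hu hv e) fun c _ hu => ImP_smul c hu e

theorem bilinOn_S2 (D : Discretization Ω p) (hΩ : IsOpen Ω) (e : Fin D.card) :
    BilinOn (D.Vh hΩ) fun u v => D.S2 e (D.ImEll e u) (D.ImEll e v) :=
  .ofBilinForm _ (fun _ hu _ hv => ImEll_add hu hv e) fun c _ hu => ImEll_smul c hu e

end Discretization

/-! ### Bounds on the coefficients -/

/-- The bounds at time `t` in the admissibility of the coefficients, on a set `U`. -/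
def Coefficients.BoundedAt {m : ℕ} (a : Coefficients m) (U : Set Pt) (ξ₀ B t : ℝ) : Prop :=
  (∀ i, AEStronglyMeasurable (a.ξ i t) (volume.restrict U) ∧
    ∀ᵐ x ∂(volume.restrict U), ξ₀ ≤ a.ξ i t x ∧ a.ξ i t x ≤ B) ∧
  (AEStronglyMeasurable (a.conv t) (volume.restrict U) ∧
    ∀ᵐ x ∂(volume.restrict U), ‖a.conv t x‖ ≤ B) ∧
  (∀ i j, AEStronglyMeasurable (a.A i j t) (volume.restrict U) ∧
    ∀ᵐ x ∂(volume.restrict U), |a.A i j t x| ≤ B) ∧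
  (∀ i l j, AEStronglyMeasurable (a.Q i l j t) (volume.restrict U) ∧
    ∀ᵐ x ∂(volume.restrict U), |a.Q i l j t x| ≤ B) ∧
  (∀ i j, AEStronglyMeasurable (a.R i j t) (volume.restrict U) ∧
    ∀ᵐ x ∂(volume.restrict U), |a.R i j t x| ≤ B) ∧
  (∀ i, MemLp (a.f i t) 2 (volume.restrict U))

theorem Coefficients.BoundedAt.mono {m : ℕ} {a : Coefficients m} {U V : Set Pt} {ξ₀ B t : ℝ}
    (h : a.BoundedAt V ξ₀ B t) (hUV : U ⊆ V) : a.BoundedAt U ξ₀ B t := by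
  have hm : volume.restrict U ≤ volume.restrict V := Measure.restrict_mono hUV le_rfl
  obtain ⟨h1, h2, h3, h4, h5, h6⟩ := h
  exact ⟨fun i => ⟨(h1 i).1.mono_measure hm, ae_mono hm (h1 i).2⟩,
    ⟨h2.1.mono_measure hm, ae_mono hm h2.2⟩,
    fun i j => ⟨(h3 i j).1.mono_measure hm, ae_mono hm (h3 i j).2⟩,
    fun i l j => ⟨(h4 i l j).1.mono_measure hm, ae_mono hm (h4 i l j).2⟩,
    fun i j => ⟨(h5 i j).1.mono_measure hm, ae_mono hm (h5 i j).2⟩,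
    fun i => (h6 i).mono_measure hm⟩

namespace Discretization

variable {Ω : Set Pt} {p m : ℕ} {D : Discretization Ω p} {u v : Pt → ℝ}
  {a : Coefficients m} {ξ₀ B t : ℝ} {W : Fin m → Pt → ℝ} {i : Fin m}

/-! ### Integrability of the integrands of the discrete forms -/

theorem integrable_ξ_inner (hξ : 0 < ξ₀) (ha : a.BoundedAt Ω ξ₀ B t) (i : Fin m)
    (e : Fin D.card) (u v : Pt → ℝ) :
    Integrable (fun x => a.ξ i t x * inner ℝ (D.PGrad e u x) (D.PGrad e v x))
      (volume.restrict (D.elem e).carrier) := by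
  obtain ⟨h1, -⟩ := ha.mono (D.subset e)
  refine Polygon.isWeight_of_bound (B := B) (h1 i).1 ?_ _
    ((D.continuous_PGrad e u).inner (D.continuous_PGrad e v))
  filter_upwards [(h1 i).2] with x hx
  rw [abs_of_pos (hξ.trans_le hx.1)]
  exact hx.2

theorem integrable_conv_inner (ha : a.BoundedAt Ω ξ₀ B t) (e : Fin D.card) (u v : Pt → ℝ) :
    Integrable (fun x => inner ℝ (a.conv t x) (D.PGrad e u x) * D.P e v x)
      (volume.restrict (D.elem e).carrier) := by
  obtain ⟨-, h2, -⟩ := ha.mono (D.subset e)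
  have h := integrable_inner_of_memLp (MemLp.of_bound h2.1 B h2.2)
    (memLp_of_continuous_of_isBounded ((D.continuous_P e v).smul (D.continuous_PGrad e u))
      (D.elem e).isBounded 2)
  refine h.congr (.of_forall fun x => ?_)
  change inner ℝ (a.conv t x) (D.P e v x • D.PGrad e u x) = _
  rw [real_inner_smul_right, mul_comm]

theorem isWeight_A (ha : a.BoundedAt Ω ξ₀ B t) (e : Fin D.card) (i j : Fin m) :
    (D.elem e).IsWeight (a.A i j t) :=
  have h := (ha.mono (D.subset e)).2.2.1 i j
  Polygon.isWeight_of_bound h.1 h.2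

theorem isWeight_Q (ha : a.BoundedAt Ω ξ₀ B t) (e : Fin D.card) (i l j : Fin m) :
    (D.elem e).IsWeight (a.Q i l j t) :=
  have h := (ha.mono (D.subset e)).2.2.2.1 i l j
  Polygon.isWeight_of_bound h.1 h.2

theorem isWeight_R (ha : a.BoundedAt Ω ξ₀ B t) (e : Fin D.card) (i j : Fin m) :
    (D.elem e).IsWeight (a.R i j t) :=
  have h := (ha.mono (D.subset e)).2.2.2.2.1 i j
  Polygon.isWeight_of_bound h.1 h.2

theorem isWeight_f (ha : a.BoundedAt Ω ξ₀ B t) (e : Fin D.card) (i : Fin m) :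
    (D.elem e).IsWeight (a.f i t) :=
  Polygon.isWeight_of_memLp ((ha.mono (D.subset e)).2.2.2.2.2 i)

theorem integrable_l2 (ha : a.BoundedAt Ω ξ₀ B t) (W : Fin m → Pt → ℝ) (i : Fin m)
    (e : Fin D.card) (u v : Pt → ℝ) :
    Integrable (fun x => D.P e u x * (∑ j, a.A i j t x * D.P e (W j) x) * D.P e v x)
      (volume.restrict (D.elem e).carrier) := by
  refine (Polygon.isWeight_sum (s := Finset.univ) (fun j _ => (isWeight_A ha e i j).mul_continuous
    (D.continuous_P e (W j))) _ ((D.continuous_P e u).mul (D.continuous_P e v))).congr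
    (.of_forall fun x => ?_)
  simp only [Pi.mul_apply]
  ring

theorem integrable_l3 (ha : a.BoundedAt Ω ξ₀ B t) (i : Fin m) (e : Fin D.card)
    (u v : Pt → ℝ) : Integrable (fun x => a.R i i t x * D.P e u x * D.P e v x)
      (volume.restrict (D.elem e).carrier) :=
  (isWeight_R ha e i i).mul_continuous (D.continuous_P e u) _ (D.continuous_P e v)

theorem integrable_P_mul (D : Discretization Ω p) (e : Fin D.card) (u v : Pt → ℝ) :
    Integrable (fun x => D.P e u x * D.P e v x) (volume.restrict (D.elem e).carrier) :=
  integrable_mul_of_memLp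
    (memLp_of_continuous_of_isBounded (D.continuous_P e u) (D.elem e).isBounded 2)
    (memLp_of_continuous_of_isBounded (D.continuous_P e v) (D.elem e).isBounded 2)

/-! ### Linearity of the discrete forms -/

theorem bilinOn_mh (D : Discretization Ω p) (hΩ : IsOpen Ω) : BilinOn (D.Vh hΩ) D.mh :=
  .sum fun e _ => .add (.integral (fun x => (D.linOn_P hΩ e x).mul (D.linOn_P hΩ e x))
    fun u _ v _ => D.integrable_P_mul e u v) (D.bilinOn_S1 hΩ e)

theorem bilinOn_ah (hΩ : IsOpen Ω) (hξ : 0 < ξ₀) (ha : a.BoundedAt Ω ξ₀ B t) (i : Fin m) :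
    BilinOn (D.Vh hΩ) (D.ah (a.ξ i t)) :=
  .sum fun e _ => .add (.integral (fun x => (D.bilinOn_inner_PGrad hΩ e x).const_mul _)
    fun u _ v _ => integrable_ξ_inner hξ ha i e u v) ((D.bilinOn_S2 hΩ e).const_mul _)

theorem bilinOn_l1 (hΩ : IsOpen Ω) (ha : a.BoundedAt Ω ξ₀ B t) :
    BilinOn (D.Vh hΩ) (D.l1 a t) :=
  .sum fun e _ => .integral (fun x => (D.linOn_inner_PGrad hΩ e _ x).mul (D.linOn_P hΩ e x))
    fun u _ v _ => integrable_conv_inner ha e u v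

theorem bilinOn_l2 (hΩ : IsOpen Ω) (ha : a.BoundedAt Ω ξ₀ B t) (W : Fin m → Pt → ℝ)
    (i : Fin m) : BilinOn (D.Vh hΩ) (D.l2 a t W i) :=
  .sum fun e _ => .integral (fun x => (((D.linOn_P hΩ e x).mul (D.linOn_P hΩ e x)).const_mul
      (∑ j, a.A i j t x * D.P e (W j) x)).congr fun u v => by ring)
    fun u _ v _ => integrable_l2 ha W i e u v

theorem bilinOn_l3 (hΩ : IsOpen Ω) (ha : a.BoundedAt Ω ξ₀ B t) (i : Fin m) :
    BilinOn (D.Vh hΩ) (D.l3 a t i) :=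
  .sum fun e _ => .integral (fun x => (((D.linOn_P hΩ e x).mul (D.linOn_P hΩ e x)).const_mul
      (a.R i i t x)).congr fun u v => by ring)
    fun u _ v _ => integrable_l3 ha i e u v

theorem linOn_l4 (hΩ : IsOpen Ω) (ha : a.BoundedAt Ω ξ₀ B t) (W : Fin m → Pt → ℝ)
    (i : Fin m) : LinOn (D.Vh hΩ) (D.l4 a t W i) :=
  .sum fun e _ => .integral (fun x => (D.linOn_P hΩ e x).const_mul _) fun v _ =>
    Polygon.isWeight_sum (fun l _ => Polygon.isWeight_sum fun j _ =>
      ((isWeight_Q ha e i l j).mul_continuous (D.continuous_P e (W l))).mul_continuous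
        (D.continuous_P e (W j))) _ (D.continuous_P e v)

theorem linOn_l5 (hΩ : IsOpen Ω) (ha : a.BoundedAt Ω ξ₀ B t) (W : Fin m → Pt → ℝ)
    (i : Fin m) : LinOn (D.Vh hΩ) (D.l5 a t W i) :=
  .sum fun e _ => .integral (fun x => (D.linOn_P hΩ e x).const_mul _) fun v _ =>
    Polygon.isWeight_sum (fun j _ => (isWeight_R ha e i j).mul_continuous
      (D.continuous_P e (W j))) _ (D.continuous_P e v)

theorem linOn_load (hΩ : IsOpen Ω) (ha : a.BoundedAt Ω ξ₀ B t) (i : Fin m) :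
    LinOn (D.Vh hΩ) (D.load a t i) :=
  .sum fun e _ => .integral (fun x => (D.linOn_P hΩ e x).const_mul _) fun v _ =>
    isWeight_f ha e i _ (D.continuous_P e v)

end Discretization
end VEM

namespace VEM

/-! ### Consequences of the stability bounds -/

namespace Discretization

variable {Ω : Set Pt} {p m : ℕ} {D : Discretization Ω p} {u v : Pt → ℝ}
  {αl αu βl βu : ℝ}

theorem Stable.S1_nonneg (hS : D.Stable αl αu βl βu) (hα : 0 < αl) (hu : D.MemVh u)
    (e : Fin D.card) : 0 ≤ D.S1 e (D.ImP e u) (D.ImP e u) :=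
  (mul_nonneg hα.le (integral_nonneg fun _ => sq_nonneg _)).trans
    ((hS e).2.1 _ (memV_ImP hu e) (l2Proj_ImP hu e)).1

theorem Stable.S2_nonneg (hS : D.Stable αl αu βl βu) (hβ : 0 < βl) (hu : D.MemVh u)
    (e : Fin D.card) : 0 ≤ D.S2 e (D.ImEll e u) (D.ImEll e u) :=
  (mul_nonneg hβ.le (integral_nonneg fun _ => sq_nonneg _)).trans
    ((hS e).2.2 _ (memV_ImEll hu e) (ellProj_ImEll hu e)).1

theorem Stable.ImP_ae_eq_zero (hS : D.Stable αl αu βl βu) (hα : 0 < αl) (hu : D.MemVh u)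
    {e : Fin D.card} (h : D.S1 e (D.ImP e u) (D.ImP e u) ≤ 0) :
    D.ImP e u =ᵐ[volume.restrict (D.elem e).carrier] 0 := by
  have hV := memV_ImP hu e
  have h1 := ((hS e).2.1 _ hV (l2Proj_ImP hu e)).1.trans h
  have h2 : ∫ x in (D.elem e).carrier, D.ImP e u x ^ 2 = 0 :=
    le_antisymm (nonpos_of_mul_nonpos_right h1 hα) (integral_nonneg fun _ => sq_nonneg _)
  rw [integral_eq_zero_iff_of_nonneg (fun _ => sq_nonneg _) hV.1.memLp.integrable_sq] at h2
  filter_upwards [h2] with x hx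
  exact pow_eq_zero_iff (two_ne_zero) |>.1 hx

/-- By the Cauchy–Schwarz inequality for `S₁`, functions whose part `(I - 𝒫) v` vanishes almost
everywhere do not contribute to the stabilization. -/
theorem Stable.S1_eq_zero (hΩ : IsOpen Ω) (hS : D.Stable αl αu βl βu) (hα : 0 < αl)
    (hu : D.MemVh u) (hv : D.MemVh v) {e : Fin D.card}
    (h : D.ImP e v =ᵐ[volume.restrict (D.elem e).carrier] 0) :
    D.S1 e (D.ImP e u) (D.ImP e v) = 0 ∧ D.S1 e (D.ImP e v) (D.ImP e u) = 0 := by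
  refine bilin_eq_zero_of_null _ (fun t => ?_)
    ((hS e).1 _ _ (memV_ImP hu e) (memV_ImP hv e)).1 ?_
  · have htv : D.MemVh (t • v) := (D.Vh hΩ).smul_mem t hv
    rw [← ImP_smul t hv, ← ImP_add hu htv]
    exact hS.S1_nonneg hα ((D.Vh hΩ).add_mem hu htv) e
  · refine ((hS e).2.1 _ (memV_ImP hv e) (l2Proj_ImP hv e)).2.trans_eq ?_
    rw [integral_eq_zero_of_ae, mul_zero]
    filter_upwards [h] with x hx
    simp [hx]

theorem Stable.S2_eq_zero (hΩ : IsOpen Ω) (hS : D.Stable αl αu βl βu) (hβ : 0 < βl)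
    (hu : D.MemVh u) (hv : D.MemVh v) {e : Fin D.card}
    (h : weakGrad (D.elem e).carrier (D.ImEll e u) =ᵐ[volume.restrict (D.elem e).carrier] 0) :
    D.S2 e (D.ImEll e u) (D.ImEll e v) = 0 := by
  refine (bilin_eq_zero_of_null _ (fun t => ?_)
    ((hS e).1 _ _ (memV_ImEll hv e) (memV_ImEll hu e)).2 ?_).2
  · have htu : D.MemVh (t • u) := (D.Vh hΩ).smul_mem t hu
    rw [← ImEll_smul t hu, ← ImEll_add hv htu]
    exact hS.S2_nonneg hβ ((D.Vh hΩ).add_mem hv htu) e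
  · refine ((hS e).2.2 _ (memV_ImEll hu e) (ellProj_ImEll hu e)).2.trans_eq ?_
    rw [integral_eq_zero_of_ae, mul_zero]
    filter_upwards [h] with x hx
    simp [hx]

/-! ### Functions that vanish almost everywhere -/

theorem restr_ae_eq_of_ae_eq (h : u =ᵐ[volume.restrict Ω] v) (e : Fin D.card) :
    (D.elem e).restr u =ᵐ[volume.restrict (D.elem e).carrier] (D.elem e).restr v :=
  ((Polygon.restr_ae_eq u).trans (ae_restrict_of_ae_restrict_of_subset (D.subset e) h)).trans
    (Polygon.restr_ae_eq v).symm

theorem P_congr (hu : D.MemVh u) (h : u =ᵐ[volume.restrict Ω] v) (e : Fin D.card) :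
    D.P e u = D.P e v :=
  (D.elem e).l2Proj_congr p (hu.memLp_restr e) (restr_ae_eq_of_ae_eq h e)

theorem P_eq_zero (h : u =ᵐ[volume.restrict Ω] 0) (e : Fin D.card) : D.P e u = 0 :=
  Polygon.l2Proj_eq_zero ((Polygon.restr_ae_eq u).trans
    (ae_restrict_of_ae_restrict_of_subset (D.subset e) h))

theorem ImP_eq_restr {e : Fin D.card} (h : D.P e u = 0) : D.ImP e u = (D.elem e).restr u := by
  simp [ImP, h]

theorem ImP_ae_eq_zero (h : u =ᵐ[volume.restrict Ω] 0) (e : Fin D.card) :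
    D.ImP e u =ᵐ[volume.restrict (D.elem e).carrier] 0 := by
  rw [ImP_eq_restr (P_eq_zero h e)]
  exact (Polygon.restr_ae_eq u).trans (ae_restrict_of_ae_restrict_of_subset (D.subset e) h)

theorem mh_eq_zero (hΩ : IsOpen Ω) (hS : D.Stable αl αu βl βu) (hα : 0 < αl)
    (hu : D.MemVh u) (hv : D.MemVh v) (h : v =ᵐ[volume.restrict Ω] 0) :
    D.mh u v = 0 ∧ D.mh v u = 0 := by
  constructor <;> refine Finset.sum_eq_zero fun e _ => ?_
  · simp [P_eq_zero h e, (hS.S1_eq_zero hΩ hα hu hv (ImP_ae_eq_zero h e)).1]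
  · simp [P_eq_zero h e, (hS.S1_eq_zero hΩ hα hu hv (ImP_ae_eq_zero h e)).2]

/-- The elements cover `Ω` up to a null set, namely their boundaries. -/
theorem ae_eq_zero_of_elem (h : ∀ e, (D.elem e).restr u
    =ᵐ[volume.restrict (D.elem e).carrier] 0) : u =ᵐ[volume.restrict Ω] 0 := by
  have hc : ∀ e, u =ᵐ[volume.restrict (closure (D.elem e).carrier)] 0 := fun e => by
    have h1 : volume.restrict (closure (D.elem e).carrier)
        = volume.restrict (D.elem e).carrier := by
      refine Measure.restrict_congr_set (Filter.EventuallyEq.symm ?_)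
      refine (ae_eq_set).2 ⟨?_, ?_⟩
      · rw [sdiff_eq_empty.2 subset_closure, measure_empty]
      · refine measure_mono_null ?_ (D.elem e).volume_frontier
        rw [(D.elem e).isOpen.frontier_eq]
    rw [h1]
    exact (Polygon.restr_ae_eq u).symm.trans (h e)
  refine ae_restrict_of_ae_restrict_of_subset (t := ⋃ e, closure (D.elem e).carrier) ?_ ?_
  · exact D.cover ▸ subset_closure
  · exact (ae_restrict_iUnion_iff _ _).2 hc

/-! ### The scheme for one component -/

/-- The bilinear form on the left-hand side of the linearized scheme for the component `i`. -/
def stepForm (D : Discretization Ω p) (a : Coefficients m) (dt t : ℝ) (W : Fin m → Pt → ℝ)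
    (i : Fin m) (u v : Pt → ℝ) : ℝ :=
  D.mh u v + dt * (D.ah (a.ξ i t) u v + D.l1 a t u v + D.l2 a t W i u v + D.l3 a t i u v)

/-- The known terms of the linearized scheme for the component `i`. -/
def stepLoad (D : Discretization Ω p) (a : Coefficients m) (dt t : ℝ) (W : Fin m → Pt → ℝ)
    (i : Fin m) (v : Pt → ℝ) : ℝ :=
  D.mh (W i) v + dt * ((-1) * D.l4 a t W i v + (-1) * D.l5 a t W i v + D.load a t i v)

variable {a : Coefficients m} {ξ₀ B t dt : ℝ} {W : Fin m → Pt → ℝ} {i : Fin m}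

theorem bilinOn_stepForm (hΩ : IsOpen Ω) (hξ : 0 < ξ₀) (ha : a.BoundedAt Ω ξ₀ B t) (dt : ℝ)
    (W : Fin m → Pt → ℝ) (i : Fin m) : BilinOn (D.Vh hΩ) (D.stepForm a dt t W i) :=
  (D.bilinOn_mh hΩ).add (.const_mul dt ((((bilinOn_ah hΩ hξ ha i).add (bilinOn_l1 hΩ ha)).add
    (bilinOn_l2 hΩ ha W i)).add (bilinOn_l3 hΩ ha i)))

theorem linOn_stepLoad (hΩ : IsOpen Ω) (ha : a.BoundedAt Ω ξ₀ B t) (dt : ℝ)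
    (hW : D.MemVh (W i)) : LinOn (D.Vh hΩ) (D.stepLoad a dt t W i) :=
  ((D.bilinOn_mh hΩ).linOn hW).add' (.const_mul dt ((((linOn_l4 hΩ ha W i).const_mul (-1)).add'
    ((linOn_l5 hΩ ha W i).const_mul (-1))).add' (linOn_load hΩ ha i)))

/-- The system decouples into one problem for each component. -/
theorem solvesStep_iff (hΩ : IsOpen Ω) (hξ : 0 < ξ₀) (ha : a.BoundedAt Ω ξ₀ B t)
    (hW : ∀ i, D.MemVh (W i)) {U : Fin m → Pt → ℝ} :
    D.SolvesStep a dt t W U ↔ (∀ i, D.MemVh (U i)) ∧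
      ∀ i v, D.MemVh v → D.stepForm a dt t W i (U i) v = D.stepLoad a dt t W i v := by
  have key : ∀ V : Fin m → Pt → ℝ,
      (∑ i, (D.mh (U i) (V i) - D.mh (W i) (V i) + dt * D.ah (a.ξ i t) (U i) (V i)
        + dt * D.l1 a t (U i) (V i) + dt * D.l2 a t W i (U i) (V i)
        + dt * D.l3 a t i (U i) (V i))
        = dt * ∑ i, (- D.l4 a t W i (V i) - D.l5 a t W i (V i) + D.load a t i (V i))) ↔
      ∑ i, (D.stepForm a dt t W i (U i) (V i) - D.stepLoad a dt t W i (V i)) = 0 := fun V => by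
    rw [← sub_eq_zero, Finset.mul_sum, ← Finset.sum_sub_distrib]
    refine Eq.congr_left (Finset.sum_congr rfl fun i _ => ?_)
    simp only [stepForm, stepLoad]
    ring
  refine and_congr_right fun hU => ⟨fun h i v hv => ?_, fun h V hV => ?_⟩
  · -- test with `V` whose only nonzero component is `v` in place `i`
    have hV : ∀ j, D.MemVh ((Pi.single i v : Fin m → Pt → ℝ) j) := fun j => by
      rcases eq_or_ne j i with rfl | hj
      · simpa using hv
      · rw [Pi.single_eq_of_ne hj]
        exact (D.Vh hΩ).zero_mem
    have h0 := (key _).1 (h _ hV)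
    rw [Finset.sum_eq_single i] at h0
    · rw [Pi.single_eq_same] at h0
      exact sub_eq_zero.1 h0
    · intro j _ hj
      rw [Pi.single_eq_of_ne hj, (bilinOn_stepForm hΩ hξ ha dt W j).zero_right (hU j)]
      have := (linOn_stepLoad hΩ ha dt (hW j)).smul 0 0 (D.Vh hΩ).zero_mem
      rw [zero_smul, zero_mul] at this
      rw [this, sub_zero]
    · simp
  · exact (key V).2 (Finset.sum_eq_zero fun i _ => sub_eq_zero.2 (h i _ (hV i)))

/-! ### Coercivity -/

/-- Young's inequality for the integrand of the quadratic form. -/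
theorem young_lower_bound {ξ ξ₀ B M s r q : ℝ} {w g : Pt} (hξ₀ : 0 < ξ₀) (hξ : ξ₀ ≤ ξ)
    (hw : ‖w‖ ≤ B) (hs : |s| ≤ M) (hr : |r| ≤ B) :
    -((B ^ 2 / (4 * ξ₀) + M + B) * (q * q)) ≤
      ξ * inner ℝ g g + inner ℝ w g * q + q * s * q + r * q * q := by
  have h1 : ξ₀ * ‖g‖ ^ 2 ≤ ξ * inner ℝ g g := by
    rw [real_inner_self_eq_norm_sq]
    gcongr
  have h2 : |inner ℝ w g * q| ≤ B * ‖g‖ * |q| := by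
    rw [abs_mul]
    gcongr
    exact (abs_real_inner_le_norm w g).trans (by gcongr)
  have h3 : -(M * (q * q)) ≤ q * s * q := by
    have := mul_nonneg (sub_nonneg.2 (neg_le_of_abs_le hs)) (mul_self_nonneg q)
    nlinarith
  have h4 : -(B * (q * q)) ≤ r * q * q := by
    have := mul_nonneg (sub_nonneg.2 (neg_le_of_abs_le hr)) (mul_self_nonneg q)
    nlinarith
  have h5 : B * ‖g‖ * |q| ≤ ξ₀ * ‖g‖ ^ 2 + B ^ 2 / (4 * ξ₀) * (q * q) := by
    have e : ξ₀ * ‖g‖ ^ 2 + B ^ 2 / (4 * ξ₀) * (q * q) - B * ‖g‖ * |q|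
        = ξ₀ * (‖g‖ - B / (2 * ξ₀) * |q|) ^ 2 := by
      rw [← abs_mul_abs_self q]
      field_simp
      ring
    have := mul_nonneg hξ₀.le (sq_nonneg (‖g‖ - B / (2 * ξ₀) * |q|))
    linarith
  have h6 := neg_le_of_abs_le h2
  linarith

theorem neg_mul_integral_le {ν : Measure Pt} {f g₁ g₂ g₃ g₄ : Pt → ℝ} {C : ℝ}
    (hf : Integrable f ν) (h₁ : Integrable g₁ ν) (h₂ : Integrable g₂ ν) (h₃ : Integrable g₃ ν)
    (h₄ : Integrable g₄ ν) (h : ∀ᵐ x ∂ν, -(C * f x) ≤ g₁ x + g₂ x + g₃ x + g₄ x) :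
    -(C * ∫ x, f x ∂ν) ≤ (∫ x, g₁ x ∂ν) + (∫ x, g₂ x ∂ν) + (∫ x, g₃ x ∂ν) + ∫ x, g₄ x ∂ν := by
  rw [← integral_add' h₁ h₂, ← integral_add' (h₁.add h₂) h₃,
    ← integral_add' ((h₁.add h₂).add h₃) h₄,
    ← integral_const_mul, ← integral_neg]
  exact integral_mono_ae (hf.const_mul C).neg (((h₁.add h₂).add h₃).add h₄) h

/-- A Gårding inequality: the convection term is absorbed by diffusion, the reaction terms are
bounded by the `L²` norm of `𝒫 u`, which the time derivative controls for small time steps. -/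
theorem le_stepForm (hS : D.Stable αl αu βl βu) (hβ : 0 < βl) (hξ : 0 < ξ₀)
    (ha : a.BoundedAt Ω ξ₀ B t) {M : ℝ}
    (hM : ∀ e, ∀ x ∈ (D.elem e).carrier, ∀ j, |D.P e (W j) x| ≤ M) (hdt : 0 ≤ dt)
    (hu : D.MemVh u) (i : Fin m) :
    ∑ e, ((1 - dt * (B ^ 2 / (4 * ξ₀) + m * |B| * M + |B|)) *
        (∫ x in (D.elem e).carrier, D.P e u x * D.P e u x)
        + D.S1 e (D.ImP e u) (D.ImP e u)) ≤ D.stepForm a dt t W i u u := by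
  set C := B ^ 2 / (4 * ξ₀) + m * |B| * M + |B| with hC
  have hel : ∀ e : Fin D.card,
      -(C * ∫ x in (D.elem e).carrier, D.P e u x * D.P e u x) ≤
        (∫ x in (D.elem e).carrier, a.ξ i t x * inner ℝ (D.PGrad e u x) (D.PGrad e u x)) +
        (∫ x in (D.elem e).carrier, inner ℝ (a.conv t x) (D.PGrad e u x) * D.P e u x) +
        (∫ x in (D.elem e).carrier,
          D.P e u x * (∑ j, a.A i j t x * D.P e (W j) x) * D.P e u x) +
        ∫ x in (D.elem e).carrier, a.R i i t x * D.P e u x * D.P e u x := fun e => by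
    refine neg_mul_integral_le (D.integrable_P_mul e u u) (integrable_ξ_inner hξ ha i e u u)
      (integrable_conv_inner ha e u u) (integrable_l2 ha W i e u u) (integrable_l3 ha i e u u) ?_
    obtain ⟨h1, h2, h3, -, h5, -⟩ := ha.mono (D.subset e)
    have h3' := fun j => (h3 i j).2
    rw [← ae_all_iff] at h3'
    filter_upwards [(h1 i).2, h2.2, h3', (h5 i i).2,
      ae_restrict_mem (D.elem e).measurableSet] with x x1 x2 x3 x5 hx
    -- any bound at a point of `Ω` shows `0 ≤ B`
    have hB : |B| = B := abs_of_nonneg ((norm_nonneg _).trans x2)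
    have hs : |∑ j, a.A i j t x * D.P e (W j) x| ≤ m * |B| * M := by
      refine (Finset.abs_sum_le_sum_abs _ _).trans ((Finset.sum_le_card_nsmul _ _ (|B| * M)
        fun j _ => ?_).trans_eq (by simp [mul_assoc]))
      rw [abs_mul, hB]
      exact mul_le_mul (x3 j) (hM e x hx j) (abs_nonneg _) ((abs_nonneg _).trans (x3 j))
    have := young_lower_bound (q := D.P e u x) (g := D.PGrad e u x) hξ x1.1
      (x2.trans (le_abs_self B)) hs (x5.trans (le_abs_self B))
    rw [sq_abs] at this
    exact this
  have hsum : D.stepForm a dt t W i u u = ∑ e,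
      ((∫ x in (D.elem e).carrier, D.P e u x * D.P e u x) + D.S1 e (D.ImP e u) (D.ImP e u)
      + dt * ((∫ x in (D.elem e).carrier, a.ξ i t x * inner ℝ (D.PGrad e u x) (D.PGrad e u x)) +
        (eLpNorm (a.ξ i t) ⊤ (volume.restrict (D.elem e).carrier)).toReal *
          D.S2 e (D.ImEll e u) (D.ImEll e u) +
        (∫ x in (D.elem e).carrier, inner ℝ (a.conv t x) (D.PGrad e u x) * D.P e u x) +
        (∫ x in (D.elem e).carrier,
          D.P e u x * (∑ j, a.A i j t x * D.P e (W j) x) * D.P e u x) +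
        ∫ x in (D.elem e).carrier, a.R i i t x * D.P e u x * D.P e u x)) := by
    simp only [stepForm, mh, ah, l1, l2, l3, ← Finset.sum_add_distrib, Finset.mul_sum]
  rw [hsum]
  refine Finset.sum_le_sum fun e _ => ?_
  have h2 := mul_nonneg (ENNReal.toReal_nonneg
    (a := eLpNorm (a.ξ i t) ⊤ (volume.restrict (D.elem e).carrier))) (hS.S2_nonneg hβ hu e)
  have h3 := mul_le_mul_of_nonneg_left (add_le_add (hel e) h2) hdt
  linarith

/-- For small time steps the quadratic form vanishes only on functions that are zero almost
everywhere. -/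
theorem ae_eq_zero_of_stepForm_self (hS : D.Stable αl αu βl βu) (hα : 0 < αl) (hβ : 0 < βl)
    (hξ : 0 < ξ₀) (ha : a.BoundedAt Ω ξ₀ B t) {M : ℝ}
    (hM : ∀ e, ∀ x ∈ (D.elem e).carrier, ∀ j, |D.P e (W j) x| ≤ M) (hdt : 0 ≤ dt)
    (hC : dt * (B ^ 2 / (4 * ξ₀) + m * |B| * M + |B|) < 1)
    (hu : D.MemVh u) (h : D.stepForm a dt t W i u u = 0) : u =ᵐ[volume.restrict Ω] 0 := by
  have h1 := (le_stepForm hS hβ hξ ha hM hdt hu i).trans_eq h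
  have hP : ∀ e : Fin D.card, 0 ≤ ∫ x in (D.elem e).carrier, D.P e u x * D.P e u x :=
    fun e => integral_nonneg fun _ => mul_self_nonneg _
  have hterm : ∀ e ∈ Finset.univ, (0 : ℝ) ≤
      (1 - dt * (B ^ 2 / (4 * ξ₀) + m * |B| * M + |B|)) *
        (∫ x in (D.elem e).carrier, D.P e u x * D.P e u x)
        + D.S1 e (D.ImP e u) (D.ImP e u) := fun e _ =>
    add_nonneg (mul_nonneg (sub_nonneg.2 hC.le) (hP e)) (hS.S1_nonneg hα hu e)
  have h0 := (Finset.sum_eq_zero_iff_of_nonneg hterm).1 (h1.antisymm (Finset.sum_nonneg hterm))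
  refine ae_eq_zero_of_elem (D := D) fun e => ?_
  have he := h0 e (Finset.mem_univ e)
  have hS1 := hS.S1_nonneg hα hu e
  have hPe : ∫ x in (D.elem e).carrier, D.P e u x * D.P e u x = 0 := by
    refine le_antisymm ?_ (hP e)
    refine nonpos_of_mul_nonpos_right ?_ (sub_pos.2 hC)
    linarith
  rw [hPe, mul_zero, zero_add] at he
  have hP0 : D.P e u = 0 := eq_zero_of_integral_sq (Polygon.l2Proj_mem _ _ _) (D.elem e).isOpen
    (D.elem e).nonempty (D.elem e).isBounded hPe
  rw [← ImP_eq_restr hP0]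
  exact hS.ImP_ae_eq_zero hα hu he.le

end Discretization
end VEM

namespace VEM

/-! ### Solvability of variational problems of finite rank -/

/-- A linear operator `T` of finite rank into the dual space hits every functional that vanishes on
the vectors `v` with `⟨T v, v⟩ = 0`. -/
theorem exists_apply_eq_of_finiteRank {X Y : Type*} [AddCommGroup X] [Module ℝ X]
    [AddCommGroup Y] [Module ℝ Y] [FiniteDimensional ℝ Y] (T : X →ₗ[ℝ] Module.Dual ℝ X)
    (Φ : X →ₗ[ℝ] Y) (hΦ : LinearMap.ker Φ ≤ LinearMap.ker T) (F : Module.Dual ℝ X)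
    (hF : ∀ v, T v v = 0 → F v = 0) : ∃ u, T u = F := by
  have : FiniteDimensional ℝ (X ⧸ LinearMap.ker Φ) :=
    Φ.quotKerEquivRange.symm.finiteDimensional
  have hr : LinearMap.range T = LinearMap.range ((LinearMap.ker Φ).liftQ T hΦ) :=
    (Submodule.range_liftQ _ _ _).symm
  have : FiniteDimensional ℝ (LinearMap.range T) := by
    rw [hr]
    infer_instance
  suffices F ∈ LinearMap.range T from this
  rw [← Subspace.dualCoannihilator_dualAnnihilator_eq (W := LinearMap.range T),
    Submodule.mem_dualAnnihilator]
  intro v hv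
  rw [Submodule.mem_dualCoannihilator] at hv
  exact hF v (hv _ ⟨v, rfl⟩)

theorem BilinOn.exists_solution {S : Submodule ℝ (Pt → ℝ)} {f : (Pt → ℝ) → (Pt → ℝ) → ℝ}
    {F : (Pt → ℝ) → ℝ} (hf : BilinOn S f) (hF : LinOn S F) {Y : Type*} [AddCommGroup Y]
    [Module ℝ Y] [FiniteDimensional ℝ Y] (Φ : S →ₗ[ℝ] Y)
    (hΦ : ∀ u : S, Φ u = 0 → ∀ v ∈ S, f u v = 0) (h0 : ∀ v ∈ S, f v v = 0 → F v = 0) :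
    ∃ u ∈ S, ∀ v ∈ S, f u v = F v := by
  let T : S →ₗ[ℝ] Module.Dual ℝ S := LinearMap.mk₂ ℝ (fun u v : S => f u v)
    (fun u u' v => hf.add_left u u.2 u' u'.2 v v.2) (fun c u v => hf.smul_left c u u.2 v v.2)
    (fun u v v' => hf.add_right u u.2 v v.2 v' v'.2) (fun c u v => hf.smul_right c u u.2 v v.2)
  let G : Module.Dual ℝ S :=
    { toFun := fun v => F v
      map_add' := fun v v' => hF.add v v.2 v' v'.2
      map_smul' := fun c v => hF.smul c v v.2 }
  obtain ⟨u, hu⟩ := exists_apply_eq_of_finiteRank T Φ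
    (fun u hu => LinearMap.mem_ker.2 (LinearMap.ext fun v => hΦ u hu v v.2)) G
    (fun v hv => h0 v v.2 hv)
  exact ⟨u, u.2, fun v hv => LinearMap.congr_fun hu ⟨v, hv⟩⟩

namespace Discretization

variable {Ω : Set Pt} {p m : ℕ} {D : Discretization Ω p} {u v : Pt → ℝ}
  {αl αu βl βu : ℝ} {a : Coefficients m} {ξ₀ B t dt : ℝ} {W : Fin m → Pt → ℝ} {i : Fin m}

/-! ### Solvability of one time step -/

/-- Data that determine `u` up to null sets: on each element, the projection `𝒫 u` and the values
at `p + 1` equidistant points of each edge. -/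
def dof (D : Discretization Ω p) (hΩ : IsOpen Ω) : D.Vh hΩ →ₗ[ℝ]
    ∀ e : Fin D.card, polySpace (p : ℤ) × (Fin (D.elem e).n → Fin (p + 1) → ℝ) where
  toFun u e := (⟨D.P e u, Polygon.l2Proj_mem _ _ _⟩, fun k j =>
    (u : Pt → ℝ) (AffineMap.lineMap ((D.elem e).vert k) ((D.elem e).next k) ((j : ℝ) / p)))
  map_add' u v := by
    funext e
    exact Prod.ext (Subtype.ext (P_add u.2 v.2 e)) rfl
  map_smul' c u := by
    funext e
    exact Prod.ext (Subtype.ext (P_smul c u.2 e)) rfl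

/-- The left-hand side of the scheme depends on `u` only through `dof`. -/
theorem stepForm_eq_zero_of_dof (hΩ : IsOpen Ω) (hp : 1 ≤ p) (hS : D.Stable αl αu βl βu)
    (hα : 0 < αl) (hβ : 0 < βl) (u : D.Vh hΩ) (hu : D.dof hΩ u = 0) (hv : D.MemVh v) :
    D.stepForm a dt t W i u v = 0 := by
  have huV : D.MemVh u := u.2
  have hP : ∀ e, D.P e u = 0 := fun e => congrArg (fun z => ((z e).1 : Pt → ℝ)) hu
  -- by unisolvence, `u` vanishes on each element almost everywhere and on its boundary pointwise
  have key := fun e => (huV.2 e).1.eq_zero hp (fun k j => by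
    have hj : (j : ℝ) / p ∈ Icc (0 : ℝ) 1 := by
      have hp0 : (0 : ℝ) < p := by exact_mod_cast hp
      refine ⟨by positivity, (div_le_one hp0).2 ?_⟩
      exact_mod_cast Nat.lt_succ_iff.1 j.2
    rw [Polygon.restr_of_mem_frontier (Polygon.lineMap_mem_frontier _ k hj)]
    exact congrArg (fun z => (z e).2 k j) hu) (hP e)
  have hG : ∀ e x, D.PGrad e u x = 0 := fun e x => Polygon.gradProj_eq_zero _ (key e).2.2 x
  have h1 : ∀ e, D.S1 e (D.ImP e u) (D.ImP e v) = 0 := fun e => by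
    refine (hS.S1_eq_zero hΩ hα hv huV ?_).2
    rw [ImP_eq_restr (hP e)]
    exact (key e).2.1
  have h2 : ∀ e, D.S2 e (D.ImEll e u) (D.ImEll e v) = 0 := fun e => by
    refine hS.S2_eq_zero hΩ hβ huV hv ?_
    have h0 : (D.elem e).ellProj p ((D.elem e).restr u) = 0 :=
      Polygon.ellProj_eq_zero (huV.2 e).1.ellAdmissible (key e).2.2 (key e).1
    have h3 : D.ImEll e u = (D.elem e).restr u := by simp [ImEll, h0]
    rw [h3]
    exact (key e).2.2
  simp [stepForm, mh, ah, l1, l2, l3, hP, hG, h1, h2]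

theorem stepLoad_eq_zero (hΩ : IsOpen Ω) (hS : D.Stable αl αu βl βu) (hα : 0 < αl)
    (hW : D.MemVh (W i)) (hv : D.MemVh v) (h : v =ᵐ[volume.restrict Ω] 0) :
    D.stepLoad a dt t W i v = 0 := by
  simp [stepLoad, (mh_eq_zero hΩ hS hα hW hv h).1, l4, l5, load, P_eq_zero h]

theorem exists_solvesStep (hΩ : IsOpen Ω) (hp : 1 ≤ p) (hS : D.Stable αl αu βl βu)
    (hα : 0 < αl) (hβ : 0 < βl) (hξ : 0 < ξ₀) (ha : a.BoundedAt Ω ξ₀ B t) {M : ℝ}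
    (hM : ∀ e, ∀ x ∈ (D.elem e).carrier, ∀ j, |D.P e (W j) x| ≤ M) (hdt : 0 ≤ dt)
    (hC : dt * (B ^ 2 / (4 * ξ₀) + m * |B| * M + |B|) < 1) (hW : ∀ i, D.MemVh (W i)) :
    ∃ U, D.SolvesStep a dt t W U ∧
      ∀ U', D.SolvesStep a dt t W U' → ∀ i, U' i =ᵐ[volume.restrict Ω] U i := by
  have hzero : ∀ i v, D.MemVh v → D.stepForm a dt t W i v v = 0 → v =ᵐ[volume.restrict Ω] 0 :=
    fun i v hv => ae_eq_zero_of_stepForm_self hS hα hβ hξ ha hM hdt hC hv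
  have hex : ∀ i, ∃ u ∈ D.Vh hΩ, ∀ v ∈ D.Vh hΩ,
      D.stepForm a dt t W i u v = D.stepLoad a dt t W i v := fun i =>
    (bilinOn_stepForm hΩ hξ ha dt W i).exists_solution (linOn_stepLoad hΩ ha dt (hW i)) (D.dof hΩ)
      (fun u hu v hv => stepForm_eq_zero_of_dof hΩ hp hS hα hβ u hu hv)
      (fun v hv h => stepLoad_eq_zero hΩ hS hα (hW i) hv (hzero i v hv h))
  choose U hU hUeq using hex
  refine ⟨U, (solvesStep_iff hΩ hξ ha hW).2 ⟨hU, hUeq⟩, fun U' hU' i => ?_⟩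
  obtain ⟨hm, he⟩ := (solvesStep_iff hΩ hξ ha hW).1 hU'
  have hb := bilinOn_stepForm (D := D) hΩ hξ ha dt W i
  have hn : (-1 : ℝ) • U i ∈ D.Vh hΩ := (D.Vh hΩ).smul_mem _ (hU i)
  have hd : U' i + (-1 : ℝ) • U i ∈ D.Vh hΩ := (D.Vh hΩ).add_mem (hm i) hn
  have h0 := hzero i _ hd (by
    rw [hb.add_left _ (hm i) _ hn _ hd, hb.smul_left _ _ (hU i) _ hd, he i _ hd, hUeq i _ hd]
    ring)
  filter_upwards [h0] with x hx
  simp only [Pi.add_apply, Pi.smul_apply, smul_eq_mul, Pi.zero_apply] at hx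
  linarith

/-- Modifying the previous iterate on a null set does not change the scheme. -/
theorem SolvesStep.congr (hΩ : IsOpen Ω) (hS : D.Stable αl αu βl βu) (hα : 0 < αl)
    (hξ : 0 < ξ₀) (ha : a.BoundedAt Ω ξ₀ B t) {W' U : Fin m → Pt → ℝ}
    (hW : ∀ i, D.MemVh (W i)) (hW' : ∀ i, D.MemVh (W' i))
    (h : ∀ i, W i =ᵐ[volume.restrict Ω] W' i) (hU : D.SolvesStep a dt t W U) :
    D.SolvesStep a dt t W' U := by
  obtain ⟨hm, he⟩ := (solvesStep_iff hΩ hξ ha hW).1 hU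
  refine (solvesStep_iff hΩ hξ ha hW').2 ⟨hm, fun i v hv => ?_⟩
  have hP : ∀ e j, D.P e (W' j) = D.P e (W j) := fun e j => (P_congr (hW j) (h j) e).symm
  have hb := D.bilinOn_mh hΩ
  have hn : (-1 : ℝ) • W' i ∈ D.Vh hΩ := (D.Vh hΩ).smul_mem _ (hW' i)
  have hd : W i + (-1 : ℝ) • W' i ∈ D.Vh hΩ := (D.Vh hΩ).add_mem (hW i) hn
  have hmh : D.mh (W' i) v = D.mh (W i) v := by
    have h0 := (mh_eq_zero (v := W i + (-1 : ℝ) • W' i) hΩ hS hα hv hd (by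
      filter_upwards [h i] with x hx
      simp [hx])).2
    rw [hb.add_left _ (hW i) _ hn _ hv, hb.smul_left _ _ (hW' i) _ hv] at h0
    linarith
  have := he i v hv
  simp only [stepForm, stepLoad, l2, l4, l5, hP, hmh] at this ⊢
  exact this

/-- An iterate bounded by `μ + 1` has projections bounded by a multiple of `μ + 1`. -/
theorem abs_P_le {K μ δ c : ℝ} (hμ : 0 < μ)
    (hK : ∀ (E : Polygon) (c : ℝ), E.ShapeRegular δ c → ∀ (u : Pt → ℝ) (M : ℝ),
      0 ≤ M → AEStronglyMeasurable u (volume.restrict E.carrier) →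
      (∀ᵐ x ∂(volume.restrict E.carrier), |u x| ≤ M) →
      ∀ x ∈ E.carrier, |E.l2Proj (p : ℤ) u x| ≤ K * M) (hD : D.Regular δ c)
    (hW : ∀ i, D.MemVh (W i)) (hb : BoundedIterate Ω μ W) (e : Fin D.card) (x : Pt)
    (hx : x ∈ (D.elem e).carrier) (j : Fin m) : |D.P e (W j) x| ≤ K * (μ + 1) := by
  refine hK _ c (hD e) _ (μ + 1) (by linarith) ((hW j).memLp_restr e).1 ?_ x hx
  have h1 : ∀ᵐ x ∂(volume.restrict Ω), |W j x| ≤ μ + 1 := by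
    have h2 := ae_le_eLpNormEssSup (f := W j) (μ := volume.restrict Ω)
    rw [← eLpNorm_exponent_top] at h2
    filter_upwards [h2] with x hx
    have h3 := hx.trans (hb j)
    rw [← ofReal_norm, ENNReal.ofReal_le_ofReal_iff (by linarith)] at h3
    exact h3
  filter_upwards [Polygon.restr_ae_eq (E := D.elem e) (W j),
    ae_restrict_of_ae_restrict_of_subset (D.subset e) h1] with x hx1 hx2
  rwa [hx1]

end Discretization

/-! ### Induction on the time levels -/

theorem Discretization.exists_solvesUpTo {Ω : Set Pt} {p m : ℕ} {D : Discretization Ω p}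
    {a : Coefficients m} {dt : ℝ} {u0 : Fin m → Pt → ℝ} (hu0 : ∀ i, D.MemVh (u0 i)) (N : ℕ)
    (hstep : ∀ n < N, ∀ U : ℕ → Fin m → Pt → ℝ, D.SolvesUpTo a dt u0 n U →
      ∃ V, D.SolvesStep a dt ((n + 1 : ℕ) * dt) (U n) V) :
    ∃ U, D.SolvesUpTo a dt u0 N U := by
  induction N with
  | zero => exact ⟨fun _ => u0, fun i => ⟨hu0 i, .rfl⟩, fun k hk => absurd hk (Nat.not_lt_zero k)⟩
  | succ N ih =>
    obtain ⟨U, hU⟩ := ih fun n hn => hstep n (hn.trans N.lt_succ_self)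
    obtain ⟨V, hV⟩ := hstep N N.lt_succ_self U hU
    have hne : ∀ k ≤ N, Function.update U (N + 1) V k = U k := fun k hk =>
      Function.update_of_ne (by omega) _ _
    refine ⟨Function.update U (N + 1) V, ?_, fun k hk => ?_⟩
    · rw [hne 0 N.zero_le]
      exact hU.1
    · rcases Nat.lt_succ_iff_lt_or_eq.1 hk with hk | rfl
      · rw [hne k hk.le, hne (k + 1) hk]
        exact hU.2 k hk
      · rw [hne k le_rfl, Function.update_self]
        exact hV

theorem Discretization.SolvesUpTo.mono {Ω : Set Pt} {p m : ℕ} {D : Discretization Ω p}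
    {a : Coefficients m} {dt : ℝ} {u0 : Fin m → Pt → ℝ} {U : ℕ → Fin m → Pt → ℝ} {k n : ℕ}
    (h : D.SolvesUpTo a dt u0 n U) (hk : k ≤ n) : D.SolvesUpTo a dt u0 k U :=
  ⟨h.1, fun j hj => h.2 j (hj.trans_le hk)⟩

theorem Discretization.SolvesUpTo.memVh {Ω : Set Pt} {p m : ℕ} {D : Discretization Ω p}
    {a : Coefficients m} {dt : ℝ} {u0 : Fin m → Pt → ℝ} {U : ℕ → Fin m → Pt → ℝ} {n : ℕ}
    (h : D.SolvesUpTo a dt u0 n U) {k : ℕ} (hk : k ≤ n) (i : Fin m) : D.MemVh (U k i) := by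
  cases k with
  | zero => exact (h.1 i).1
  | succ k => exact (h.2 k hk).1 i

end VEM

end

theorem mainTheorem2 (Ω : Set VEM.Pt) (hΩo : IsOpen Ω) (hΩb : Bornology.IsBounded Ω)
    (hΩc : IsConnected Ω) (T : ℝ) (hT : 0 < T) (m p : ℕ) (hp : 1 ≤ p)
    (a : VEM.Coefficients m) (ha : a.Admissible Ω T)
    (δ c : ℝ) (hδ : 0 < δ) (hc : 0 < c)
    (αl αu βl βu : ℝ) (hαl : 0 < αl) (hαu : αl ≤ αu) (hβl : 0 < βl) (hβu : βl ≤ βu)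
    (μ : ℝ) (hμ : 0 < μ) :
    ∃ dt₀ : ℝ, 0 < dt₀ ∧
      ∀ D : VEM.Discretization Ω p, D.Regular δ c → D.Stable αl αu βl βu →
      ∀ N : ℕ, 0 < N → T / N < dt₀ →
        (∀ n : ℕ, 1 ≤ n → n ≤ N →
          ∀ W : Fin m → VEM.Pt → ℝ, (∀ i, D.MemVh (W i)) → VEM.BoundedIterate Ω μ W →
            ∃ U : Fin m → VEM.Pt → ℝ, D.SolvesStep a (T / N) (n * (T / N)) W U ∧
              ∀ U' : Fin m → VEM.Pt → ℝ, D.SolvesStep a (T / N) (n * (T / N)) W U' →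
                ∀ i, U' i =ᵐ[volume.restrict Ω] U i) ∧
        (∀ u0 : Fin m → VEM.Pt → ℝ, (∀ i, D.MemVh (u0 i)) →
          (∀ n : ℕ, n < N → ∀ U : ℕ → Fin m → VEM.Pt → ℝ,
            D.SolvesUpTo a (T / N) u0 n U → VEM.BoundedIterate Ω μ (U n)) →
          ∃ U : ℕ → Fin m → VEM.Pt → ℝ, D.SolvesUpTo a (T / N) u0 N U ∧
            ∀ U' : ℕ → Fin m → VEM.Pt → ℝ, D.SolvesUpTo a (T / N) u0 N U' →
              ∀ k : ℕ, k ≤ N → ∀ i, U' k i =ᵐ[volume.restrict Ω] U k i) := by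
  obtain ⟨ξ₀, hξ₀, B, hB⟩ := ha
  obtain ⟨K, hK0, hK⟩ := VEM.Polygon.exists_abs_l2Proj_le (p : ℤ) hδ
  set C := B ^ 2 / (4 * ξ₀) + m * |B| * (K * (μ + 1)) + |B| with hCdef
  have hC0 : 0 ≤ C := by positivity
  -- `C + 1` instead of `C`, since `C` may vanish
  refine ⟨1 / (C + 1), by positivity, fun D hD hS N hN hdt => ?_⟩
  have hN0 : (0 : ℝ) < N := by exact_mod_cast hN
  have hdt0 : 0 ≤ T / N := by positivity
  have hdtC : T / N * C < 1 := by
    rw [lt_div_iff₀ (by positivity)] at hdt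
    linarith
  have hBt : ∀ n : ℕ, n ≤ N → a.BoundedAt Ω ξ₀ B (n * (T / N)) := fun n hn =>
    hB _ ⟨by positivity, by
      have hn' : (n : ℝ) ≤ N := by exact_mod_cast hn
      calc (n : ℝ) * (T / N) ≤ N * (T / N) := by gcongr
        _ = T := by field_simp⟩
  have hstep : ∀ n : ℕ, n ≤ N →
      ∀ W : Fin m → VEM.Pt → ℝ, (∀ i, D.MemVh (W i)) → VEM.BoundedIterate Ω μ W →
        ∃ U : Fin m → VEM.Pt → ℝ, D.SolvesStep a (T / N) (n * (T / N)) W U ∧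
          ∀ U' : Fin m → VEM.Pt → ℝ, D.SolvesStep a (T / N) (n * (T / N)) W U' →
            ∀ i, U' i =ᵐ[volume.restrict Ω] U i := fun n hn W hW hWb =>
    VEM.Discretization.exists_solvesStep hΩo hp hS hαl hβl hξ₀ (hBt n hn)
      (VEM.Discretization.abs_P_le hμ hK hD hW hWb) hdt0 hdtC hW
  refine ⟨fun n _ hn => hstep n hn, fun u0 hu0 hbd => ?_⟩
  obtain ⟨U, hU⟩ := VEM.Discretization.exists_solvesUpTo (a := a) (dt := T / N) hu0 N
    fun n hn U hU => (hstep (n + 1) hn (U n) (hU.memVh le_rfl) (hbd n hn U hU)).imp fun _ h => h.1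
  refine ⟨U, hU, fun U' hU' k => ?_⟩
  induction k with
  | zero => exact fun _ i => (hU'.1 i).2.trans (hU.1 i).2.symm
  | succ k ih =>
    intro hk i
    have hk' : k ≤ N := (Nat.le_succ k).trans hk
    obtain ⟨V, -, hV⟩ := hstep (k + 1) hk (U k) (hU.memVh hk') (hbd k hk U (hU.mono hk'))
    have h1 := (hU'.2 k hk).congr hΩo hS hαl hξ₀ (hBt (k + 1) hk) (hU'.memVh hk') (hU.memVh hk')
      (ih hk')
    exact (hV _ h1 i).trans (hV _ (hU.2 k hk) i).symm
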